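/- Let $E=\ell^2(\mathbb Z)$ (complex scalars), let $\Omega=BDO(E)$ be the operator-norm closure of the bounded operators with banded matrix, and $\mathbb N=\{1,2,\dots\}$. For $p\in\mathbb N$ let $\Omega_T^p$ be the set of bi-infinite tridiagonal matrices $T$ with entries in $\mathbb C^{p\times p}$ whose diagonals $\alpha_j=t_{j+1,j}$, $\beta_j=t_{j,j}$, $\gamma_j=t_{j-1,j}$ are bounded. Matrices carry the operator norm for Euclidean norms, $\nu(B)=\min_{\|x\|=1}\|Bx\|$, and $T^*$ has entries $(T^*)_{i,j}=t_{j,i}^{T}$. For $n\in\mathbb N$, $k\in\mathbb Z$ let $T^+_{n,k}$ be the $(n+2)\times n$ block matrix of the rows $k,\dots,k+n+1$ and columns $k+1,\dots,k+n$ of $T$, and let $I_n^+$ be the corresponding submatrix of the identity. For $A=[a_{i,j}]\in\Omega$ let $A^{(n)}$ be the banded operator with entries $(1-\frac{|i-j|}{n+1})a_{i,j}$ for $|i-j|\le n$ and $0$ otherwise, and let $A_n\in\Omega_T^n$ be $A^{(n)}$ written in $n\times n$ blocks, the $i$-th block of indices being $ni+1,\dots,n(i+1)$. Input maps. Let the following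 be given. - $\mathcal A_p:\Omega_T^p\times\mathbb N\to P(\mathbb Z)$ with $\mathcal A_p(T,n)$ a finite set such that for every $k\in\mathbb Z$ there is $j\in\mathcal A_p(T,n)$ with $\|T^+_{n,k}-T^+_{n,j}\|\le\frac1n$ and $\|(T^*)^+_{n,k}-(T^*)^+_{n,j}\|\le\frac1n$. - $\mathcal B_p:\Omega_T^p\to\mathbb R^3$, $T\mapsto(\alpha_{\max},\beta_{\max},\gamma_{\max})$, upper bounds for $\|\alpha\|_\infty,\|\beta\|_\infty,\|\gamma\|_\infty$. - $\mathcal C_p(T,k,n)=(T^+_{n,k},(T^*)^+_{n,k})$. - $\mathcal D=(\mathcal D_1,\mathcal D_2)$ on $\Omega\times\mathbb N$, with $\mathcal D_1(A,n)=A_n$ and $\mathcal D_2(A,n)=\eta_n\ge\|A-A^{(n)}\|$, where $\eta_n\to0$ as $n\to\infty$. For $A\in\Omega$ and $n\in\mathbb N$ put $K_n=\mathcal A_n(A_n,n)$, $(\alpha_{\max},\beta_{\max},\gamma_{\max})=\mathcal B_n(A_n)$, $R_n=\alpha_{\max}+\beta_{\max}+\gamma_{\max}+\eta_n$, $\varepsilon_n^*=(\alpha_{\max}+\gamma_{\max})\frac{22}{7(n+1)}$,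 and let $\Gamma^n_{\rm fin}(A)$ be the set of all $\lambda\in\frac1n(\mathbb Z+i\mathbb Z)\cap R_n\mathbb D$, $\mathbb D$ being the open unit disc, such that $$\min_{k\in K_n}\min\big(\nu((A_n)^+_{n,k}-\lambda I_n^+),\ \nu((A_n^*)^+_{n,k}-\lambda I_n^+)\big)\le\varepsilon_n^*+\tfrac3n+\eta_n,\qquad \widehat\Gamma^n_{\rm fin}(A)=\Gamma^n_{\rm fin}(A)+\tfrac2n\overline{\mathbb D}.$$ Theorem. 1. $\Gamma^n_{\rm fin}(A)$ is a finite set that can be computed in finitely many arithmetic operations and comparisons of real numbers from $\eta_n$, $K_n$, $(\alpha_{\max},\beta_{\max},\gamma_{\max})$ and $\mathcal C_n(A_n,k,n)$, $k\in K_n$. One Blum-Shub-Smale machine does this for all $A$, all $n$ and all choices of the input maps. 2. $\operatorname{Spec}A\subset\widehat\Gamma^n_{\rm fin}(A)$ for all $A\in\Omega$, $n\in\mathbb N$. 3. If $A\in\Omega$ is such that the sequence $(R_n)$ is bounded, then $\Gamma^n_{\rm fin}(A)\to\operatorname{Spec}A$ and $\widehat\Gamma^n_{\rm fin}(A)\to\operatorname{Spec}A$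 in the Hausdorff distance as $n\to\infty$. 4. The set of functions $\Lambda=\{\mathcal A_n(\cdot,n)\circ\mathcal D_1(\cdot,n),\ \mathcal B_n\circ\mathcal D_1(\cdot,n),\ \mathcal C_n(\cdot,k,n)\circ\mathcal D_1(\cdot,n),\ \mathcal D_2(\cdot,n):k\in\mathbb Z,\ n\in\mathbb N\}$ separates the points of $\Omega$, and $A\mapsto\Gamma^n_{\rm fin}(A)$, $A\mapsto\widehat\Gamma^n_{\rm fin}(A)$ are general algorithms with evaluation set $\Lambda$: each value depends on finitely many evaluations of $A$, and the choice of these evaluations is itself determined by their values. If $(R_n)$ is bounded for every $A\in\Omega$, then the computational problem of finding $\operatorname{Spec}A$, for $A\in\Omega$, in the non-empty compact subsets of $\mathbb C$ with the Hausdorff metric and with evaluation set $\Lambda$, has arithmetic solvability complexity index equal to one, and is in the class $\Pi_1^A$. Here an arithmetic tower of height $k$ is a family of general algorithms $\Gamma_{n_k,\dots,n_1}$ that one Blum-Shub-Smale machine computes from $n_k,\dots,n_1$ and calls to evaluations in $\Lambda$, the output being a finite list of closed discs (of radius $0$ for single points), such that $\lim_{n_k}\cdots\lim_{n_1}\Gamma_{n_k,\dots,n_1}(A)=\operatorname{Spec}A$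 for all $A$. The index is the least height of such a tower, height $0$ meaning exact computation. The class $\Pi_1^A$ consists of the problems of index at most one with a tower $(\Gamma_n)$ of height one and compact sets $X_n(A)\supset\operatorname{Spec}A$ with $d_H(X_n(A),\Gamma_n(A))\le2^{-n}$ for all $A$ and $n$. -/

import Mathlib

open Filter Topology
open scoped Pointwise Matrix.Norms.L2Operator

namespace BandSpec

/-! ### Band-dominated operators on `ℓ²(ℤ)` -/

/-- The Hilbert space `ℓ²(ℤ)` of square-summable bi-infinite complex sequences. -/
abbrev E : Type := lp (fun _ : ℤ => ℂ) 2

/-- The standard basis vector `e_j`. -/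
noncomputable def basisVec (j : ℤ) : E := lp.single 2 j (1 : ℂ)

/-- The matrix entry `a_{i,j} = (A e_j)_i`. -/
noncomputable def entry (A : E →L[ℂ] E) (i j : ℤ) : ℂ := (A (basisVec j) : ℤ → ℂ) i

/-- `A ∈ BO(E)`: the matrix of `A` is banded with some band-width `w`. -/
def IsBanded (A : E →L[ℂ] E) : Prop :=
  ∃ w : ℕ, ∀ i j : ℤ, (w : ℤ) < |i - j| → entry A i j = 0

/-- `Ω = BDO(E)`: the band-dominated operators, the operator-norm closure of the banded ones. -/
def BDO : Type := {A : E →L[ℂ] E // A ∈ closure {B : E →L[ℂ] E | IsBanded B}}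

lemma norm_basisVec (j : ℤ) : ‖basisVec j‖ = 1 := by
  simp [basisVec, lp.norm_single]

lemma norm_entry_le (A : E →L[ℂ] E) (i j : ℤ) : ‖entry A i j‖ ≤ ‖A‖ := by
  calc ‖entry A i j‖ ≤ ‖A (basisVec j)‖ := lp.norm_apply_le_norm (by norm_num) _ i
    _ ≤ ‖A‖ * ‖basisVec j‖ := A.le_opNorm _
    _ = ‖A‖ := by rw [norm_basisVec, mul_one]

instance : Nontrivial E :=
  ⟨⟨basisVec 0, 0, fun h => by simpa [h] using norm_basisVec 0⟩⟩

/-! ### The banded approximations `A⁽ⁿ⁾` -/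

/-- The entries `a⁽ⁿ⁾_{i,j}` of the banded approximation: the diagonal at distance `|i - j| ≤ n`
is multiplied by `1 - |i - j| / (n + 1)`, the other diagonals are dropped. -/
noncomputable def bandEntry (A : E →L[ℂ] E) (n : ℕ) (i j : ℤ) : ℂ :=
  if |i - j| ≤ (n : ℤ) then ((1 - (|i - j| : ℤ) / ((n : ℝ) + 1) : ℝ) : ℂ) * entry A i j else 0

lemma norm_bandEntry_le (A : E →L[ℂ] E) (n : ℕ) (i j : ℤ) : ‖bandEntry A n i j‖ ≤ ‖A‖ := by
  unfold bandEntry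
  split_ifs with h
  · have h0 : (0 : ℝ) ≤ (|i - j| : ℤ) := by exact_mod_cast abs_nonneg (i - j)
    have h1 : ((|i - j| : ℤ) : ℝ) ≤ n := by exact_mod_cast h
    have hn : (0 : ℝ) < (n : ℝ) + 1 := by positivity
    have h2 : ((|i - j| : ℤ) : ℝ) / ((n : ℝ) + 1) ≤ 1 := by
      rw [div_le_one hn]; linarith
    have h3 : 0 ≤ ((|i - j| : ℤ) : ℝ) / ((n : ℝ) + 1) := by positivity
    rw [norm_mul, Complex.norm_real, Real.norm_eq_abs, abs_of_nonneg (by linarith)]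
    calc _ ≤ 1 * ‖entry A i j‖ := by gcongr; linarith
      _ ≤ ‖A‖ := by rw [one_mul]; exact norm_entry_le A i j
  · simp

lemma memlp_weightedShift (c : ℤ → ℂ) (d : ℤ) {C : ℝ} (hC : ∀ i, ‖c i‖ ≤ C) (x : E) :
    Memℓp (fun i : ℤ => c i * (x : ℤ → ℂ) (i + d)) 2 := by
  have hx : Summable fun i : ℤ => ‖(x : ℤ → ℂ) i‖ ^ (2 : ENNReal).toReal :=
    (lp.memℓp x).summable (by norm_num)
  have hx' : Summable fun i : ℤ => ‖(x : ℤ → ℂ) (i + d)‖ ^ (2 : ENNReal).toReal :=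
    (Equiv.addRight d).summable_iff.mpr hx
  refine memℓp_gen (Summable.of_nonneg_of_le (fun i => by positivity) (fun i => ?_)
    (hx'.mul_left (C ^ (2 : ENNReal).toReal)))
  have hC0 : 0 ≤ C := (norm_nonneg _).trans (hC i)
  rw [norm_mul, Real.mul_rpow (norm_nonneg _) (norm_nonneg _)]
  gcongr
  exact hC i

/-- The weighted shift `(W x)_i = c_i x_{i + d}`, for a sequence `c` bounded by `C`. -/
noncomputable def weightedShift (c : ℤ → ℂ) (d : ℤ) (C : ℝ) (hC : ∀ i, ‖c i‖ ≤ C) : E →L[ℂ] E :=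
  LinearMap.mkContinuous
    { toFun := fun x => ⟨fun i => c i * (x : ℤ → ℂ) (i + d), memlp_weightedShift c d hC x⟩
      map_add' := fun x y => by
        ext i
        change c i * ((x : ℤ → ℂ) (i + d) + (y : ℤ → ℂ) (i + d)) = _
        rw [mul_add]; rfl
      map_smul' := fun r x => by
        ext i; simp [mul_left_comm] } C
    (fun x => by
      have hC0 : 0 ≤ C := (norm_nonneg _).trans (hC 0)
      have h2 : (0 : ℝ) < (2 : ENNReal).toReal := by norm_num
      refine lp.norm_le_of_forall_sum_le h2 (by positivity) fun s => ?_
      have hx := lp.sum_rpow_le_norm_rpow h2 x (s.map (Equiv.addRight d).toEmbedding)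
      rw [Finset.sum_map] at hx
      rw [Real.mul_rpow hC0 (norm_nonneg _)]
      refine le_trans ?_ (mul_le_mul_of_nonneg_left hx (by positivity))
      rw [Finset.mul_sum]
      refine Finset.sum_le_sum fun i _ => ?_
      simp only [LinearMap.coe_mk, AddHom.coe_mk]
      rw [norm_mul, Real.mul_rpow (norm_nonneg _) (norm_nonneg _)]
      simp only [Equiv.coe_toEmbedding, Equiv.coe_addRight]
      gcongr
      exact hC i)

/-- The banded approximation `A⁽ⁿ⁾ ∈ BO(E)`, the operator with matrix `bandEntry A n`,
written as the sum of its `2 n + 1` diagonals. -/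
noncomputable def bandApprox (A : E →L[ℂ] E) (n : ℕ) : E →L[ℂ] E :=
  ∑ d ∈ Finset.Icc (-(n : ℤ)) n,
    weightedShift (fun i => bandEntry A n i (i + d)) d ‖A‖ (fun i => norm_bandEntry_le A n i (i + d))

lemma entry_bandApprox (A : E →L[ℂ] E) (n : ℕ) (i j : ℤ) :
    entry (bandApprox A n) i j = bandEntry A n i j := by
  have h : entry (bandApprox A n) i j =
      ∑ d ∈ Finset.Icc (-(n : ℤ)) n,
        bandEntry A n i (i + d) * (basisVec j : ℤ → ℂ) (i + d) := by
    simp only [entry, bandApprox, sum_apply, lp.coeFn_sum, Finset.sum_apply]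
    rfl
  rw [h]
  have h1 : ∀ d : ℤ, bandEntry A n i (i + d) * (basisVec j : ℤ → ℂ) (i + d) =
      if d = j - i then bandEntry A n i j else 0 := by
    intro d
    by_cases hd : d = j - i
    · subst hd; simp [basisVec]
    · rw [if_neg hd, basisVec, lp.single_apply_ne _ _ _ (by omega), mul_zero]
  simp only [h1, Finset.sum_ite_eq', Finset.mem_Icc]
  split_ifs with h2
  · rfl
  · rw [bandEntry, if_neg]
    rw [abs_le]; omega

/-! ### Tridiagonal block matrices -/

/-- `Ω_T^p`: the tridiagonal bi-infinite matrices whose entries are complex `p × p` matrices, with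
`α_j = a_{j+1,j}`, `β_j = a_{j,j}`, `γ_j = a_{j-1,j}` bounded sequences; `p × p` matrices carry the
operator norm of the Euclidean space `ℂ^p`. -/
structure TriMatrix (p : ℕ) where
  α : ℤ → Matrix (Fin p) (Fin p) ℂ
  β : ℤ → Matrix (Fin p) (Fin p) ℂ
  γ : ℤ → Matrix (Fin p) (Fin p) ℂ
  bdd_α : BddAbove (Set.range fun j => ‖α j‖)
  bdd_β : BddAbove (Set.range fun j => ‖β j‖)
  bdd_γ : BddAbove (Set.range fun j => ‖γ j‖)

lemma norm_transpose_le {p : ℕ} (M : Matrix (Fin p) (Fin p) ℂ) {C : ℝ} (h : ‖M‖ ≤ C) :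
    ‖M.transpose‖ ≤ ∑ _s : Fin p, ∑ _t : Fin p, C * ‖Matrix.single _s _t (1 : ℂ)‖ := by
  rw [Matrix.matrix_eq_sum_single M.transpose]
  refine (norm_sum_le _ _).trans (Finset.sum_le_sum fun s _ => (norm_sum_le _ _).trans
    (Finset.sum_le_sum fun t _ => ?_))
  have h1 : Matrix.single s t (M.transpose s t) = M t s • Matrix.single s t (1 : ℂ) := by simp
  have h2 : ‖M t s‖ ≤ ‖M‖ := by
    have h3 := Matrix.l2_opNorm_mulVec M (EuclideanSpace.single s (1 : ℂ))
    have h4 := (PiLp.norm_apply_le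
      (WithLp.toLp 2 (M.mulVec (EuclideanSpace.single s (1 : ℂ)).ofLp)) t).trans h3
    simpa using h4
  rw [h1, norm_smul]
  gcongr
  exact h2.trans h

namespace TriMatrix

variable {p : ℕ}

/-- The matrix of the (Banach space) adjoint: `(A^*)_{i,j} = (a_{j,i})ᵀ`. -/
def adjoint (T : TriMatrix p) : TriMatrix p where
  α j := (T.γ (j + 1)).transpose
  β j := (T.β j).transpose
  γ j := (T.α (j - 1)).transpose
  bdd_α := by
    obtain ⟨C, hC⟩ := T.bdd_γ
    exact ⟨_, by rintro _ ⟨j, rfl⟩; exact norm_transpose_le _ (hC ⟨j + 1, rfl⟩)⟩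
  bdd_β := by
    obtain ⟨C, hC⟩ := T.bdd_β
    exact ⟨_, by rintro _ ⟨j, rfl⟩; exact norm_transpose_le _ (hC ⟨j, rfl⟩)⟩
  bdd_γ := by
    obtain ⟨C, hC⟩ := T.bdd_α
    exact ⟨_, by rintro _ ⟨j, rfl⟩; exact norm_transpose_le _ (hC ⟨j - 1, rfl⟩)⟩

/-- The entry (a `p × p` matrix) in row `i` and column `j`. -/
def blockAt (T : TriMatrix p) (i j : ℤ) : Matrix (Fin p) (Fin p) ℂ :=
  if i = j + 1 then T.α j else if i = j then T.β j else if i = j - 1 then T.γ j else 0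

/-- `A⁺_{n,k}`: the `(n+2) × n` block matrix formed by the rows `k, …, k+n+1` and the columns
`k+1, …, k+n`. -/
def plus (T : TriMatrix p) (n : ℕ) (k : ℤ) : Matrix (Fin (n + 2) × Fin p) (Fin n × Fin p) ℂ :=
  Matrix.of fun r c => T.blockAt (k + (r.1 : ℕ)) (k + 1 + (c.1 : ℕ)) r.2 c.2

end TriMatrix

/-- `I⁺_n`: the `n × n` block identity between a zero block row above and one below. -/
def idPlus (p n : ℕ) : Matrix (Fin (n + 2) × Fin p) (Fin n × Fin p) ℂ :=
  Matrix.of fun r c => if (r.1 : ℕ) = (c.1 : ℕ) + 1 ∧ r.2 = c.2 then 1 else 0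

/-- The lower norm `ν(B) = inf {‖B x‖ : ‖x‖ = 1}`, for Euclidean norms. -/
noncomputable def lowerNorm {m n : Type} [Fintype m] [Fintype n] [DecidableEq n]
    (B : Matrix m n ℂ) : ℝ :=
  ⨅ x : Metric.sphere (0 : EuclideanSpace ℂ n) 1, ‖Matrix.toEuclideanLin B x‖

/-- `μ_n^fin(A - λ I)`, the minimum over `k ∈ K` of
`min (ν(A⁺_{n,k} - λ I⁺_n), ν((A^*)⁺_{n,k} - λ I⁺_n))`. -/
noncomputable def muFin {p : ℕ} (T : TriMatrix p) (K : Finset ℤ) (n : ℕ) (z : ℂ) : ℝ :=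
  ⨅ k : K, min (lowerNorm (T.plus n k - z • idPlus p n))
    (lowerNorm (T.adjoint.plus n k - z • idPlus p n))

/-- `Γ_ε^{n,fin}(A)`. -/
noncomputable def GammaEps {p : ℕ} (T : TriMatrix p) (K : Finset ℤ) (n : ℕ) (ε : ℝ) : Set ℂ :=
  {z | muFin T K n z ≤ ε}

/-- `Grid(n, r) = (1/n)(ℤ + iℤ) ∩ r𝔻`, with `𝔻` the open unit disc. -/
def Grid (n : ℕ) (r : ℝ) : Set ℂ :=
  {z | ∃ a b : ℤ, z = ((a : ℂ) + (b : ℂ) * Complex.I) / (n : ℂ)} ∩ r • Metric.ball (0 : ℂ) 1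

/-- The `b × b` block in block row `i` and block column `j` of a bi-infinite scalar matrix, the
`i`-th block of indices being `b i + 1, …, b (i + 1)`. -/
def blockOf (a : ℤ → ℤ → ℂ) (b : ℕ) (i j : ℤ) : Matrix (Fin b) (Fin b) ℂ :=
  Matrix.of fun s t => a (b * i + (s : ℕ) + 1) (b * j + (t : ℕ) + 1)

lemma bdd_blockOf {a : ℤ → ℤ → ℂ} {C : ℝ} (h : ∀ i j, ‖a i j‖ ≤ C) (b : ℕ) (f g : ℤ → ℤ) :
    BddAbove (Set.range fun j => ‖blockOf a b (f j) (g j)‖) := by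
  refine ⟨∑ s : Fin b, ∑ t : Fin b, C * ‖Matrix.single s t (1 : ℂ)‖, ?_⟩
  rintro _ ⟨j, rfl⟩
  simp only
  rw [Matrix.matrix_eq_sum_single (blockOf a b (f j) (g j))]
  refine (norm_sum_le _ _).trans (Finset.sum_le_sum fun s _ => (norm_sum_le _ _).trans
    (Finset.sum_le_sum fun t _ => ?_))
  have h1 : Matrix.single s t (blockOf a b (f j) (g j) s t) =
      blockOf a b (f j) (g j) s t • Matrix.single s t (1 : ℂ) := by simp
  rw [h1, norm_smul]
  gcongr
  exact h _ _

/-- `A_n = 𝓘_n A⁽ⁿ⁾ 𝓘_n⁻¹`, the matrix of `A⁽ⁿ⁾` written in `n × n` blocks; this is the first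
component of the mapping `𝓓`. (All blocks off the three central diagonals vanish, because `A⁽ⁿ⁾` has
band-width `n`.) -/
noncomputable def toTri (A : BDO) (n : ℕ) : TriMatrix n where
  α j := blockOf (bandEntry A.1 n) n (j + 1) j
  β j := blockOf (bandEntry A.1 n) n j j
  γ j := blockOf (bandEntry A.1 n) n (j - 1) j
  bdd_α := bdd_blockOf (norm_bandEntry_le A.1 n) n (fun j => j + 1) (fun j => j)
  bdd_β := bdd_blockOf (norm_bandEntry_le A.1 n) n (fun j => j) (fun j => j)
  bdd_γ := bdd_blockOf (norm_bandEntry_le A.1 n) n (fun j => j - 1) (fun j => j)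

/-! ### The input maps and the approximations to the spectrum -/

/-- The input maps `𝓐_p`, `𝓑_p` and `𝓓₂`, which are any maps with the listed properties. (The maps
`𝓒_p`, `(A, n, k) ↦ (A⁺_{n,k}, (A^*)⁺_{n,k})`, and `𝓓₁`, `(A, n) ↦ A_n`, are determined.) -/
structure InputMaps where
  /-- `𝓐_p (A, n) = K_n` -/
  K : ∀ p : ℕ, TriMatrix p → ℕ → Finset ℤ
  K_spec : ∀ (p : ℕ) (T : TriMatrix p) (n : ℕ), 0 < n → ∀ k : ℤ, ∃ j ∈ K p T n,
    ‖T.plus n k - T.plus n j‖ ≤ 1 / (n : ℝ) ∧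
      ‖T.adjoint.plus n k - T.adjoint.plus n j‖ ≤ 1 / (n : ℝ)
  /-- `𝓑_p (A) = (α_max, β_max, γ_max)` -/
  αmax : ∀ p : ℕ, TriMatrix p → ℝ
  βmax : ∀ p : ℕ, TriMatrix p → ℝ
  γmax : ∀ p : ℕ, TriMatrix p → ℝ
  le_αmax : ∀ (p : ℕ) (T : TriMatrix p) (j : ℤ), ‖T.α j‖ ≤ αmax p T
  le_βmax : ∀ (p : ℕ) (T : TriMatrix p) (j : ℤ), ‖T.β j‖ ≤ βmax p T
  le_γmax : ∀ (p : ℕ) (T : TriMatrix p) (j : ℤ), ‖T.γ j‖ ≤ γmax p T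
  /-- `𝓓₂ (A, n) = η_n` -/
  η : BDO → ℕ → ℝ
  η_nonneg : ∀ (A : BDO) (n : ℕ), 0 < n → 0 ≤ η A n
  le_η : ∀ (A : BDO) (n : ℕ), 0 < n → ‖A.1 - bandApprox A.1 n‖ ≤ η A n
  η_tendsto : ∀ A : BDO, Tendsto (η A) atTop (𝓝 0)

namespace InputMaps

/-- `K_n = 𝓐_n (A_n, n)`. -/
noncomputable def Kset (𝓘 : InputMaps) (A : BDO) (n : ℕ) : Finset ℤ := 𝓘.K n (toTri A n) n

/-- `R_n = α_max + β_max + γ_max + η_n`, with `(α_max, β_max, γ_max) = 𝓑_n (A_n)`. -/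
noncomputable def R (𝓘 : InputMaps) (A : BDO) (n : ℕ) : ℝ :=
  𝓘.αmax n (toTri A n) + 𝓘.βmax n (toTri A n) + 𝓘.γmax n (toTri A n) + 𝓘.η A n

/-- `ε_n^* (A_n) = (α_max + γ_max) · 22 / (7 (n + 1))`. -/
noncomputable def εstar (𝓘 : InputMaps) (A : BDO) (n : ℕ) : ℝ :=
  (𝓘.αmax n (toTri A n) + 𝓘.γmax n (toTri A n)) * (22 / (7 * ((n : ℝ) + 1)))

/-- `Γⁿ_fin(A)`. -/
noncomputable def GammaFin (𝓘 : InputMaps) (A : BDO) (n : ℕ) : Set ℂ :=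
  GammaEps (toTri A n) (𝓘.Kset A n) n (𝓘.εstar A n + 3 / (n : ℝ) + 𝓘.η A n) ∩ Grid n (𝓘.R A n)

/-- `Γ̂ⁿ_fin(A) = Γⁿ_fin(A) + (2/n) 𝔻̄`. -/
noncomputable def GammaHat (𝓘 : InputMaps) (A : BDO) (n : ℕ) : Set ℂ :=
  𝓘.GammaFin A n + (2 / (n : ℝ)) • Metric.closedBall (0 : ℂ) 1

end InputMaps

/-! ### A machine model for exact real arithmetic with an oracle -/

/-- Finite data: binary trees with real numbers at the leaves. -/
inductive Data where
  | num (x : ℝ)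
  | pair (a b : Data)

namespace Data

/-- A finite list, as nested pairs closed by the number `0`. -/
def ofList : List Data → Data
  | [] => num 0
  | d :: l => pair d (ofList l)

/-- A complex number, as the pair of its real and imaginary parts. -/
def ofComplex (z : ℂ) : Data := pair (num z.re) (num z.im)

/-- A complex matrix, as the list of its rows, each the list of its entries; rows and columns are
in the lexicographic order of their (block, position in the block) index pairs. -/
def ofMatrix {a b c d : ℕ} (M : Matrix (Fin a × Fin b) (Fin c × Fin d) ℂ) : Data :=
  ofList (List.ofFn fun r : Fin (a * b) => ofList (List.ofFn fun s : Fin (c * d) =>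
    ofComplex (M (finProdFinEquiv.symm r) (finProdFinEquiv.symm s))))

/-- A finite set of integers, as the increasing list of its elements. -/
noncomputable def ofIntFinset (K : Finset ℤ) : Data :=
  ofList ((K.sort (· ≤ ·)).map fun k => num (k : ℝ))

/-- A finite list of complex numbers. -/
def ofPoints (l : List ℂ) : Data := ofList (l.map ofComplex)

/-- A finite list of closed discs, each given by its centre and radius. -/
def ofDiscs (l : List (ℂ × ℝ)) : Data := ofList (l.map fun q => pair (ofComplex q.1) (num q.2))

/-- A tuple of natural numbers. -/
noncomputable def ofNats {k : ℕ} (v : Fin k → ℕ) : Data :=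
  ofList (List.ofFn fun i => num (v i : ℝ))

end Data

/-- Programs of a Blum-Shub-Smale machine over `ℝ` with an oracle, in structured form: exact field
operations, sign tests, loops, rearrangement of finite data, real machine constants, and oracle
calls. -/
inductive Program where
  | id
  | const (x : ℝ)
  | fst
  | snd
  | pair (f g : Program)
  | comp (f g : Program)
  | add
  | sub
  | mul
  | div
  | isPair
  | cond (t f g : Program)
  | loop (t f : Program)
  | query

/-- `Runs O c d r`: started on the data `d`, the program `c` halts with the result `r`, after
finitely many operations (a derivation is a finite record of them), when its oracle answers `r'` to
the query `d'` exactly if `O d' r'`. There is no result when the machine does not halt, divides by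
zero, meets ill-formed data, or asks a query to which the oracle has no answer. -/
inductive Runs (O : Data → Data → Prop) : Program → Data → Data → Prop where
  | id (d : Data) : Runs O .id d d
  | const (x : ℝ) (d : Data) : Runs O (.const x) d (.num x)
  | fst (a b : Data) : Runs O .fst (.pair a b) a
  | snd (a b : Data) : Runs O .snd (.pair a b) b
  | pair {f g : Program} {d a b : Data} :
      Runs O f d a → Runs O g d b → Runs O (.pair f g) d (.pair a b)
  | comp {f g : Program} {d a b : Data} :
      Runs O g d a → Runs O f a b → Runs O (.comp f g) d b
  | add (x y : ℝ) : Runs O .add (.pair (.num x) (.num y)) (.num (x + y))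
  | sub (x y : ℝ) : Runs O .sub (.pair (.num x) (.num y)) (.num (x - y))
  | mul (x y : ℝ) : Runs O .mul (.pair (.num x) (.num y)) (.num (x * y))
  | div (x y : ℝ) : y ≠ 0 → Runs O .div (.pair (.num x) (.num y)) (.num (x / y))
  | isPair_num (x : ℝ) : Runs O .isPair (.num x) (.num 0)
  | isPair_pair (a b : Data) : Runs O .isPair (.pair a b) (.num 1)
  | cond_pos {t f g : Program} {d r : Data} {x : ℝ} :
      Runs O t d (.num x) → 0 < x → Runs O f d r → Runs O (.cond t f g) d r
  | cond_nonpos {t f g : Program} {d r : Data} {x : ℝ} :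
      Runs O t d (.num x) → x ≤ 0 → Runs O g d r → Runs O (.cond t f g) d r
  | loop_stop {t f : Program} {d : Data} {x : ℝ} :
      Runs O t d (.num x) → x ≤ 0 → Runs O (.loop t f) d d
  | loop_step {t f : Program} {d d' r : Data} {x : ℝ} :
      Runs O t d (.num x) → 0 < x → Runs O f d d' → Runs O (.loop t f) d' r →
        Runs O (.loop t f) d r
  | query {d r : Data} : O d r → Runs O .query d r

/-! ### Computational problems, towers of algorithms, the solvability complexity index -/

/-- A computational problem with values in the non-empty compact subsets of `ℂ` (with the Hausdorff
metric): the problem function `Ξ` on `Ω` and the evaluation set, a family of functions on `Ω` whose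
values are finite strings of numbers; `name q` is the query by which a machine asks for `eval q`. -/
structure ComputationalProblem (Ω : Type) where
  Ξ : Ω → TopologicalSpace.NonemptyCompacts ℂ
  Query : Type
  name : Query → Data
  name_injective : Function.Injective name
  eval : Query → Ω → Data

/-- The set represented by a finite list of closed discs; a finite set of points is represented by
discs of radius `0`. -/
def discUnion (l : List (ℂ × ℝ)) : Set ℂ := {z | ∃ q ∈ l, z ∈ Metric.closedBall q.1 q.2}

/-- Iterated limits: `x = lim_{n_k} ⋯ lim_{n_1} f (n_k, …, n_1)`, all the limits existing. -/
def IterLim {M : Type} [TopologicalSpace M] : (k : ℕ) → ((Fin k → ℕ) → M) → M → Prop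
  | 0, f, x => f Fin.elim0 = x
  | k + 1, f, x => ∃ g : ℕ → M,
      (∀ m : ℕ, IterLim k (fun v => f (Fin.cons m v)) (g m)) ∧ Tendsto g atTop (𝓝 x)

namespace ComputationalProblem

variable {Ω : Type} (P : ComputationalProblem Ω)

/-- The requirement on an evaluation set: it determines the elements of `Ω`. -/
def Separates : Prop := ∀ A B : Ω, (∀ q, P.eval q A = P.eval q B) → A = B

/-- The oracle that gives access to the evaluations in `S` of the input `A`, and to nothing else. -/
def oracle (S : Set P.Query) (A : Ω) (d r : Data) : Prop :=
  ∃ q ∈ S, d = P.name q ∧ r = P.eval q A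

/-- `Γ` is a general algorithm: for every input `A` there is a finite non-empty set of evaluations
such that any input on which these evaluations agree with those of `A` has the same value of `Γ` and
the same set of evaluations. -/
def IsGeneralAlgorithm {β : Type} (Γ : Ω → β) : Prop :=
  ∃ S : Ω → Set P.Query, ∀ A : Ω, (S A).Finite ∧ (S A).Nonempty ∧
    ∀ B : Ω, (∀ q ∈ S A, P.eval q B = P.eval q A) → Γ B = Γ A ∧ S B = S A

/-- An arithmetic tower of algorithms of height `k`, with lowest functions `Γ_{n_k, …, n_1}`: these
are general algorithms, one machine computes all of them (given `n_k, …, n_1` and access to the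
evaluations of `A`), its output being a finite list of closed discs, and the iterated limit is
`Ξ(A)`. A tower of height `0` is a single algorithm that computes `Ξ` exactly. -/
structure IsArithmeticTower (k : ℕ)
    (Γ : (Fin k → ℕ) → Ω → TopologicalSpace.NonemptyCompacts ℂ) : Prop where
  general : ∀ v, P.IsGeneralAlgorithm (Γ v)
  computable : ∃ c : Program, ∀ v A, ∃ l : List (ℂ × ℝ),
    Runs (P.oracle Set.univ A) c (Data.ofNats v) (Data.ofDiscs l) ∧
      (Γ v A : Set ℂ) = discUnion l
  limit : ∀ A, IterLim k (fun v => Γ v A) (P.Ξ A)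

/-- The arithmetic solvability complexity index: the least height of an arithmetic tower. -/
noncomputable def SCI : ℕ∞ := sInf {m | ∃ k : ℕ, m = k ∧ ∃ Γ, P.IsArithmeticTower k Γ}

/-- The class `Π₁^A`: problems of arithmetic index at most one that have an arithmetic tower
`(Γ_n)` of height one and sets `X_n(A)` with `Ξ(A) ⊆ X_n(A)` and `d(X_n(A), Γ_n(A)) ≤ 2⁻ⁿ`. -/
def InPiOne : Prop :=
  P.SCI ≤ 1 ∧ ∃ Γ : (Fin 1 → ℕ) → Ω → TopologicalSpace.NonemptyCompacts ℂ,
    P.IsArithmeticTower 1 Γ ∧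
      ∃ X : ℕ → Ω → TopologicalSpace.NonemptyCompacts ℂ, ∀ (n : ℕ) (A : Ω),
        (P.Ξ A : Set ℂ) ⊆ (X n A : Set ℂ) ∧ dist (X n A) (Γ (fun _ => n) A) ≤ (2 : ℝ)⁻¹ ^ n

end ComputationalProblem

/-! ### The spectral problem for band-dominated operators -/

/-- The evaluations: `𝓐_n(·, n) ∘ 𝓓₁`, `𝓑_n ∘ 𝓓₁`, `𝓒_n(·, k, n) ∘ 𝓓₁` and `𝓓₂(·, n)`, for
positive `n` and integer `k`. -/
inductive SpecQuery where
  | cover (n : ℕ+)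
  | bounds (n : ℕ+)
  | sub (k : ℤ) (n : ℕ+)
  | error (n : ℕ+)

namespace SpecQuery

/-- A query, as data: a tag followed by `n`, or by `k` and `n`. -/
noncomputable def name : SpecQuery → Data
  | cover n => .pair (.num 0) (.num (n : ℕ))
  | bounds n => .pair (.num 1) (.num (n : ℕ))
  | sub k n => .pair (.num 2) (.pair (.num k) (.num (n : ℕ)))
  | error n => .pair (.num 3) (.num (n : ℕ))

lemma name_injective : Function.Injective name := by
  rintro (a | a | ⟨k, a⟩ | a) (b | b | ⟨l, b⟩ | b) h <;> simp_all [name]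

/-- The values of the evaluations. -/
noncomputable def eval (𝓘 : InputMaps) : SpecQuery → BDO → Data
  | cover n, A => .ofIntFinset (𝓘.Kset A n)
  | bounds n, A => .pair (.num (𝓘.αmax n (toTri A n)))
      (.pair (.num (𝓘.βmax n (toTri A n))) (.num (𝓘.γmax n (toTri A n))))
  | sub k n, A => .pair (.ofMatrix ((toTri A n).plus n k)) (.ofMatrix ((toTri A n).adjoint.plus n k))
  | error n, A => .num (𝓘.η A n)

end SpecQuery

/-- The spectrum as a non-empty compact subset of `ℂ`. -/
noncomputable def specCompact (A : E →L[ℂ] E) : TopologicalSpace.NonemptyCompacts ℂ where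
  carrier := spectrum ℂ A
  isCompact' := spectrum.isCompact A
  nonempty' := spectrum.nonempty A

/-- The computational problem `{Ξ, Ω, ℂ^C, Λ}` with `Ξ(A) = Spec A`, for `A ∈ Ω = BDO(E)`. -/
noncomputable def spectralProblem (𝓘 : InputMaps) : ComputationalProblem BDO where
  Ξ A := specCompact A.1
  Query := SpecQuery
  name := SpecQuery.name
  name_injective := SpecQuery.name_injective
  eval := SpecQuery.eval 𝓘

/-- The evaluations used in the computation of `Γⁿ_fin(A)`: `K_n`, `(α_max, β_max, γ_max)`, `η_n` and
the pairs of rectangular submatrices for `k ∈ K_n`. -/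
def neededQueries (𝓘 : InputMaps) (A : BDO) (n : ℕ+) : Set (spectralProblem 𝓘).Query :=
  {SpecQuery.cover n, SpecQuery.bounds n, SpecQuery.error n} ∪
    {q | ∃ k ∈ 𝓘.Kset A n, q = SpecQuery.sub k n}

end BandSpec

/-! The inclusion rests on averaging over windows. A point `μ` of the spectrum has approximate
eigenvectors of `A` or of its transpose (`approxEigen_of_mem_spectrum`), hence, up to `η_n`, of the
banded approximation, which is block tridiagonal. Multiply such a vector `x` by sine weights
supported on the `n` blocks after `k`. Moving the weights past the tridiagonal matrix leaves only
the two off-diagonals, multiplied by differences of neighbouring weights. Squared norms, summed over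
all `k`, give `∑ w²` times `‖x‖²` for the cut-off vectors, and the sine weights keep the commutator
terms below `(α_max + γ_max) π / (n + 1)` in relative size. So some window has a small lower norm
(`HasBlocks.exists_lowerNorm_le`). Replacing this window by one from `K_n` costs `1 / n`, and
replacing `μ` by a grid point costs `2 / n`.

Conversely, a vector on a window, extended by zero, has an image supported in the `n + 2` rows of
the rectangular submatrix. A small lower norm is therefore a genuine approximate eigenvector,
without truncation error (`HasBlocks.exists_norm_le`). Such points are close to the spectrum,
uniformly on bounded sets, because the resolvent is bounded on compact sets away from the spectrum
(`exists_dist_spectrum_le`). With bounded `R_n` the thresholds tend to `0`, and convergence follows.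

The set is computable without roots or eigenvalues: `ε < ν(B)` says that `Bᴴ B - ε²` is positive
definite, which division-free elimination decides by the signs of the pivots (`leadingPosDef_succ`,
`lowerFlag_pos_iff`). The values asked for first determine which further values are asked for, so
the maps are general algorithms (`eq_of_eval_eq`). Along `n = 2 ^ (m + 1)` the discs have radius
`2⁻ᵐ`, which gives membership in `Π₁^A`. Height `0` is impossible, because the spectrum of the
diagonal operator with entries `1 / (1 + |i|)` is real and infinite, hence no finite union of discs.
-/

namespace BandSpec

/-! ### A library of machine-computable functions -/

/-- Types whose elements are encoded as finite data. -/
class Enc (X : Type) where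
  enc : X → Data

open Enc

noncomputable instance : Enc ℝ := ⟨Data.num⟩
noncomputable instance : Enc ℕ := ⟨fun n => Data.num (n : ℝ)⟩
noncomputable instance : Enc ℂ := ⟨Data.ofComplex⟩
instance {X Y : Type} [Enc X] [Enc Y] : Enc (X × Y) := ⟨fun q => .pair (enc q.1) (enc q.2)⟩
instance {X : Type} [Enc X] : Enc (List X) := ⟨fun l => Data.ofList (l.map enc)⟩

/-- A function on encoded data that one machine without oracle computes. -/
def BSSComp {X Y : Type} [Enc X] [Enc Y] (f : X → Y) : Prop :=
  ∃ c : Program, ∀ (O : Data → Data → Prop) (x : X), Runs O c (enc x) (enc (f x))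

/-- The loop that replaces the state `(d, j, s)` by `(d, j - 1, c (d, j - 1, s))` while `0 < j`. -/
noncomputable def Program.countdown (c : Program) : Program :=
  .loop (.comp .fst .snd) (.pair .fst
    (.pair (.comp .sub (.pair (.comp .fst .snd) (.const 1)))
      (.comp c (.pair .fst (.pair (.comp .sub (.pair (.comp .fst .snd) (.const 1)))
        (.comp .snd .snd))))))

/-- The counter takes the values `N - 1, …, 0`, the order in which `foldr` consumes `List.range N`
from its right end. -/
lemma runs_countdown {O : Data → Data → Prop} {S : Type} [Enc S] (c : Program) (d : Data)
    (step : ℕ → S → S)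
    (hc : ∀ j s, Runs O c (.pair d (.pair (enc j) (enc s))) (enc (step j s))) (N : ℕ) (s : S) :
    Runs O c.countdown (.pair d (.pair (enc N) (enc s)))
      (.pair d (.pair (enc 0) (enc ((List.range N).foldr step s)))) := by
  induction N generalizing s with
  | zero =>
    refine Runs.loop_stop (x := ((0 : ℕ) : ℝ)) (.comp (.snd _ _) (.fst _ _)) (by simp)
  | succ N ih =>
    rw [List.range_succ, List.foldr_append]
    have h1 : Runs O (.comp .sub (.pair (.comp .fst .snd) (.const 1)))
        (.pair d (.pair (enc (N + 1)) (enc s))) (enc N) := by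
      have h2 : (enc N : Data) = .num (((N + 1 : ℕ) : ℝ) - 1) := by
        change Data.num (N : ℝ) = _
        push_cast; congr 1; ring
      rw [h2]
      exact .comp (.pair (.comp (.snd _ _) (.fst _ _)) (.const _ _)) (.sub _ _)
    refine Runs.loop_step (x := ((N + 1 : ℕ) : ℝ)) (d' := .pair d (.pair (enc N) (enc (step N s))))
      (.comp (.snd _ _) (.fst _ _)) (by positivity) ?_ (ih _)
    exact .pair (.fst _ _) (.pair h1 (.comp (.pair (.fst _ _) (.pair h1 (.comp (.snd _ _)
      (.snd _ _)))) (hc _ _)))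

/-- The loop that replaces the state `(d, a :: l, s)` by `(d, l, c (d, a, s))`. -/
noncomputable def Program.listLoop (c : Program) : Program :=
  .loop (.comp .isPair (.comp .fst .snd)) (.pair .fst
    (.pair (.comp .snd (.comp .fst .snd))
      (.comp c (.pair .fst (.pair (.comp .fst (.comp .fst .snd)) (.comp .snd .snd))))))

/-- `isPair` is the test for a non-empty list. The step is required to run only for members of `l`,
so that it may call an oracle that answers for these members alone. -/
lemma runs_listLoop {O : Data → Data → Prop} {X S : Type} [Enc X] [Enc S] (c : Program) (d : Data)
    (step : S → X → S) (l : List X)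
    (hc : ∀ a ∈ l, ∀ s, Runs O c (.pair d (.pair (enc a) (enc s))) (enc (step s a))) (s : S) :
    Runs O c.listLoop (.pair d (.pair (enc l) (enc s)))
      (.pair d (.pair (.num 0) (enc (l.foldl step s)))) := by
  induction l generalizing s with
  | nil =>
    refine Runs.loop_stop (x := 0) (.comp (.comp (.snd _ _) (.fst _ _)) (.isPair_num _)) le_rfl
  | cons a l ih =>
    have h0 : Runs O (.comp .fst .snd) (.pair d (.pair (enc (a :: l)) (enc s)))
        (.pair (enc a) (enc l)) := .comp (.snd _ _) (.fst _ _)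
    refine Runs.loop_step (x := 1) (d' := .pair d (.pair (enc l) (enc (step s a))))
      (.comp h0 (.isPair_pair _ _)) one_pos ?_
      (ih (fun b hb => hc b (List.mem_cons_of_mem _ hb)) _)
    exact .pair (.fst _ _) (.pair (.comp h0 (.snd _ _)) (.comp (.pair (.fst _ _) (.pair
      (.comp h0 (.fst _ _)) (.comp (.snd _ _) (.snd _ _)))) (hc a List.mem_cons_self _)))

namespace BSSComp

variable {X Y Z S : Type} [Enc X] [Enc Y] [Enc Z] [Enc S]

lemma id : BSSComp (fun x : X => x) := ⟨.id, fun _ _ => .id _⟩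

lemma comp {f : Y → Z} {g : X → Y} (hf : BSSComp f) (hg : BSSComp g) :
    BSSComp (fun x => f (g x)) := by
  obtain ⟨c, hc⟩ := hf
  obtain ⟨e, he⟩ := hg
  exact ⟨.comp c e, fun O x => .comp (he O x) (hc O _)⟩

lemma pair {f : X → Y} {g : X → Z} (hf : BSSComp f) (hg : BSSComp g) :
    BSSComp (fun x => (f x, g x)) := by
  obtain ⟨c, hc⟩ := hf
  obtain ⟨e, he⟩ := hg
  exact ⟨.pair c e, fun O x => .pair (hc O x) (he O x)⟩

lemma fst {f : X → Y × Z} (hf : BSSComp f) : BSSComp (fun x => (f x).1) :=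
  comp (f := fun q : Y × Z => q.1) ⟨.fst, fun _ _ => .fst _ _⟩ hf

lemma snd {f : X → Y × Z} (hf : BSSComp f) : BSSComp (fun x => (f x).2) :=
  comp (f := fun q : Y × Z => q.2) ⟨.snd, fun _ _ => .snd _ _⟩ hf

lemma const (r : ℝ) : BSSComp (fun _ : X => r) := ⟨.const r, fun _ _ => .const _ _⟩

lemma add {f g : X → ℝ} (hf : BSSComp f) (hg : BSSComp g) : BSSComp (fun x => f x + g x) :=
  comp (f := fun q : ℝ × ℝ => q.1 + q.2) ⟨.add, fun _ _ => .add _ _⟩ (pair hf hg)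

lemma sub {f g : X → ℝ} (hf : BSSComp f) (hg : BSSComp g) : BSSComp (fun x => f x - g x) :=
  comp (f := fun q : ℝ × ℝ => q.1 - q.2) ⟨.sub, fun _ _ => .sub _ _⟩ (pair hf hg)

lemma mul {f g : X → ℝ} (hf : BSSComp f) (hg : BSSComp g) : BSSComp (fun x => f x * g x) :=
  comp (f := fun q : ℝ × ℝ => q.1 * q.2) ⟨.mul, fun _ _ => .mul _ _⟩ (pair hf hg)

lemma ite {t : X → ℝ} {f g : X → Y} (ht : BSSComp t) (hf : BSSComp f) (hg : BSSComp g) :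
    BSSComp (fun x => if 0 < t x then f x else g x) := by
  obtain ⟨a, ha⟩ := ht
  obtain ⟨b, hb⟩ := hf
  obtain ⟨c, hc⟩ := hg
  refine ⟨.cond a b c, fun O x => ?_⟩
  beta_reduce
  split_ifs with h
  · exact .cond_pos (ha O x) h (hb O x)
  · exact .cond_nonpos (ha O x) (not_lt.mp h) (hc O x)

/-- A division by zero gives no result, and the only test is for positivity: hence the test of `r *
r`, and the value `0` that `0⁻¹` has by convention. -/
lemma inv {f : X → ℝ} (hf : BSSComp f) : BSSComp (fun x => (f x)⁻¹) := by
  refine comp (f := fun r : ℝ => r⁻¹) ⟨.cond (.comp .mul (.pair .id .id))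
    (.comp .div (.pair (.const 1) .id)) (.const 0), fun O r => ?_⟩ hf
  have h0 : Runs O (.comp .mul (.pair .id .id)) (.num r) (.num (r * r)) :=
    .comp (.pair (.id _) (.id _)) (.mul _ _)
  by_cases h : r = 0
  · subst h
    refine .cond_nonpos h0 (by simp) ?_
    beta_reduce
    rw [inv_zero]
    exact .const 0 _
  · refine .cond_pos h0 (mul_self_pos.mpr h) (.comp (.pair (.const _ _) (.id _)) ?_)
    have := Runs.div (O := O) 1 r h
    rwa [one_div] at this

lemma div {f g : X → ℝ} (hf : BSSComp f) (hg : BSSComp g) : BSSComp (fun x => f x / g x) := by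
  simpa only [div_eq_mul_inv] using hf.mul hg.inv

/-- A natural number and its cast have the same code, so arithmetic on `ℕ` is inherited from `ℝ`. -/
lemma natCast {f : X → ℕ} (hf : BSSComp f) : BSSComp (fun x => (f x : ℝ)) := hf

lemma natConst (k : ℕ) : BSSComp (fun _ : X => k) := const (X := X) (k : ℝ)

lemma natAdd {f g : X → ℕ} (hf : BSSComp f) (hg : BSSComp g) : BSSComp (fun x => f x + g x) := by
  obtain ⟨c, hc⟩ := add hf.natCast hg.natCast
  refine ⟨c, fun O x => ?_⟩
  have := hc O x
  beta_reduce at this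
  rwa [← Nat.cast_add] at this

lemma natMul {f g : X → ℕ} (hf : BSSComp f) (hg : BSSComp g) : BSSComp (fun x => f x * g x) := by
  obtain ⟨c, hc⟩ := mul hf.natCast hg.natCast
  refine ⟨c, fun O x => ?_⟩
  have := hc O x
  beta_reduce at this
  rwa [← Nat.cast_mul] at this

lemma re {f : X → ℂ} (hf : BSSComp f) : BSSComp (fun x => (f x).re) :=
  comp (f := Complex.re) ⟨.fst, fun _ _ => .fst _ _⟩ hf

lemma im {f : X → ℂ} (hf : BSSComp f) : BSSComp (fun x => (f x).im) :=
  comp (f := Complex.im) ⟨.snd, fun _ _ => .snd _ _⟩ hf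

lemma mkComplex {f g : X → ℝ} (hf : BSSComp f) (hg : BSSComp g) :
    BSSComp (fun x => (⟨f x, g x⟩ : ℂ)) := by
  obtain ⟨c, hc⟩ := hf
  obtain ⟨e, he⟩ := hg
  exact ⟨.pair c e, fun O x => .pair (hc O x) (he O x)⟩

lemma ofReal {f : X → ℝ} (hf : BSSComp f) : BSSComp (fun x => (f x : ℂ)) :=
  hf.mkComplex (const 0)

lemma cadd {f g : X → ℂ} (hf : BSSComp f) (hg : BSSComp g) : BSSComp (fun x => f x + g x) :=
  (hf.re.add hg.re).mkComplex (hf.im.add hg.im)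

lemma csub {f g : X → ℂ} (hf : BSSComp f) (hg : BSSComp g) : BSSComp (fun x => f x - g x) := by
  have h : (fun x => f x - g x) = fun x => ⟨(f x).re - (g x).re, (f x).im - (g x).im⟩ := by
    funext x; apply Complex.ext <;> simp
  rw [h]
  exact (hf.re.sub hg.re).mkComplex (hf.im.sub hg.im)

lemma cmul {f g : X → ℂ} (hf : BSSComp f) (hg : BSSComp g) : BSSComp (fun x => f x * g x) :=
  ((hf.re.mul hg.re).sub (hf.im.mul hg.im)).mkComplex ((hf.re.mul hg.im).add (hf.im.mul hg.re))

lemma cconj {f : X → ℂ} (hf : BSSComp f) : BSSComp (fun x => (starRingEnd ℂ) (f x)) := by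
  have h : (fun x => (starRingEnd ℂ) (f x)) = fun x => ⟨(f x).re, 0 - (f x).im⟩ := by
    funext x; apply Complex.ext <;> simp
  rw [h]
  exact hf.re.mkComplex ((const 0).sub hf.im)

lemma nil : BSSComp (fun _ : X => ([] : List Y)) := ⟨.const 0, fun _ _ => .const _ _⟩

lemma cons {f : X → Y} {l : X → List Y} (hf : BSSComp f) (hl : BSSComp l) :
    BSSComp (fun x => f x :: l x) := by
  obtain ⟨c, hc⟩ := hf
  obtain ⟨e, he⟩ := hl
  exact ⟨.pair c e, fun O x => .pair (hc O x) (he O x)⟩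

lemma tail {l : X → List Y} (hl : BSSComp l) : BSSComp (fun x => (l x).tail) := by
  refine comp (f := fun l : List Y => l.tail) ⟨.cond .isPair .snd .id, fun O l => ?_⟩ hl
  cases l with
  | nil => exact .cond_nonpos (.isPair_num _) le_rfl (.id _)
  | cons a l => exact .cond_pos (.isPair_pair _ _) one_pos (.snd _ _)

lemma headD {l : X → List Y} {d : Y} (hl : BSSComp l) (hd : BSSComp (fun _ : List Y => d)) :
    BSSComp (fun x => (l x).headD d) := by
  obtain ⟨c, hc⟩ := hd
  refine comp (f := fun l : List Y => l.headD d) ⟨.cond .isPair .fst c, fun O l => ?_⟩ hl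
  cases l with
  | nil => exact .cond_nonpos (.isPair_num _) le_rfl (hc O [])
  | cons a l => exact .cond_pos (.isPair_pair _ _) one_pos (.fst _ _)

lemma foldr_range {N : X → ℕ} {init : X → S} {step : X → ℕ → S → S} (hN : BSSComp N)
    (hi : BSSComp init) (hs : BSSComp (fun q : X × ℕ × S => step q.1 q.2.1 q.2.2)) :
    BSSComp (fun x => (List.range (N x)).foldr (step x) (init x)) := by
  obtain ⟨a, ha⟩ := hN
  obtain ⟨b, hb⟩ := hi
  obtain ⟨c, hc⟩ := hs
  refine ⟨.comp (.comp .snd .snd) (.comp c.countdown (.pair .id (.pair a b))), fun O x => ?_⟩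
  exact .comp (.comp (.pair (.id _) (.pair (ha O x) (hb O x))) (runs_countdown c (enc x) (step x)
    (fun j s => hc O (x, j, s)) _ _)) (.comp (.snd _ _) (.snd _ _))

lemma foldl {l : X → List Y} {init : X → S} {step : X → S → Y → S} (hl : BSSComp l)
    (hi : BSSComp init) (hs : BSSComp (fun q : X × Y × S => step q.1 q.2.2 q.2.1)) :
    BSSComp (fun x => (l x).foldl (step x) (init x)) := by
  obtain ⟨a, ha⟩ := hl
  obtain ⟨b, hb⟩ := hi
  obtain ⟨c, hc⟩ := hs
  refine ⟨.comp (.comp .snd .snd) (.comp c.listLoop (.pair .id (.pair a b))), fun O x => ?_⟩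
  exact .comp (.comp (.pair (.id _) (.pair (ha O x) (hb O x))) (runs_listLoop c (enc x) (step x) _
    (fun j _ s => hc O (x, j, s)) _)) (.comp (.snd _ _) (.snd _ _))

lemma iterate {N : X → ℕ} {init : X → S} {step : X → S → S} (hN : BSSComp N)
    (hi : BSSComp init) (hs : BSSComp (fun q : X × S => step q.1 q.2)) :
    BSSComp (fun x => (step x)^[N x] (init x)) := by
  have h : ∀ (g : S → S) (k : ℕ) (s : S), g^[k] s = (List.range k).foldr (fun _ => g) s := by
    intro g k
    induction k with
    | zero => intro s; rfl
    | succ k ih => intro s; rw [Function.iterate_succ_apply, ih, List.range_succ]; simp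
  simp only [h]
  exact foldr_range (step := fun x _ => step x) hN hi
    (comp (f := fun q : X × S => step q.1 q.2) hs (id.fst.pair id.snd.snd))

lemma map_range {N : X → ℕ} {g : X → ℕ → Y} (hN : BSSComp N)
    (hg : BSSComp (fun q : X × ℕ => g q.1 q.2)) :
    BSSComp (fun x => (List.range (N x)).map (g x)) := by
  have h : ∀ x, (List.range (N x)).map (g x) =
      (List.range (N x)).foldr (fun j (l : List Y) => g x j :: l) [] := by
    intro x
    induction List.range (N x) <;> simp_all
  simp only [h]
  exact foldr_range (step := fun x j l => g x j :: l) hN nil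
    ((comp (f := fun q : X × ℕ => g q.1 q.2) hg (id.fst.pair id.snd.fst)).cons id.snd.snd)

lemma sum_range {N : X → ℕ} {g : X → ℕ → ℂ} (hN : BSSComp N)
    (hg : BSSComp (fun q : X × ℕ => g q.1 q.2)) :
    BSSComp (fun x => ∑ j ∈ Finset.range (N x), g x j) := by
  have h : ∀ x k, ∑ j ∈ Finset.range k, g x j =
      (List.range k).foldr (fun j (s : ℂ) => g x j + s) 0 := by
    intro x k
    rw [← List.foldr_map (g := fun (a s : ℂ) => a + s), ← List.sum_eq_foldr,
      Finset.sum_eq_multiset_sum]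
    simp [Multiset.range]
  simp only [h]
  exact foldr_range (step := fun x j s => g x j + s) hN (ofReal (const 0))
    ((comp (f := fun q : X × ℕ => g q.1 q.2) hg (id.fst.pair id.snd.fst)).cadd id.snd.snd)

lemma getD {l : X → List Y} {j : X → ℕ} {d : Y} (hl : BSSComp l) (hj : BSSComp j)
    (hd : BSSComp (fun _ : List Y => d)) : BSSComp (fun x => (l x).getD (j x) d) := by
  have h : ∀ (k : ℕ) (l : List Y), l.getD k d = (List.tail^[k] l).headD d := by
    intro k
    induction k with
    | zero => intro l; cases l <;> simp
    | succ k ih =>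
      intro l
      rw [Function.iterate_succ_apply, ← ih]
      cases l <;> simp
  simp only [h]
  exact headD (iterate (step := fun _ => List.tail) hj hl (tail id.snd)) hd

/-- The machine has no rounding operation; a counter is raised from `0` as long as it is below `r`.
-/
lemma natCeil {f : X → ℝ} (hf : BSSComp f) : BSSComp (fun x => ⌈f x⌉₊) := by
  refine comp (f := fun r : ℝ => ⌈r⌉₊) ⟨.comp .snd (.comp (.loop .sub (.pair .fst
    (.comp .add (.pair .snd (.const 1))))) (.pair .id (.const 0))), fun O r => ?_⟩ hf
  -- Here `m` is the present counter and `k` the number of rounds that remain.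
  suffices H : ∀ k m : ℕ, ⌈r⌉₊ = m + k → Runs O (.loop .sub (.pair .fst
      (.comp .add (.pair .snd (.const 1))))) (.pair (.num r) (.num (m : ℝ)))
        (.pair (.num r) (enc ⌈r⌉₊)) by
    have := H ⌈r⌉₊ 0 (by simp)
    rw [Nat.cast_zero] at this
    exact .comp (.comp (.pair (.id _) (.const _ _)) this) (.snd _ _)
  intro k
  induction k with
  | zero =>
    intro m hm
    rw [hm]
    have : r ≤ m := Nat.ceil_le.mp (by omega)
    exact Runs.loop_stop (.sub _ _) (by linarith)
  | succ k ih =>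
    intro m hm
    have h : (m : ℝ) < r := Nat.lt_ceil.mp (by omega)
    refine .loop_step (.sub _ _) (by linarith) (.pair (.fst _ _) (.comp (.pair (.snd _ _)
      (.const _ _)) (.add _ _))) ?_
    have := ih (m + 1) (by omega)
    rwa [Nat.cast_add, Nat.cast_one] at this

end BSSComp

/-! ### Lower norms and positive definiteness -/

/-- By compactness of the unit sphere the infimum is attained. Without a column the sphere would be
empty and the infimum `0` by convention. -/
lemma lowerNorm_le_iff {m n : Type} [Fintype m] [Fintype n] [DecidableEq n] [Nonempty n]
    (B : Matrix m n ℂ) (ε : ℝ) :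
    lowerNorm B ≤ ε ↔ ∃ x : EuclideanSpace ℂ n, ‖x‖ = 1 ∧ ‖Matrix.toEuclideanLin B x‖ ≤ ε := by
  have hne : Nonempty (Metric.sphere (0 : EuclideanSpace ℂ n) 1) :=
    ⟨⟨EuclideanSpace.single (Classical.arbitrary n) 1, by simp⟩⟩
  have hbdd : BddBelow (Set.range fun x : Metric.sphere (0 : EuclideanSpace ℂ n) 1 =>
      ‖Matrix.toEuclideanLin B x‖) := ⟨0, by rintro _ ⟨x, rfl⟩; exact norm_nonneg _⟩
  constructor
  · intro h
    have hc : Continuous fun x : EuclideanSpace ℂ n => ‖Matrix.toEuclideanLin B x‖ :=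
      (LinearMap.continuous_of_finiteDimensional _).norm
    obtain ⟨x, hx, hmin⟩ := (isCompact_sphere (0 : EuclideanSpace ℂ n) 1).exists_isMinOn
      ⟨_, hne.some.2⟩ hc.continuousOn
    refine ⟨x, by simpa using hx, le_trans ?_ h⟩
    exact le_ciInf fun y => hmin y.2
  · rintro ⟨x, hx, h⟩
    exact (ciInf_le hbdd ⟨x, by simpa using hx⟩).trans h

lemma lowerNorm_mul_norm_le {m n : Type} [Fintype m] [Fintype n] [DecidableEq n]
    (B : Matrix m n ℂ) (x : EuclideanSpace ℂ n) :
    lowerNorm B * ‖x‖ ≤ ‖Matrix.toEuclideanLin B x‖ := by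
  by_cases hx : x = 0
  · simp [hx]
  have hx' : 0 < ‖x‖ := norm_pos_iff.mpr hx
  have hbdd : BddBelow (Set.range fun x : Metric.sphere (0 : EuclideanSpace ℂ n) 1 =>
      ‖Matrix.toEuclideanLin B x‖) := ⟨0, by rintro _ ⟨x, rfl⟩; exact norm_nonneg _⟩
  have h := ciInf_le hbdd ⟨((‖x‖⁻¹ : ℝ) : ℂ) • x, by
    simp [norm_smul, hx'.ne']⟩
  simp only [map_smul, norm_smul, Complex.norm_real, norm_inv, norm_norm] at h
  rw [lowerNorm, ← le_div_iff₀ hx', div_eq_inv_mul]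
  exact h

/-- By homogeneity the normalisation can be dropped; squaring then leaves a quadratic inequality,
free of roots. -/
lemma exists_le_iff_exists_ne_zero {m n : Type} [Fintype m] [Fintype n] [DecidableEq n]
    (B : Matrix m n ℂ) {ε : ℝ} (hε : 0 ≤ ε) :
    (∃ x : EuclideanSpace ℂ n, ‖x‖ = 1 ∧ ‖Matrix.toEuclideanLin B x‖ ≤ ε) ↔
      ∃ x : n → ℂ, x ≠ 0 ∧ ∑ r, ‖(B.mulVec x) r‖ ^ 2 ≤ ε ^ 2 * ∑ s, ‖x s‖ ^ 2 := by
  have key : ∀ x : EuclideanSpace ℂ n, ‖Matrix.toEuclideanLin B x‖ ^ 2 =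
      ∑ r, ‖(B.mulVec x.ofLp) r‖ ^ 2 := fun x => by
    rw [EuclideanSpace.norm_sq_eq]; rfl
  constructor
  · rintro ⟨x, hx, h⟩
    refine ⟨x.ofLp, fun h0 => ?_, ?_⟩
    · have : x = 0 := by ext i; exact congrFun h0 i
      simp [this] at hx
    · rw [← key, ← EuclideanSpace.norm_sq_eq, hx, one_pow, mul_one]
      gcongr
  · rintro ⟨x, hx, h⟩
    set y : EuclideanSpace ℂ n := WithLp.toLp 2 x
    have hy : 0 < ‖y‖ := norm_pos_iff.mpr fun h0 => hx (by
      funext i; exact congrArg (fun v : EuclideanSpace ℂ n => v i) h0)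
    have h1 : ‖Matrix.toEuclideanLin B y‖ ≤ ε * ‖y‖ := by
      rw [← sq_le_sq₀ (norm_nonneg _) (by positivity), key, mul_pow, EuclideanSpace.norm_sq_eq]
      exact h
    refine ⟨((‖y‖⁻¹ : ℝ) : ℂ) • y, by simp [norm_smul, hy.ne'], ?_⟩
    simp only [map_smul, norm_smul, Complex.norm_real, norm_inv, norm_norm]
    rwa [← div_eq_inv_mul, div_le_iff₀ hy]

/-- The quadratic form with coefficients `h i j`, `i, j < m`. -/
noncomputable def quadForm (m : ℕ) (h : ℕ → ℕ → ℂ) (x : ℕ → ℂ) : ℂ :=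
  ∑ i ∈ Finset.range m, ∑ j ∈ Finset.range m, (starRingEnd ℂ) (x i) * h i j * x j

/-- Positive definiteness of the leading `m × m` submatrix. -/
def LeadingPosDef (m : ℕ) (h : ℕ → ℕ → ℂ) : Prop :=
  ∀ x : ℕ → ℂ, (∃ i < m, x i ≠ 0) → 0 < (quadForm m h x).re

/-- The leading `m × m` submatrix is Hermitian. -/
def LeadingHermitian (m : ℕ) (h : ℕ → ℕ → ℂ) : Prop :=
  ∀ i < m, ∀ j < m, h j i = (starRingEnd ℂ) (h i j)

/-- The Schur complement of the top left entry, multiplied by this entry. -/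
def schur (h : ℕ → ℕ → ℂ) (i j : ℕ) : ℂ := h 0 0 * h (i + 1) (j + 1) - h (i + 1) 0 * h 0 (j + 1)

lemma quadForm_congr {m : ℕ} {h h' : ℕ → ℕ → ℂ} (H : ∀ i < m, ∀ j < m, h i j = h' i j)
    (x : ℕ → ℂ) : quadForm m h x = quadForm m h' x :=
  Finset.sum_congr rfl fun i hi => Finset.sum_congr rfl fun j hj => by
    rw [H i (Finset.mem_range.mp hi) j (Finset.mem_range.mp hj)]

lemma leadingPosDef_congr {m : ℕ} {h h' : ℕ → ℕ → ℂ} (H : ∀ i < m, ∀ j < m, h i j = h' i j) :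
    LeadingPosDef m h ↔ LeadingPosDef m h' := by
  simp only [LeadingPosDef, quadForm_congr H]

lemma LeadingHermitian.congr {m : ℕ} {h h' : ℕ → ℕ → ℂ} (hh : LeadingHermitian m h)
    (H : ∀ i < m, ∀ j < m, h' i j = h i j) : LeadingHermitian m h' := fun i hi j hj => by
  rw [H i hi j hj, H j hj i hi, hh i hi j hj]

lemma LeadingHermitian.schur {m : ℕ} {h : ℕ → ℕ → ℂ} (hh : LeadingHermitian (m + 1) h) :
    LeadingHermitian m (schur h) := fun i hi j hj => by
  simp only [BandSpec.schur, map_sub, map_mul]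
  rw [← hh 0 (by omega) 0 (by omega), ← hh (i + 1) (by omega) (j + 1) (by omega),
    ← hh (i + 1) (by omega) 0 (by omega), ← hh 0 (by omega) (j + 1) (by omega)]
  ring

/-- Completion of the square in `x 0`, multiplied by the pivot `h 0 0` so that no division occurs.
-/
lemma mul_quadForm_succ {m : ℕ} {h : ℕ → ℕ → ℂ} (hh : LeadingHermitian (m + 1) h) (x : ℕ → ℂ) :
    h 0 0 * quadForm (m + 1) h x =
      (starRingEnd ℂ) (h 0 0 * x 0 + ∑ j ∈ Finset.range m, h 0 (j + 1) * x (j + 1)) *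
        (h 0 0 * x 0 + ∑ j ∈ Finset.range m, h 0 (j + 1) * x (j + 1)) +
      quadForm m (schur h) (fun i => x (i + 1)) := by
  have h1 : ∀ i ∈ Finset.range m, h (i + 1) 0 = (starRingEnd ℂ) (h 0 (i + 1)) := fun i hi =>
    hh 0 (by omega) (i + 1) (by simpa using hi)
  have h0 : (starRingEnd ℂ) (h 0 0) = h 0 0 := (hh 0 (by omega) 0 (by omega)).symm
  have hq : quadForm m (schur h) (fun i => x (i + 1)) =
      h 0 0 * quadForm m (fun i j => h (i + 1) (j + 1)) (fun i => x (i + 1)) -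
        (∑ i ∈ Finset.range m, (starRingEnd ℂ) (x (i + 1)) * h (i + 1) 0) *
          ∑ j ∈ Finset.range m, h 0 (j + 1) * x (j + 1) := by
    rw [quadForm, quadForm, Finset.sum_mul_sum, Finset.mul_sum, ← Finset.sum_sub_distrib]
    refine Finset.sum_congr rfl fun i _ => ?_
    rw [Finset.mul_sum, ← Finset.sum_sub_distrib]
    refine Finset.sum_congr rfl fun j _ => ?_
    simp only [schur]; ring
  have hs : quadForm (m + 1) h x = (starRingEnd ℂ) (x 0) * h 0 0 * x 0 +
      (starRingEnd ℂ) (x 0) * ∑ j ∈ Finset.range m, h 0 (j + 1) * x (j + 1) +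
      ((∑ i ∈ Finset.range m, (starRingEnd ℂ) (x (i + 1)) * h (i + 1) 0) * x 0 +
        quadForm m (fun i j => h (i + 1) (j + 1)) (fun i => x (i + 1))) := by
    simp only [quadForm, Finset.sum_range_succ', Finset.sum_add_distrib, Finset.mul_sum,
      Finset.sum_mul]
    simp only [mul_assoc]
    ring
  have hc : (starRingEnd ℂ) (∑ j ∈ Finset.range m, h 0 (j + 1) * x (j + 1)) =
      ∑ i ∈ Finset.range m, (starRingEnd ℂ) (x (i + 1)) * h (i + 1) 0 := by
    rw [map_sum]
    refine Finset.sum_congr rfl fun i hi => ?_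
    rw [h1 i hi, map_mul, mul_comm]
  rw [hs, hq, map_add, map_mul, h0, hc]
  ring

/-- The recursion behind the elimination: after the square is completed, the remaining form is that
of the Schur complement. -/
lemma leadingPosDef_succ {m : ℕ} {h : ℕ → ℕ → ℂ} (hh : LeadingHermitian (m + 1) h) :
    LeadingPosDef (m + 1) h ↔ 0 < (h 0 0).re ∧ LeadingPosDef m (schur h) := by
  have h0 : (h 0 0).im = 0 := by
    have := congrArg Complex.im (hh 0 (by omega) 0 (by omega))
    rw [Complex.conj_im] at this
    linarith
  have key : ∀ x : ℕ → ℂ, (h 0 0).re * (quadForm (m + 1) h x).re =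
      Complex.normSq (h 0 0 * x 0 + ∑ j ∈ Finset.range m, h 0 (j + 1) * x (j + 1)) +
      (quadForm m (schur h) (fun i => x (i + 1))).re := fun x => by
    have := congrArg Complex.re (mul_quadForm_succ hh x)
    rw [Complex.add_re, ← Complex.normSq_eq_conj_mul_self, Complex.ofReal_re, Complex.mul_re, h0,
      zero_mul, sub_zero] at this
    exact this
  constructor
  · intro H
    have hp : 0 < (h 0 0).re := by
      have := H (fun i => if i = 0 then 1 else 0) ⟨0, by omega, by simp⟩
      simpa [quadForm, Finset.sum_range_succ'] using this
    refine ⟨hp, fun x ⟨i, hi, hx⟩ => ?_⟩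
    have hne : h 0 0 ≠ 0 := fun h' => by simp [h'] at hp
    -- The entry `y 0` is chosen to make the completed square vanish, so that only the Schur
    -- complement remains.
    let y : ℕ → ℂ := fun i => if i = 0 then -(∑ j ∈ Finset.range m, h 0 (j + 1) * x j) / h 0 0
      else x (i - 1)
    have h1 := key y
    have h2 := H y ⟨i + 1, by omega, by simpa [y] using hx⟩
    have h3 : h 0 0 * y 0 + ∑ j ∈ Finset.range m, h 0 (j + 1) * y (j + 1) = 0 := by
      simp only [y, if_true, Nat.add_eq_zero_iff, one_ne_zero, and_false, if_false,
        Nat.add_sub_cancel]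
      field_simp
      ring
    rw [h3, map_zero, zero_add] at h1
    have h4 : (fun i => y (i + 1)) = x := by funext i; simp [y]
    rw [h4] at h1
    rw [← h1]
    positivity
  · rintro ⟨hp, H⟩ x ⟨i, hi, hx⟩
    have hne : h 0 0 ≠ 0 := fun h' => by simp [h'] at hp
    refine pos_of_mul_pos_right (a := (h 0 0).re) ?_ hp.le
    rw [key x]
    -- If all later coordinates vanish, the square of `h 0 0 * x 0` is positive; otherwise the Schur
    -- complement contributes a positive term.
    by_cases hy : ∃ j < m, x (j + 1) ≠ 0
    · exact add_pos_of_nonneg_of_pos (Complex.normSq_nonneg _) (H _ hy)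
    · push Not at hy
      have hx0 : x 0 ≠ 0 := by
        rcases i with _ | i
        · exact hx
        · exact absurd (hy i (by omega)) hx
      have h1 : ∑ j ∈ Finset.range m, h 0 (j + 1) * x (j + 1) = 0 :=
        Finset.sum_eq_zero fun j hj => by rw [hy j (by simpa using hj), mul_zero]
      have h2 : quadForm m (schur h) (fun i => x (i + 1)) = 0 :=
        Finset.sum_eq_zero fun j _ => Finset.sum_eq_zero fun k hk => by
          beta_reduce
          rw [hy k (by simpa using hk), mul_zero]
      rw [h1, h2, add_zero, Complex.zero_re, add_zero]
      exact Complex.normSq_pos.mpr (mul_ne_zero hne hx0)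

/-! ### The test for positive definiteness on lists of rows -/

/-- The entry of a list of rows. -/
def listEntry (M : List (List ℂ)) (i j : ℕ) : ℂ := (M.getD i []).getD j 0

/-- The `a × b` list of rows with given entries. -/
def listTable (a b : ℕ) (g : ℕ → ℕ → ℂ) : List (List ℂ) :=
  (List.range a).map fun i => (List.range b).map (g i)

lemma listEntry_listTable {a b : ℕ} (g : ℕ → ℕ → ℂ) {i j : ℕ} (hi : i < a) (hj : j < b) :
    listEntry (listTable a b g) i j = g i j := by
  simp [listEntry, listTable, List.getD_eq_getElem?_getD, hi, hj]

/-- One step of the elimination, with a flag that records whether all pivots were positive. -/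
noncomputable def schurStep (N : ℕ) (s : ℝ × List (List ℂ)) : ℝ × List (List ℂ) :=
  (if 0 < (listEntry s.2 0 0).re then s.1 else 0, listTable N N (schur (listEntry s.2)))

-- A flag once set to `0` stays `0`. The tables keep their size `N × N`, but each step makes one
-- more row and column meaningless: only the leading `m × m` part is controlled, hence `m ≤ N`.
open Classical in
lemma iterate_schurStep_fst (N m : ℕ) (hm : m ≤ N) (f : ℝ) (M : List (List ℂ))
    (hM : LeadingHermitian m (listEntry M)) :
    ((schurStep N)^[m] (f, M)).1 = if LeadingPosDef m (listEntry M) then f else 0 := by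
  induction m generalizing f M with
  | zero => rw [if_pos]; · rfl
            · rintro x ⟨i, hi, -⟩; omega
  | succ m ih =>
    have h1 : ∀ i < m, ∀ j < m, listEntry (listTable N N (schur (listEntry M))) i j =
        schur (listEntry M) i j := fun i hi j hj =>
      listEntry_listTable _ (by omega) (by omega)
    rw [Function.iterate_succ_apply, schurStep, ih (by omega) _ _ (hM.schur.congr h1),
      leadingPosDef_congr h1]
    simp only [leadingPosDef_succ hM]
    split_ifs <;> simp_all

/-- The flag is `1` if the leading `N × N` submatrix is positive definite and `0` if not. -/
noncomputable def posFlag (N : ℕ) (M : List (List ℂ)) : ℝ := ((schurStep N)^[N] (1, M)).1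

lemma posFlag_pos_iff {N : ℕ} {M : List (List ℂ)} (hM : LeadingHermitian N (listEntry M)) :
    0 < posFlag N M ↔ LeadingPosDef N (listEntry M) := by
  rw [posFlag, iterate_schurStep_fst N N le_rfl 1 M hM]
  split_ifs <;> simp_all

/-- The entries of `B - z I⁺`, for `n × n` blocks of size `n`. -/
noncomputable def shiftedEntry (n : ℕ) (M : List (List ℂ)) (z : ℂ) (r i : ℕ) : ℂ :=
  listEntry M r i - if r = i + n then z else 0

/-- The entries of `(B - z I⁺)ᴴ (B - z I⁺) - e I`. -/
noncomputable def gramEntry (n : ℕ) (M : List (List ℂ)) (z : ℂ) (e : ℝ) (i j : ℕ) : ℂ :=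
  ∑ r ∈ Finset.range ((n + 2) * n),
    (starRingEnd ℂ) (shiftedEntry n M z r i) * shiftedEntry n M z r j - if i = j then (e : ℂ) else 0

/-- Positive exactly if `e` is less than the squared lower norm of `B - z I⁺`. -/
noncomputable def lowerFlag (n : ℕ) (M : List (List ℂ)) (z : ℂ) (e : ℝ) : ℝ :=
  posFlag (n * n) (listTable (n * n) (n * n) (gramEntry n M z e))

lemma leadingHermitian_gramEntry (n N : ℕ) (M : List (List ℂ)) (z : ℂ) (e : ℝ) :
    LeadingHermitian N (gramEntry n M z e) := fun i _ j _ => by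
  simp only [gramEntry, map_sub, map_sum, map_mul, Complex.conj_conj]
  congr 1
  · exact Finset.sum_congr rfl fun r _ => mul_comm _ _
  · rw [apply_ite (starRingEnd ℂ), Complex.conj_ofReal, map_zero]
    exact if_congr eq_comm rfl rfl

/-- This is `xᴴ (Bᴴ B - e) x = ‖B x‖² - e ‖x‖²`, in coordinates. -/
lemma quadForm_gramEntry (n N : ℕ) (M : List (List ℂ)) (z : ℂ) (e : ℝ) (x : ℕ → ℂ) :
    quadForm N (gramEntry n M z e) x =
      ((∑ r ∈ Finset.range ((n + 2) * n),
        ‖∑ i ∈ Finset.range N, shiftedEntry n M z r i * x i‖ ^ 2 -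
        e * ∑ i ∈ Finset.range N, ‖x i‖ ^ 2 : ℝ) : ℂ) := by
  have hn : ∀ w : ℂ, ((‖w‖ ^ 2 : ℝ) : ℂ) = (starRingEnd ℂ) w * w := fun w => by
    rw [← Complex.normSq_eq_conj_mul_self, Complex.normSq_eq_norm_sq]
  rw [Complex.ofReal_sub, Complex.ofReal_mul, Complex.ofReal_sum, Complex.ofReal_sum]
  simp only [hn, map_sum, map_mul, Finset.sum_mul_sum]
  rw [Finset.sum_comm, Finset.mul_sum, quadForm, ← Finset.sum_sub_distrib]
  refine Finset.sum_congr rfl fun i hi => ?_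
  rw [Finset.sum_comm]
  simp only [gramEntry, mul_sub, sub_mul, Finset.sum_sub_distrib]
  congr 1
  · refine Finset.sum_congr rfl fun j _ => ?_
    rw [Finset.mul_sum, Finset.sum_mul]
    exact Finset.sum_congr rfl fun r _ => by ring
  · simp only [mul_ite, ite_mul, mul_zero, zero_mul, Finset.sum_ite_eq, hi, if_true]
    ring

/-- A matrix as the list of its rows. -/
def matrixRows {a b c d : ℕ} (M : Matrix (Fin a × Fin b) (Fin c × Fin d) ℂ) : List (List ℂ) :=
  List.ofFn fun r : Fin (a * b) => List.ofFn fun s : Fin (c * d) =>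
    M (finProdFinEquiv.symm r) (finProdFinEquiv.symm s)

lemma enc_matrixRows {a b c d : ℕ} (M : Matrix (Fin a × Fin b) (Fin c × Fin d) ℂ) :
    Enc.enc (matrixRows M) = Data.ofMatrix M := by
  change Data.ofList (List.map _ _) = _
  rw [matrixRows, List.map_ofFn]
  congr 2
  funext r
  change Data.ofList (List.map _ _) = _
  rw [List.map_ofFn]
  rfl

lemma listEntry_matrixRows {a b c d : ℕ} (M : Matrix (Fin a × Fin b) (Fin c × Fin d) ℂ)
    (r : Fin (a * b)) (s : Fin (c * d)) :
    listEntry (matrixRows M) r s = M (finProdFinEquiv.symm r) (finProdFinEquiv.symm s) := by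
  simp [listEntry, matrixRows, List.getD_eq_getElem?_getD]

/-- In the lexicographic numbering one block row down means adding the block size `n`, so the two
conditions in `idPlus` merge into the single equation `r = s + n`. -/
lemma shiftedEntry_matrixRows {n : ℕ} (M : Matrix (Fin (n + 2) × Fin n) (Fin n × Fin n) ℂ) (z : ℂ)
    (r : Fin ((n + 2) * n)) (s : Fin (n * n)) :
    shiftedEntry n (matrixRows M) z r s =
      (M - z • idPlus n n) (finProdFinEquiv.symm r) (finProdFinEquiv.symm s) := by
  rw [shiftedEntry, listEntry_matrixRows]
  obtain ⟨⟨r1, r2⟩, rfl⟩ := finProdFinEquiv.surjective r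
  obtain ⟨⟨s1, s2⟩, rfl⟩ := finProdFinEquiv.surjective s
  simp only [Equiv.symm_apply_apply, Matrix.sub_apply, Matrix.smul_apply, idPlus, Matrix.of_apply,
    smul_eq_mul, mul_ite, mul_one, mul_zero, finProdFinEquiv_apply_val]
  congr 1
  refine if_congr ⟨fun h => ?_, fun ⟨h1, h2⟩ => ?_⟩ rfl rfl
  · have hn : 0 < n := r2.pos
    -- Quotient and remainder modulo `n` recover the block number and the position in the block.
    have h' : (r2 : ℕ) + n * r1 = s2 + n * (s1 + 1) := by rw [h]; ring
    have e1 := congrArg (· / n) h'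
    have e2 := congrArg (· % n) h'
    simp [Nat.add_mul_div_left, Nat.div_eq_of_lt, hn, r2.2, s2.2] at e1
    simp [Nat.mod_eq_of_lt, r2.2, s2.2] at e2
    exact ⟨e1, Fin.ext e2⟩
  · rw [h1, h2]; ring

/-- Failure of positive definiteness of `Bᴴ B - ε²` means a nonzero `x` with `‖B x‖ ≤ ε ‖x‖`; for `0
≤ ε` this can be read off from squares. -/
lemma lowerFlag_pos_iff {n : ℕ} (hn : 0 < n)
    (M : Matrix (Fin (n + 2) × Fin n) (Fin n × Fin n) ℂ) (z : ℂ) {ε : ℝ} (hε : 0 ≤ ε) :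
    0 < lowerFlag n (matrixRows M) z (ε ^ 2) ↔ ε < lowerNorm (M - z • idPlus n n) := by
  have : NeZero n := ⟨hn.ne'⟩
  have ht : ∀ i < n * n, ∀ j < n * n,
      listEntry (listTable (n * n) (n * n) (gramEntry n (matrixRows M) z (ε ^ 2))) i j =
        gramEntry n (matrixRows M) z (ε ^ 2) i j := fun i hi j hj =>
    listEntry_listTable _ hi hj
  rw [lowerFlag, posFlag_pos_iff ((leadingHermitian_gramEntry _ _ _ _ _).congr ht),
    leadingPosDef_congr ht, ← not_iff_not, not_lt, lowerNorm_le_iff,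
    exists_le_iff_exists_ne_zero _ hε, LeadingPosDef]
  push Not
  set B := M - z • idPlus n n
  have hq : ∀ x : ℕ → ℂ, (quadForm (n * n) (gramEntry n (matrixRows M) z (ε ^ 2)) x).re ≤ 0 ↔
      ∑ r, ‖(B.mulVec fun s => x (finProdFinEquiv s)) r‖ ^ 2 ≤
        ε ^ 2 * ∑ s : Fin n × Fin n, ‖x (finProdFinEquiv s)‖ ^ 2 := by
    intro x
    rw [quadForm_gramEntry, Complex.ofReal_re, sub_nonpos, Finset.sum_range, Finset.sum_range,
      ← finProdFinEquiv.sum_comp, ← finProdFinEquiv.sum_comp]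
    refine iff_of_eq (congrArg₂ _ (Finset.sum_congr rfl fun r _ => ?_) rfl)
    rw [Finset.sum_range, ← finProdFinEquiv.sum_comp]
    simp only [shiftedEntry_matrixRows, Equiv.symm_apply_apply]
    rfl
  constructor
  · rintro ⟨x, ⟨i, hi, hx⟩, h⟩
    refine ⟨fun s => x (finProdFinEquiv s), fun h0 => hx ?_, (hq x).mp h⟩
    have := congrFun h0 (finProdFinEquiv.symm ⟨i, hi⟩)
    rwa [Equiv.apply_symm_apply] at this
  · rintro ⟨x, hx, h⟩
    obtain ⟨s, hs⟩ := Function.ne_iff.mp hx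
    let y : ℕ → ℂ := fun i => if h : i < n * n then x (finProdFinEquiv.symm ⟨i, h⟩) else 0
    have hy : ∀ s, y (finProdFinEquiv s) = x s := fun s => by
      simp only [y, dif_pos (finProdFinEquiv s).2, Fin.eta, Equiv.symm_apply_apply]
    refine ⟨y, ⟨finProdFinEquiv s, Fin.is_lt _, by rw [hy]; exact hs⟩, (hq y).mpr ?_⟩
    simpa only [hy] using h

/-! ### The machine that computes `Γⁿ_fin(A)` -/

namespace BSSComp

variable {X Y : Type} [Enc X] [Enc Y]

/-- The machine tests only for positivity, so two numbers are compared through the square of their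
difference. -/
lemma ite_eq {f g : X → ℕ} {u v : X → Y} (hf : BSSComp f) (hg : BSSComp g) (hu : BSSComp u)
    (hv : BSSComp v) : BSSComp (fun x => if f x = g x then u x else v x) := by
  have h : (fun x => if f x = g x then u x else v x) = fun x =>
      if 0 < ((f x : ℝ) - g x) * ((f x : ℝ) - g x) then v x else u x := by
    funext x
    by_cases h : f x = g x
    · simp [h]
    · rw [if_neg h, if_pos (mul_self_pos.mpr (sub_ne_zero.mpr (Nat.cast_injective.ne h)))]
  rw [h]
  exact ((hf.natCast.sub hg.natCast).mul (hf.natCast.sub hg.natCast)).ite hv hu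

lemma listEntry {M : X → List (List ℂ)} {i j : X → ℕ} (hM : BSSComp M) (hi : BSSComp i)
    (hj : BSSComp j) : BSSComp (fun x => BandSpec.listEntry (M x) (i x) (j x)) :=
  (hM.getD hi nil).getD hj (ofReal (const 0))

lemma listTable {a b : X → ℕ} {g : X → ℕ → ℕ → ℂ} (ha : BSSComp a) (hb : BSSComp b)
    (hg : BSSComp (fun q : (X × ℕ) × ℕ => g q.1.1 q.1.2 q.2)) :
    BSSComp (fun x => BandSpec.listTable (a x) (b x) (g x)) :=
  map_range (g := fun x i => (List.range (b x)).map (g x i)) ha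
    (map_range (X := X × ℕ) (N := fun q => b q.1) (g := fun q => g q.1 q.2)
      (hb.comp id.fst) hg)

lemma schurStep {N : X → ℕ} {s : X → ℝ × List (List ℂ)} (hN : BSSComp N) (hs : BSSComp s) :
    BSSComp (fun x => BandSpec.schurStep (N x) (s x)) := by
  have h0 : ∀ {Z : Type} [Enc Z], BSSComp (fun _ : Z => (0 : ℕ)) := natConst 0
  refine ((((hs.snd).listEntry h0 h0).re).ite hs.fst (const 0)).pair
    (listTable (g := fun x i j => schur (BandSpec.listEntry (s x).2) i j) hN hN ?_)
  have hM : BSSComp (fun q : (X × ℕ) × ℕ => (s q.1.1).2) := hs.snd.comp id.fst.fst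
  have hi : BSSComp (fun q : (X × ℕ) × ℕ => q.1.2 + 1) := id.fst.snd.natAdd (natConst 1)
  have hj : BSSComp (fun q : (X × ℕ) × ℕ => q.2 + 1) := id.snd.natAdd (natConst 1)
  exact ((hM.listEntry h0 h0).cmul (hM.listEntry hi hj)).csub
    ((hM.listEntry hi h0).cmul (hM.listEntry h0 hj))

lemma posFlag {N : X → ℕ} {M : X → List (List ℂ)} (hN : BSSComp N) (hM : BSSComp M) :
    BSSComp (fun x => BandSpec.posFlag (N x) (M x)) :=
  fst (iterate (step := fun x s => BandSpec.schurStep (N x) s) hN ((const 1).pair hM)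
    (schurStep (hN.comp id.fst) id.snd))

lemma shiftedEntry {n : X → ℕ} {M : X → List (List ℂ)} {z : X → ℂ} {r i : X → ℕ} (hn : BSSComp n)
    (hM : BSSComp M) (hz : BSSComp z) (hr : BSSComp r) (hi : BSSComp i) :
    BSSComp (fun x => BandSpec.shiftedEntry (n x) (M x) (z x) (r x) (i x)) :=
  (hM.listEntry hr hi).csub (hr.ite_eq (hi.natAdd hn) hz (ofReal (const 0)))

lemma gramEntry {n : X → ℕ} {M : X → List (List ℂ)} {z : X → ℂ} {e : X → ℝ} {i j : X → ℕ}
    (hn : BSSComp n) (hM : BSSComp M) (hz : BSSComp z) (he : BSSComp e) (hi : BSSComp i)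
    (hj : BSSComp j) :
    BSSComp (fun x => BandSpec.gramEntry (n x) (M x) (z x) (e x) (i x) (j x)) := by
  refine csub (sum_range (N := fun x => (n x + 2) * n x) (g := fun x r =>
    (starRingEnd ℂ) (BandSpec.shiftedEntry (n x) (M x) (z x) r (i x)) *
      BandSpec.shiftedEntry (n x) (M x) (z x) r (j x)) ((hn.natAdd (natConst 2)).natMul hn) ?_)
    (hi.ite_eq hj he.ofReal (ofReal (const 0)))
  have hn' := hn.comp (X := X × ℕ) id.fst
  have hM' := hM.comp (X := X × ℕ) id.fst
  have hz' := hz.comp (X := X × ℕ) id.fst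
  exact (shiftedEntry hn' hM' hz' id.snd (hi.comp id.fst)).cconj.cmul
    (shiftedEntry hn' hM' hz' id.snd (hj.comp id.fst))

lemma lowerFlag {n : X → ℕ} {M : X → List (List ℂ)} {z : X → ℂ} {e : X → ℝ}
    (hn : BSSComp n) (hM : BSSComp M) (hz : BSSComp z) (he : BSSComp e) :
    BSSComp (fun x => BandSpec.lowerFlag (n x) (M x) (z x) (e x)) :=
  posFlag (hn.natMul hn) (listTable (g := fun x i j => BandSpec.gramEntry (n x) (M x) (z x) (e x) i j)
    (hn.natMul hn) (hn.natMul hn) (gramEntry (hn.comp id.fst.fst) (hM.comp id.fst.fst)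
      (hz.comp id.fst.fst) (he.comp id.fst.fst) id.fst.snd id.snd))

end BSSComp

/-! ### Selection of the grid points -/

/-- Positive if one of the matrices in the list of pairs has a small lower norm, after the shift
by `z`. -/
noncomputable def foundFlag (n : ℕ) (L : List (List (List ℂ) × List (List ℂ))) (z : ℂ) (e : ℝ) : ℝ :=
  L.foldl (fun s q => if 0 < lowerFlag n q.1 z e then
    (if 0 < lowerFlag n q.2 z e then s else 1) else 1) 0

lemma foundFlag_pos_iff (n : ℕ) (L : List (List (List ℂ) × List (List ℂ))) (z : ℂ) (e : ℝ) :
    0 < foundFlag n L z e ↔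
      ∃ q ∈ L, ¬ 0 < lowerFlag n q.1 z e ∨ ¬ 0 < lowerFlag n q.2 z e := by
  have h : ∀ s : ℝ, 0 < L.foldl (fun s q => if 0 < lowerFlag n q.1 z e then
      (if 0 < lowerFlag n q.2 z e then s else 1) else 1) s ↔
      0 < s ∨ ∃ q ∈ L, ¬ 0 < lowerFlag n q.1 z e ∨ ¬ 0 < lowerFlag n q.2 z e := by
    induction L with
    | nil => simp
    | cons a L ih =>
      intro s
      rw [List.foldl_cons, ih, List.exists_mem_cons_iff]
      have := one_pos (α := ℝ)
      by_cases h1 : 0 < lowerFlag n a.1 z e <;> by_cases h2 : 0 < lowerFlag n a.2 z e <;>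
        simp only [h1, h2, if_true, if_false, not_true, not_false_eq_true, false_or, true_or,
          or_true, this]
  rw [foundFlag, h]
  simp

/-- Positive exactly on the disc `r 𝔻`, for `0 ≤ r`. -/
noncomputable def discFlag (r : ℝ) (z : ℂ) : ℝ :=
  if 0 < r * r - (z.re * z.re + z.im * z.im) then 1
  else if 0 < r * r + (z.re * z.re + z.im * z.im) then 0 else 1

/-- For `r = 0` the dilated unit disc is `{0}`, in contrast to the empty open ball of radius `0`;
the second alternative accounts for this. -/
lemma mem_smul_ball_iff {r : ℝ} (hr : 0 ≤ r) (z : ℂ) :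
    z ∈ r • Metric.ball (0 : ℂ) 1 ↔ ‖z‖ < r ∨ (r = 0 ∧ z = 0) := by
  rcases hr.eq_or_lt with rfl | hr
  · rw [Set.zero_smul_set (Metric.nonempty_ball.mpr one_pos)]
    simp [(norm_nonneg z).not_gt]
  · rw [smul_ball hr.ne']
    simp [abs_of_pos hr, hr.ne']

lemma discFlag_pos_iff {r : ℝ} (hr : 0 ≤ r) (z : ℂ) :
    0 < discFlag r z ↔ z ∈ r • Metric.ball (0 : ℂ) 1 := by
  have hz : z.re * z.re + z.im * z.im = ‖z‖ ^ 2 := by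
    rw [← Complex.normSq_eq_norm_sq, Complex.normSq_apply]
  rw [mem_smul_ball_iff hr, discFlag, hz]
  split_ifs with h1 h2
  · have : ‖z‖ < r := lt_of_pow_lt_pow_left₀ 2 hr (by linarith)
    simp [this]
  · have h3 : ¬ ‖z‖ < r := fun h => h1 (by nlinarith [norm_nonneg z])
    have h4 : ¬ (r = 0 ∧ z = 0) := by rintro ⟨rfl, rfl⟩; simp at h2
    simp [h3, h4]
  -- Both tests fail only if `r² + ‖z‖² ≤ 0`, that is, for `r = 0` and `z = 0`.
  · have h3 : r = 0 := by nlinarith [sq_nonneg ‖z‖, mul_self_nonneg r]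
    have h4 : ‖z‖ = 0 := by
      have := sq_nonneg ‖z‖
      refine pow_eq_zero_iff (n := 2) two_ne_zero |>.mp ?_
      rw [h3] at h2
      linarith
    simp [h3, norm_eq_zero.mp h4]

/-- The grid point with index `(i, j)`. -/
noncomputable def gridPoint (n M i j : ℕ) : ℂ := ⟨((i : ℝ) - M) / n, ((j : ℝ) - M) / n⟩

/-- The grid points that pass both tests. -/
noncomputable def selectedPoints (n : ℕ) (L : List (List (List ℂ) × List (List ℂ))) (r e : ℝ) :
    List ℂ :=
  (List.range (2 * ⌈n * r⌉₊ + 1)).foldr (fun i acc =>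
    (List.range (2 * ⌈n * r⌉₊ + 1)).foldr (fun j acc =>
      if 0 < discFlag r (gridPoint n ⌈n * r⌉₊ i j) then
        (if 0 < foundFlag n L (gridPoint n ⌈n * r⌉₊ i j) e then
          gridPoint n ⌈n * r⌉₊ i j :: acc else acc) else acc) acc) []

lemma mem_foldr_iff {X Y : Type} (l : List X) (f : X → List Y → List Y) (P : X → Y → Prop)
    (hf : ∀ x acc y, y ∈ f x acc ↔ P x y ∨ y ∈ acc) (acc : List Y) (y : Y) :
    y ∈ l.foldr f acc ↔ (∃ x ∈ l, P x y) ∨ y ∈ acc := by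
  induction l with
  | nil => simp
  | cons a l ih => simp [hf, ih, or_assoc]

lemma mem_selectedPoints_iff (n : ℕ) (L : List (List (List ℂ) × List (List ℂ))) (r e : ℝ) (z : ℂ) :
    z ∈ selectedPoints n L r e ↔
      (∃ i < 2 * ⌈n * r⌉₊ + 1, ∃ j < 2 * ⌈n * r⌉₊ + 1, z = gridPoint n ⌈n * r⌉₊ i j) ∧
        0 < discFlag r z ∧ 0 < foundFlag n L z e := by
  rw [selectedPoints, mem_foldr_iff _ _ (fun i z => ∃ j ∈ List.range (2 * ⌈n * r⌉₊ + 1),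
    z = gridPoint n ⌈n * r⌉₊ i j ∧ 0 < discFlag r z ∧ 0 < foundFlag n L z e)]
  · simp only [List.mem_range, List.not_mem_nil, or_false]
    constructor
    · rintro ⟨i, hi, j, hj, h, h1, h2⟩
      exact ⟨⟨i, hi, j, hj, h⟩, h1, h2⟩
    · rintro ⟨⟨i, hi, j, hj, h⟩, h1, h2⟩
      exact ⟨i, hi, j, hj, h, h1, h2⟩
  · intro i acc z
    rw [mem_foldr_iff _ _ (fun j z => z = gridPoint n ⌈n * r⌉₊ i j ∧ 0 < discFlag r z ∧
      0 < foundFlag n L z e)]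
    intro j acc z
    split_ifs with h1 h2
    · rw [List.mem_cons]
      exact or_congr ⟨fun h => ⟨h, h ▸ h1, h ▸ h2⟩, fun h => h.1⟩ Iff.rfl
    · exact ⟨Or.inr, fun h => h.elim (fun h => absurd (h.1 ▸ h.2.2) h2) _root_.id⟩
    · exact ⟨Or.inr, fun h => h.elim (fun h => absurd (h.1 ▸ h.2.1) h1) _root_.id⟩

/-- With `M = ⌈n r⌉₊`, the indices `0, …, 2 M` stand for the integers `-M, …, M`. These suffice,
since the coordinates of a grid point in the closed disc are at most `n r` in modulus after
multiplication by `n`. -/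
lemma exists_gridPoint_iff {n : ℕ} (hn : 0 < n) {r : ℝ} {z : ℂ} (hz : ‖z‖ ≤ r) :
    (∃ i < 2 * ⌈n * r⌉₊ + 1, ∃ j < 2 * ⌈n * r⌉₊ + 1, z = gridPoint n ⌈n * r⌉₊ i j) ↔
      ∃ a b : ℤ, z = ((a : ℂ) + (b : ℂ) * Complex.I) / (n : ℂ) := by
  have hn' : (0 : ℝ) < n := by exact_mod_cast hn
  have hpt : ∀ a b : ℤ, ((a : ℂ) + (b : ℂ) * Complex.I) / (n : ℂ) = ⟨a / n, b / n⟩ := by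
    intro a b
    rw [← Complex.ofReal_natCast]
    apply Complex.ext
    · rw [Complex.div_ofReal_re]; simp
    · rw [Complex.div_ofReal_im]; simp
  set M := ⌈n * r⌉₊
  constructor
  · rintro ⟨i, -, j, -, rfl⟩
    refine ⟨(i : ℤ) - M, (j : ℤ) - M, ?_⟩
    rw [hpt]
    simp [gridPoint]
  · rintro ⟨a, b, rfl⟩
    rw [hpt] at hz ⊢
    have hM : n * r ≤ M := Nat.le_ceil _
    have hbd : ∀ c : ℤ, |(c : ℝ) / n| ≤ r → |c| ≤ (M : ℤ) := by
      intro c hc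
      rw [abs_div, abs_of_pos hn', div_le_iff₀ hn'] at hc
      have : |(c : ℝ)| ≤ M := hc.trans (by linarith)
      exact_mod_cast this
    have ha := abs_le.mp (hbd a ((Complex.abs_re_le_norm _).trans hz))
    have hb := abs_le.mp (hbd b ((Complex.abs_im_le_norm _).trans hz))
    have hc : ∀ c : ℤ, -(M : ℤ) ≤ c → (((c + M).toNat : ℕ) : ℝ) - M = c := by
      intro c hc
      have : ((((c + M).toNat : ℕ) : ℤ) : ℝ) = ((c + M : ℤ) : ℝ) := by
        rw [Int.toNat_of_nonneg (by omega)]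
      rw [Int.cast_natCast] at this
      rw [this]; push_cast; ring
    refine ⟨(a + M).toNat, by omega, (b + M).toNat, by omega, ?_⟩
    rw [gridPoint, hc a ha.1, hc b hb.1]

/-- The data from which `Γⁿ_fin(A)` is computed: `n`, the submatrices, the bounds, the error. -/
abbrev GammaInput : Type := ℕ × List (List (List ℂ) × List (List ℂ)) × (ℝ × ℝ × ℝ) × ℝ

/-- The points of `Γⁿ_fin(A)`, computed from the data. -/
noncomputable def pointsOfInput (x : GammaInput) : List ℂ :=
  selectedPoints x.1 x.2.1 (x.2.2.1.1 + x.2.2.1.2.1 + x.2.2.1.2.2 + x.2.2.2)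
    (((x.2.2.1.1 + x.2.2.1.2.2) * (22 / (7 * ((x.1 : ℝ) + 1))) + 3 / (x.1 : ℝ) + x.2.2.2) ^ 2)

namespace BSSComp

variable {X : Type} [Enc X]

lemma foundFlag {n : X → ℕ} {L : X → List (List (List ℂ) × List (List ℂ))} {z : X → ℂ}
    {e : X → ℝ} (hn : BSSComp n) (hL : BSSComp L) (hz : BSSComp z) (he : BSSComp e) :
    BSSComp (fun x => BandSpec.foundFlag (n x) (L x) (z x) (e x)) := by
  have h := fun (f : X × (List (List ℂ) × List (List ℂ)) × ℝ → List (List ℂ)) (hf : BSSComp f) =>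
    lowerFlag (hn.comp id.fst) hf (hz.comp id.fst) (he.comp id.fst)
  have hs : BSSComp (fun x : X × (List (List ℂ) × List (List ℂ)) × ℝ =>
      if 0 < BandSpec.lowerFlag (n x.1) x.2.1.1 (z x.1) (e x.1) then
        (if 0 < BandSpec.lowerFlag (n x.1) x.2.1.2 (z x.1) (e x.1) then x.2.2 else 1) else 1) :=
    (h _ id.snd.fst.fst).ite ((h _ id.snd.fst.snd).ite id.snd.snd (const 1)) (const 1)
  exact foldl (Y := List (List ℂ) × List (List ℂ)) (S := ℝ)
    (step := fun x s q => if 0 < BandSpec.lowerFlag (n x) q.1 (z x) (e x) then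
      (if 0 < BandSpec.lowerFlag (n x) q.2 (z x) (e x) then s else 1) else 1) hL (const 0) hs

lemma discFlag {r : X → ℝ} {z : X → ℂ} (hr : BSSComp r) (hz : BSSComp z) :
    BSSComp (fun x => BandSpec.discFlag (r x) (z x)) := by
  have h := (hz.re.mul hz.re).add (hz.im.mul hz.im)
  exact ((hr.mul hr).sub h).ite (const 1) (((hr.mul hr).add h).ite (const 0) (const 1))

lemma gridPoint {n M i j : X → ℕ} (hn : BSSComp n) (hM : BSSComp M) (hi : BSSComp i)
    (hj : BSSComp j) : BSSComp (fun x => BandSpec.gridPoint (n x) (M x) (i x) (j x)) :=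
  ((hi.natCast.sub hM.natCast).div hn.natCast).mkComplex
    ((hj.natCast.sub hM.natCast).div hn.natCast)

lemma selectedPoints {n : X → ℕ} {L : X → List (List (List ℂ) × List (List ℂ))} {r e : X → ℝ}
    (hn : BSSComp n) (hL : BSSComp L) (hr : BSSComp r) (he : BSSComp e) :
    BSSComp (fun x => BandSpec.selectedPoints (n x) (L x) (r x) (e x)) := by
  have hM : BSSComp (fun x => ⌈n x * r x⌉₊) := natCeil (hn.natCast.mul hr)
  have hN : BSSComp (fun x => 2 * ⌈n x * r x⌉₊ + 1) := ((natConst 2).natMul hM).natAdd (natConst 1)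
  refine foldr_range (step := fun x i acc => (List.range (2 * ⌈n x * r x⌉₊ + 1)).foldr
    (fun j acc => if 0 < BandSpec.discFlag (r x) (BandSpec.gridPoint (n x) ⌈n x * r x⌉₊ i j) then
        (if 0 < BandSpec.foundFlag (n x) (L x) (BandSpec.gridPoint (n x) ⌈n x * r x⌉₊ i j) (e x) then
          BandSpec.gridPoint (n x) ⌈n x * r x⌉₊ i j :: acc else acc) else acc) acc) hN nil ?_
  refine foldr_range (X := X × ℕ × List ℂ) (S := List ℂ) (step := fun q j acc =>
    if 0 < BandSpec.discFlag (r q.1) (BandSpec.gridPoint (n q.1) ⌈n q.1 * r q.1⌉₊ q.2.1 j) then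
      (if 0 < BandSpec.foundFlag (n q.1) (L q.1)
          (BandSpec.gridPoint (n q.1) ⌈n q.1 * r q.1⌉₊ q.2.1 j) (e q.1) then
        BandSpec.gridPoint (n q.1) ⌈n q.1 * r q.1⌉₊ q.2.1 j :: acc else acc) else acc)
    (hN.comp id.fst) id.snd.snd ?_
  have hp := gridPoint (X := (X × ℕ × List ℂ) × ℕ × List ℂ) (hn.comp id.fst.fst)
    (hM.comp id.fst.fst) id.fst.snd.fst id.snd.fst
  exact (discFlag (hr.comp id.fst.fst) hp).ite ((foundFlag (hn.comp id.fst.fst)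
    (hL.comp id.fst.fst) hp (he.comp id.fst.fst)).ite (hp.cons id.snd.snd) id.snd.snd) id.snd.snd

lemma pointsOfInput : BSSComp BandSpec.pointsOfInput := by
  have hn : BSSComp (fun x : GammaInput => x.1) := id.fst
  have ha : BSSComp (fun x : GammaInput => x.2.2.1.1) := id.snd.snd.fst.fst
  have hb : BSSComp (fun x : GammaInput => x.2.2.1.2.1) := id.snd.snd.fst.snd.fst
  have hc : BSSComp (fun x : GammaInput => x.2.2.1.2.2) := id.snd.snd.fst.snd.snd
  have hη : BSSComp (fun x : GammaInput => x.2.2.2) := id.snd.snd.snd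
  have he := (((ha.add hc).mul ((const 22).div ((const 7).mul (hn.natCast.add (const 1))))).add
    ((const 3).div hn.natCast)).add hη
  refine selectedPoints hn id.snd.fst (((ha.add hb).add hc).add hη) ?_
  simp only [pow_two]
  exact he.mul he

end BSSComp

/-! ### Reading the input from the oracle -/

noncomputable instance : Enc ℤ := ⟨fun k => Data.num (k : ℝ)⟩

lemma enc_sort (K : Finset ℤ) : Enc.enc (K.sort (· ≤ ·)) = Data.ofIntFinset K := by
  change Data.ofList (List.map _ _) = Data.ofList (List.map _ _)
  -- In `Data.ofIntFinset` the casts to `ℝ` enter as a bind over the list; here they become a map.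
  simp only [List.bind_eq_flatMap, List.pure_def, List.map_flatMap, List.map_cons, List.map_nil]
  rw [← List.map_eq_flatMap]
  rfl

/-- The data from which `Γⁿ_fin(A)` is computed. -/
noncomputable def gammaInput (𝓘 : InputMaps) (A : BDO) (n : ℕ) : GammaInput :=
  (n, ((𝓘.Kset A n).sort (· ≤ ·)).foldl (fun l k =>
      (matrixRows ((toTri A n).plus n k), matrixRows ((toTri A n).adjoint.plus n k)) :: l) [],
    (𝓘.αmax n (toTri A n), 𝓘.βmax n (toTri A n), 𝓘.γmax n (toTri A n)), 𝓘.η A n)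

/-- The program learns `K_n` from the oracle and asks for the submatrices of its members only.
Working with the oracle restricted to `neededQueries` certifies that nothing else is asked. -/
lemma exists_program_gammaInput : ∃ c : Program, ∀ (𝓘 : InputMaps) (A : BDO) (n : ℕ+),
    Runs ((spectralProblem 𝓘).oracle (neededQueries 𝓘 A n) A) c (Data.num (n : ℕ))
      (Enc.enc (gammaInput 𝓘 A n)) := by
  refine ⟨.pair .id (.pair (.comp (.comp .snd .snd) (.comp (Program.listLoop
    (.pair (.comp .query (.pair (.const 2) (.pair (.comp .fst .snd) .fst))) (.comp .snd .snd)))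
      (.pair .id (.pair (.comp .query (.pair (.const 0) .id)) (.const 0)))))
    (.pair (.comp .query (.pair (.const 1) .id)) (.comp .query (.pair (.const 3) .id)))),
    fun 𝓘 A n => ?_⟩
  have h0 : Runs ((spectralProblem 𝓘).oracle (neededQueries 𝓘 A n) A)
      (.comp .query (.pair (.const 0) .id)) (Data.num (n : ℕ))
        (Enc.enc ((𝓘.Kset A n).sort (· ≤ ·))) :=
    .comp (.pair (.const _ _) (.id _)) (.query ⟨SpecQuery.cover n, Or.inl (Or.inl rfl), rfl,
      enc_sort _⟩)
  have h1 : Runs ((spectralProblem 𝓘).oracle (neededQueries 𝓘 A n) A)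
      (.comp .query (.pair (.const 1) .id)) (Data.num (n : ℕ)) (Enc.enc
        (𝓘.αmax n (toTri A n), 𝓘.βmax n (toTri A n), 𝓘.γmax n (toTri A n))) :=
    .comp (.pair (.const _ _) (.id _)) (.query ⟨SpecQuery.bounds n, Or.inl (Or.inr (Or.inl rfl)), rfl,
      rfl⟩)
  have h3 : Runs ((spectralProblem 𝓘).oracle (neededQueries 𝓘 A n) A)
      (.comp .query (.pair (.const 3) .id)) (Data.num (n : ℕ)) (Enc.enc (𝓘.η A n)) :=
    .comp (.pair (.const _ _) (.id _)) (.query ⟨SpecQuery.error n, Or.inl (Or.inr (Or.inr rfl)), rfl,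
      rfl⟩)
  refine .pair (.id _) (.pair ?_ (.pair h1 h3))
  refine .comp (.comp (.pair (.id _) (.pair h0 (.const _ _))) (runs_listLoop _ _ (fun l k =>
      (matrixRows ((toTri A n).plus n k), matrixRows ((toTri A n).adjoint.plus n k)) :: l)
    _ ?_ ([] : List (List (List ℂ) × List (List ℂ))))) (.comp (.snd _ _) (.snd _ _))
  intro k hk s
  refine .pair (.comp (.pair (.const _ _) (.pair (.comp (.snd _ _) (.fst _ _)) (.fst _ _))) ?_)
    (.comp (.snd _ _) (.snd _ _))
  refine .query ⟨SpecQuery.sub k n, Or.inr ⟨k, by simpa using hk, rfl⟩, rfl, ?_⟩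
  change Data.pair (Enc.enc _) (Enc.enc _) = _
  rw [enc_matrixRows, enc_matrixRows]
  rfl

/-! ### Correctness of the machine -/

namespace InputMaps

variable (𝓘 : InputMaps) (A : BDO) (n : ℕ)

lemma αmax_nonneg {p : ℕ} (T : TriMatrix p) : 0 ≤ 𝓘.αmax p T :=
  (norm_nonneg _).trans (𝓘.le_αmax p T 0)

lemma βmax_nonneg {p : ℕ} (T : TriMatrix p) : 0 ≤ 𝓘.βmax p T :=
  (norm_nonneg _).trans (𝓘.le_βmax p T 0)

lemma γmax_nonneg {p : ℕ} (T : TriMatrix p) : 0 ≤ 𝓘.γmax p T :=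
  (norm_nonneg _).trans (𝓘.le_γmax p T 0)

variable {n}

lemma R_nonneg (hn : 0 < n) : 0 ≤ 𝓘.R A n := by
  have h1 := 𝓘.αmax_nonneg (toTri A n)
  have h2 := 𝓘.βmax_nonneg (toTri A n)
  have h3 := 𝓘.γmax_nonneg (toTri A n)
  have h4 := 𝓘.η_nonneg A n hn
  unfold R
  linarith

lemma εstar_nonneg : 0 ≤ 𝓘.εstar A n :=
  mul_nonneg (add_nonneg (𝓘.αmax_nonneg _) (𝓘.γmax_nonneg _)) (by positivity)

lemma Kset_nonempty (hn : 0 < n) : Nonempty (𝓘.Kset A n) := by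
  obtain ⟨j, hj, -⟩ := 𝓘.K_spec n (toTri A n) n hn 0
  exact ⟨⟨j, hj⟩⟩

end InputMaps

/-- A minimum over a finite set is attained; over an empty one it would be `0` by convention. -/
lemma muFin_le_iff {p : ℕ} (T : TriMatrix p) (K : Finset ℤ) (hK : Nonempty K) (n : ℕ) (z : ℂ)
    (ε : ℝ) : muFin T K n z ≤ ε ↔ ∃ k ∈ K, lowerNorm (T.plus n k - z • idPlus p n) ≤ ε ∨
      lowerNorm (T.adjoint.plus n k - z • idPlus p n) ≤ ε := by
  constructor
  · intro h
    obtain ⟨k, hk⟩ := exists_eq_ciInf_of_finite (f := fun k : K =>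
      min (lowerNorm (T.plus n k - z • idPlus p n))
        (lowerNorm (T.adjoint.plus n k - z • idPlus p n)))
    exact ⟨k, k.2, min_le_iff.mp (hk.trans_le h)⟩
  · rintro ⟨k, hk, h⟩
    exact (ciInf_le (Set.finite_range _).bddBelow (⟨k, hk⟩ : K)).trans (min_le_iff.mpr h)

lemma GammaFin_eq_pointsOfInput (𝓘 : InputMaps) (A : BDO) (n : ℕ+) :
    𝓘.GammaFin A n = {z | z ∈ pointsOfInput (gammaInput 𝓘 A n)} := by
  have hn : 0 < (n : ℕ) := n.pos
  have := 𝓘.Kset_nonempty A hn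
  have hε : 0 ≤ 𝓘.εstar A n + 3 / ((n : ℕ) : ℝ) + 𝓘.η A n :=
    add_nonneg (add_nonneg (𝓘.εstar_nonneg A) (by positivity)) (𝓘.η_nonneg A n hn)
  have hR := 𝓘.R_nonneg A hn
  -- The fold reverses the order of the submatrices, but only membership in the list matters.
  have hL : ∀ (l : List ℤ) (acc : List (List (List ℂ) × List (List ℂ)))
      (f : ℤ → List (List ℂ) × List (List ℂ)) (q : List (List ℂ) × List (List ℂ)),
      q ∈ l.foldl (fun l k => f k :: l) acc ↔ (∃ k ∈ l, q = f k) ∨ q ∈ acc := by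
    intro l
    induction l with
    | nil => simp
    | cons a l ih => intro acc f q; rw [List.foldl_cons, ih]; simp [or_assoc, or_left_comm]
  ext z
  change z ∈ _ ∩ _ ↔ z ∈ selectedPoints n (gammaInput 𝓘 A n).2.1 (𝓘.R A n)
    ((𝓘.εstar A n + 3 / ((n : ℕ) : ℝ) + 𝓘.η A n) ^ 2)
  rw [mem_selectedPoints_iff, discFlag_pos_iff hR, foundFlag_pos_iff, GammaEps, Set.mem_inter_iff,
    Set.mem_ofPred_eq, muFin_le_iff _ _ this, Grid, Set.mem_inter_iff, Set.mem_ofPred_eq]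
  have h1 : (∃ q ∈ (gammaInput 𝓘 A n).2.1,
      ¬ 0 < lowerFlag n q.1 z ((𝓘.εstar A n + 3 / ((n : ℕ) : ℝ) + 𝓘.η A n) ^ 2) ∨
      ¬ 0 < lowerFlag n q.2 z ((𝓘.εstar A n + 3 / ((n : ℕ) : ℝ) + 𝓘.η A n) ^ 2)) ↔
      ∃ k ∈ 𝓘.Kset A n,
        lowerNorm ((toTri A n).plus n k - z • idPlus n n) ≤
          𝓘.εstar A n + 3 / ((n : ℕ) : ℝ) + 𝓘.η A n ∨
        lowerNorm ((toTri A n).adjoint.plus n k - z • idPlus n n) ≤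
          𝓘.εstar A n + 3 / ((n : ℕ) : ℝ) + 𝓘.η A n := by
    simp only [gammaInput, hL, List.not_mem_nil, or_false, Finset.mem_sort]
    constructor
    · rintro ⟨q, ⟨k, hk, rfl⟩, h⟩
      simp only [lowerFlag_pos_iff hn _ _ hε, not_lt] at h
      exact ⟨k, hk, h⟩
    · rintro ⟨k, hk, h⟩
      refine ⟨_, ⟨k, hk, rfl⟩, ?_⟩
      simp only [lowerFlag_pos_iff hn _ _ hε, not_lt]
      exact h
  rw [h1]
  constructor
  · rintro ⟨h, ⟨hg, hb⟩⟩
    refine ⟨(exists_gridPoint_iff hn ?_).mpr hg, hb, h⟩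
    rcases (mem_smul_ball_iff hR z).mp hb with h | ⟨h, rfl⟩
    · exact h.le
    · simpa using hR
  · rintro ⟨hg, hb, h⟩
    refine ⟨h, (exists_gridPoint_iff hn ?_).mp hg, hb⟩
    rcases (mem_smul_ball_iff hR z).mp hb with h | ⟨h, rfl⟩
    · exact h.le
    · simpa using hR

theorem exists_program_GammaFin : ∃ c : Program, ∀ (𝓘 : InputMaps) (A : BDO) (n : ℕ+),
    ∃ l : List ℂ, Runs ((spectralProblem 𝓘).oracle (neededQueries 𝓘 A n) A) c
      (Data.num (n : ℕ)) (Data.ofPoints l) ∧ 𝓘.GammaFin A n = {z | z ∈ l} := by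
  obtain ⟨c, hc⟩ := exists_program_gammaInput
  obtain ⟨e, he⟩ := BSSComp.pointsOfInput
  exact ⟨.comp e c, fun 𝓘 A n => ⟨_, .comp (hc 𝓘 A n) (he _ _), GammaFin_eq_pointsOfInput 𝓘 A n⟩⟩

lemma finite_neededQueries (𝓘 : InputMaps) (A : BDO) (n : ℕ+) : (neededQueries 𝓘 A n).Finite := by
  refine Set.Finite.union (((Set.finite_singleton _).insert _).insert _) ?_
  refine ((𝓘.Kset A n).finite_toSet.image fun k => SpecQuery.sub k n).subset ?_
  rintro q ⟨k, hk, rfl⟩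
  exact ⟨k, hk, rfl⟩

/-- Carries runs with the restricted oracle over to the oracle of a tower, which answers all
queries. -/
lemma Runs.mono {O O' : Data → Data → Prop} (h : ∀ d r, O d r → O' d r) {c : Program} {d r : Data}
    (hr : Runs O c d r) : Runs O' c d r := by
  induction hr with
  | id => exact .id _
  | const => exact .const _ _
  | fst => exact .fst _ _
  | snd => exact .snd _ _
  | pair _ _ h1 h2 => exact .pair h1 h2
  | comp _ _ h1 h2 => exact .comp h1 h2
  | add => exact .add _ _
  | sub => exact .sub _ _
  | mul => exact .mul _ _
  | div x y hy => exact .div x y hy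
  | isPair_num => exact .isPair_num _
  | isPair_pair => exact .isPair_pair _ _
  | cond_pos _ hx _ h1 h2 => exact .cond_pos h1 hx h2
  | cond_nonpos _ hx _ h1 h2 => exact .cond_nonpos h1 hx h2
  | loop_stop _ hx h1 => exact Runs.loop_stop h1 hx
  | loop_step _ hx _ _ h1 h2 h3 => exact .loop_step h1 hx h2 h3
  | query hq => exact .query (h _ _ hq)

/-! ### Weights -/

/-- The sine weights, cut off outside `1, …, n`. -/
noncomputable def sineWeight (n : ℕ) (i : ℤ) : ℝ :=
  if 1 ≤ i ∧ i ≤ n then Real.sin (i * (Real.pi / (n + 1))) else 0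

/-- The cut-off is invisible at `0` and `n + 1`, because the sine vanishes there. -/
lemma sineWeight_natCast {n r : ℕ} (hr : r ≤ n + 1) :
    sineWeight n r = Real.sin (r * (Real.pi / (n + 1))) := by
  unfold sineWeight
  split_ifs with h
  · simp
  · obtain rfl | rfl : r = 0 ∨ r = n + 1 := by omega
    · simp
    · have : ((n + 1 : ℕ) : ℝ) * (Real.pi / (n + 1)) = Real.pi := by push_cast; field_simp
      rw [this, Real.sin_pi]

/-- Summation by parts: `sin (r θ)` is an eigenvector of the discrete Laplacian for the eigenvalue
`2 - 2 cos θ`. The boundary term vanishes for `m θ = π`. -/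
lemma sum_sq_sin_sub (θ : ℝ) (m : ℕ) :
    ∑ r ∈ Finset.range m, (Real.sin ((r + 1 : ℕ) * θ) - Real.sin (r * θ)) ^ 2 =
      (2 - 2 * Real.cos θ) * ∑ r ∈ Finset.range m, Real.sin (r * θ) ^ 2 +
        Real.sin (m * θ) * (Real.sin (m * θ) - Real.sin (m * θ - θ)) := by
  induction m with
  | zero => simp
  | succ m ih =>
    rw [Finset.sum_range_succ, Finset.sum_range_succ, ih]
    have h1 : ((m + 1 : ℕ) : ℝ) * θ = m * θ + θ := by push_cast; ring
    rw [h1, Real.sin_add, add_sub_cancel_right, Real.sin_sub]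
    have := Real.sin_sq_add_cos_sq θ
    ring

/-- With `θ = π / (n + 1)` the identity for sines gives the factor `2 - 2 cos θ ≤ θ²`. -/
lemma sum_sineWeight_sub_sq (n : ℕ) :
    ∑ r ∈ Finset.range (n + 1), (sineWeight n (r + 1) - sineWeight n r) ^ 2 ≤
      (22 / (7 * ((n : ℝ) + 1))) ^ 2 * ∑ r ∈ Finset.range (n + 2), sineWeight n r ^ 2 := by
  set θ := Real.pi / ((n : ℝ) + 1) with hθ
  have h1 : ∑ r ∈ Finset.range (n + 1), (sineWeight n (r + 1) - sineWeight n r) ^ 2 =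
      ∑ r ∈ Finset.range (n + 1), (Real.sin ((r + 1 : ℕ) * θ) - Real.sin (r * θ)) ^ 2 := by
    refine Finset.sum_congr rfl fun r hr => ?_
    have hr := Finset.mem_range.mp hr
    rw [← sineWeight_natCast (by omega), ← sineWeight_natCast (by omega)]
    simp
  have h2 : ∑ r ∈ Finset.range (n + 2), sineWeight n r ^ 2 =
      ∑ r ∈ Finset.range (n + 1), Real.sin (r * θ) ^ 2 := by
    rw [Finset.sum_range_succ, show sineWeight n (n + 1 : ℕ) = 0 by simp [sineWeight]]
    rw [zero_pow two_ne_zero, add_zero]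
    refine Finset.sum_congr rfl fun r hr => ?_
    have hr := Finset.mem_range.mp hr
    rw [sineWeight_natCast (by omega)]
  have h3 : ((n + 1 : ℕ) : ℝ) * θ = Real.pi := by rw [hθ]; push_cast; field_simp
  rw [h1, h2, sum_sq_sin_sub, h3, Real.sin_pi, zero_mul, add_zero]
  refine mul_le_mul_of_nonneg_right ?_ (Finset.sum_nonneg fun r _ => sq_nonneg _)
  have h4 := Real.one_sub_sq_div_two_le_cos (x := θ)
  have h5 : θ ≤ 22 / (7 * ((n : ℝ) + 1)) := by
    rw [hθ, div_le_div_iff₀ (by positivity) (by positivity)]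
    -- The rational constant of `ε_n^*` comes from `π < 3.1416 < 22 / 7`.
    have := Real.pi_lt_d4
    have hn : (0 : ℝ) < (n : ℝ) + 1 := by positivity
    nlinarith
  have h6 : 0 ≤ θ := by positivity
  nlinarith

lemma sum_sq_sineWeight_pos {n : ℕ} (hn : 0 < n) :
    0 < ∑ r ∈ Finset.range (n + 2), sineWeight n r ^ 2 := by
  refine Finset.sum_pos' (fun _ _ => sq_nonneg _) ⟨1, by simp, ?_⟩
  rw [sineWeight_natCast (by omega)]
  have : (1 : ℝ) < n + 1 := by norm_cast; omega
  have h := Real.sin_pos_of_pos_of_lt_pi (x := ((1 : ℕ) : ℝ) * (Real.pi / (n + 1)))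
    (by have := Real.pi_pos; positivity)
    (by rw [Nat.cast_one, one_mul]; exact div_lt_self Real.pi_pos this)
  positivity

/-- The differences belonging to the subdiagonal; those of the superdiagonal come next. Compared
with `sum_sineWeight_sub_sq` there is one more term, and it is zero, because the weights vanish
outside `1, …, n`. -/
lemma sum_sineWeight_pred_sub_sq (n : ℕ) :
    ∑ r ∈ Finset.range (n + 2), (sineWeight n (r - 1) - sineWeight n r) ^ 2 ≤
      (22 / (7 * ((n : ℝ) + 1))) ^ 2 * ∑ r ∈ Finset.range (n + 2), sineWeight n r ^ 2 := by
  refine le_of_eq_of_le ?_ (sum_sineWeight_sub_sq n)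
  rw [Finset.sum_range_succ']
  simp only [Nat.cast_add, Nat.cast_one, add_sub_cancel_right, Nat.cast_zero]
  rw [show sineWeight n (0 - 1) = 0 by simp [sineWeight], show sineWeight n 0 = 0 by
    simp [sineWeight], sub_zero, zero_pow two_ne_zero, add_zero]
  exact Finset.sum_congr rfl fun r _ => by ring

lemma sum_sineWeight_succ_sub_sq (n : ℕ) :
    ∑ r ∈ Finset.range (n + 2), (sineWeight n (r + 1) - sineWeight n r) ^ 2 ≤
      (22 / (7 * ((n : ℝ) + 1))) ^ 2 * ∑ r ∈ Finset.range (n + 2), sineWeight n r ^ 2 := by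
  refine le_of_eq_of_le ?_ (sum_sineWeight_sub_sq n)
  rw [Finset.sum_range_succ, show sineWeight n ((n + 1 : ℕ) + 1) = 0 by simp [sineWeight],
    show sineWeight n (n + 1 : ℕ) = 0 by simp [sineWeight], sub_zero, zero_pow two_ne_zero,
    add_zero]

/-- Minkowski's inequality for three summands, with bounds. -/
lemma sum_sq_le_of_le_add {ι : Type} (s : Finset ι) {u f g h : ι → ℝ} {F G H : ℝ}
    (hu : ∀ i ∈ s, 0 ≤ u i) (hle : ∀ i ∈ s, u i ≤ f i + g i + h i)
    (hF : 0 ≤ F) (hG : 0 ≤ G) (hH : 0 ≤ H) (h1 : ∑ i ∈ s, f i ^ 2 ≤ F ^ 2)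
    (h2 : ∑ i ∈ s, g i ^ 2 ≤ G ^ 2) (h3 : ∑ i ∈ s, h i ^ 2 ≤ H ^ 2) :
    ∑ i ∈ s, u i ^ 2 ≤ (F + G + H) ^ 2 := by
  have cs : ∀ (f g : ι → ℝ) (F G : ℝ), 0 ≤ F → 0 ≤ G → ∑ i ∈ s, f i ^ 2 ≤ F ^ 2 →
      ∑ i ∈ s, g i ^ 2 ≤ G ^ 2 → ∑ i ∈ s, f i * g i ≤ F * G := by
    intro f g F G hF hG hf hg
    refine le_of_abs_le (abs_le_of_sq_le_sq ?_ (mul_nonneg hF hG))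
    rw [mul_pow]
    exact (Finset.sum_mul_sq_le_sq_mul_sq s f g).trans
      (mul_le_mul hf hg (Finset.sum_nonneg fun _ _ => sq_nonneg _) (sq_nonneg _))
  have c1 := cs f g F G hF hG h1 h2
  have c2 := cs f h F H hF hH h1 h3
  have c3 := cs g h G H hG hH h2 h3
  calc ∑ i ∈ s, u i ^ 2 ≤ ∑ i ∈ s, (f i + g i + h i) ^ 2 :=
        Finset.sum_le_sum fun i hi => pow_le_pow_left₀ (hu i hi) (hle i hi) 2
    _ = ∑ i ∈ s, f i ^ 2 + ∑ i ∈ s, g i ^ 2 + ∑ i ∈ s, h i ^ 2 + 2 * ∑ i ∈ s, f i * g i +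
        2 * ∑ i ∈ s, f i * h i + 2 * ∑ i ∈ s, g i * h i := by
      simp only [Finset.mul_sum, ← Finset.sum_add_distrib]
      exact Finset.sum_congr rfl fun i _ => by ring
    _ ≤ _ := by nlinarith

/-! ### Blocks of vectors -/

variable {p : ℕ}

/-- The `i`-th block of length `p` of a bi-infinite sequence. -/
noncomputable def block (p : ℕ) (x : ℤ → ℂ) (i : ℤ) : EuclideanSpace ℂ (Fin p) :=
  WithLp.toLp 2 fun s => x (p * i + (s : ℕ) + 1)

@[simp] lemma block_apply (x : ℤ → ℂ) (i : ℤ) (s : Fin p) :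
    block p x i s = x (p * i + (s : ℕ) + 1) := rfl

/-- The position of an entry, from the number of its block and the position in the block. -/
def blockIndex (p : ℕ) [NeZero p] : ℤ × Fin p ≃ ℤ :=
  (Int.divModEquiv p).symm.trans (Equiv.addRight 1)

lemma blockIndex_apply [NeZero p] (q : ℤ × Fin p) :
    blockIndex p q = p * q.1 + (q.2 : ℕ) + 1 := by
  simp [blockIndex, mul_comm]

lemma hasSum_sq_norm (x : E) : HasSum (fun i => ‖(x : ℤ → ℂ) i‖ ^ 2) (‖x‖ ^ 2) := by
  have := lp.hasSum_norm (p := 2) (by norm_num) x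
  simpa using this

lemma hasSum_sq_norm_block (hp : 0 < p) (x : E) :
    HasSum (fun i => ‖block p x i‖ ^ 2) (‖x‖ ^ 2) := by
  have : NeZero p := ⟨hp.ne'⟩
  have h := (blockIndex p).hasSum_iff.mpr (hasSum_sq_norm x)
  refine h.prod_fiberwise fun i => ?_
  rw [EuclideanSpace.norm_sq_eq]
  simp only [block_apply, Function.comp_def, blockIndex_apply]
  exact hasSum_fintype _

lemma hasSum_sq_norm_block_add (hp : 0 < p) (x : E) (e : ℤ) :
    HasSum (fun i => ‖block p x (i + e)‖ ^ 2) (‖x‖ ^ 2) :=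
  (Equiv.addRight e).hasSum_iff.mpr (hasSum_sq_norm_block hp x)

lemma sum_sq_mul_norm_block_le (hp : 0 < p) (x : E) (s : Finset ℤ) (N : ℕ) (g : ℕ → ℝ) (e : ℤ) :
    ∑ q ∈ s ×ˢ Finset.range N, (g q.2 * ‖block p x (q.1 + (q.2 + e))‖) ^ 2 ≤
      (∑ r ∈ Finset.range N, g r ^ 2) * ‖x‖ ^ 2 := by
  rw [Finset.sum_product_right, Finset.sum_mul]
  refine Finset.sum_le_sum fun r _ => ?_
  simp only [mul_pow, ← Finset.mul_sum]
  exact mul_le_mul_of_nonneg_left (sum_le_hasSum s (fun _ _ => sq_nonneg _)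
    (hasSum_sq_norm_block_add hp x _)) (sq_nonneg _)

/-- For fixed `r`, the index `k + r` meets every block exactly once as `k` runs over `ℤ`. This is
what makes averaging over all windows exact. -/
lemma hasSum_sum_mul_sq_norm_block (hp : 0 < p) (x : E) (N : ℕ) (g : ℕ → ℝ) :
    HasSum (fun k : ℤ => ∑ r ∈ Finset.range N, g r * ‖block p x (k + r)‖ ^ 2)
      ((∑ r ∈ Finset.range N, g r) * ‖x‖ ^ 2) := by
  rw [Finset.sum_mul]
  exact hasSum_sum fun r _ => (hasSum_sq_norm_block_add hp x r).mul_left _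

/-! ### Rows of tridiagonal block matrices -/

lemma norm_toEuclideanLin_le {m n : Type} [Fintype m] [Fintype n] [DecidableEq n] {C : ℝ}
    (M : Matrix m n ℂ) (h : ‖M‖ ≤ C) (v : EuclideanSpace ℂ n) :
    ‖Matrix.toEuclideanLin M v‖ ≤ C * ‖v‖ :=
  (Matrix.l2_opNorm_mulVec M v).trans (mul_le_mul_of_nonneg_right h (norm_nonneg _))

/-- The `i`-th block of the image of a sequence of blocks under a tridiagonal matrix. -/
noncomputable def TriMatrix.row (T : TriMatrix p) (X : ℤ → EuclideanSpace ℂ (Fin p)) (i : ℤ) :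
    EuclideanSpace ℂ (Fin p) :=
  Matrix.toEuclideanLin (T.α (i - 1)) (X (i - 1)) + Matrix.toEuclideanLin (T.β i) (X i) +
    Matrix.toEuclideanLin (T.γ (i + 1)) (X (i + 1))

/-- Both sides are the sum over all `j`: the terms vanish outside `s` with `X`, and outside `{i - 1,
i, i + 1}` with the blocks of `T`. -/
lemma TriMatrix.sum_blockAt (T : TriMatrix p) (X : ℤ → EuclideanSpace ℂ (Fin p)) (i : ℤ)
    (s : Finset ℤ) (hX : ∀ j, j ∉ s → X j = 0) :
    ∑ j ∈ s, Matrix.toEuclideanLin (T.blockAt i j) (X j) = T.row X i := by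
  have h1 : ∀ j ∉ s, Matrix.toEuclideanLin (T.blockAt i j) (X j) = 0 := fun j hj => by
    rw [hX j hj, map_zero]
  have h2 : ∀ j ∉ ({i - 1, i, i + 1} : Finset ℤ),
      Matrix.toEuclideanLin (T.blockAt i j) (X j) = 0 := fun j hj => by
    simp only [Finset.mem_insert, Finset.mem_singleton, not_or] at hj
    rw [TriMatrix.blockAt, if_neg (by omega), if_neg (by omega), if_neg (by omega), map_zero]
    rfl
  rw [← finsum_eq_sum_of_support_subset (s := s) _ fun j hj => by
      by_contra h; exact hj (h1 j (by simpa using h)),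
    finsum_eq_sum_of_support_subset (s := {i - 1, i, i + 1}) _ fun j hj => by
      by_contra h; exact hj (h2 j (by simpa using h)),
    Finset.sum_insert (by simp; omega), Finset.sum_insert (by simp), Finset.sum_singleton,
    ← add_assoc, TriMatrix.row]
  simp [TriMatrix.blockAt, show i ≠ i + 1 + 1 by omega]

/-- The vector formed by the blocks `k + 1, …, k + n`. -/
noncomputable def columnVec (n : ℕ) (k : ℤ) (X : ℤ → EuclideanSpace ℂ (Fin p)) :
    EuclideanSpace ℂ (Fin n × Fin p) :=
  WithLp.toLp 2 fun q => X (k + 1 + (q.1 : ℕ)) q.2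

lemma sq_norm_columnVec (n : ℕ) (k : ℤ) (X : ℤ → EuclideanSpace ℂ (Fin p)) :
    ‖columnVec n k X‖ ^ 2 = ∑ c ∈ Finset.range n, ‖X (k + 1 + (c : ℕ))‖ ^ 2 := by
  rw [EuclideanSpace.norm_sq_eq, Fintype.sum_prod_type, Finset.sum_range]
  refine Finset.sum_congr rfl fun c _ => ?_
  rw [EuclideanSpace.norm_sq_eq]
  rfl

/-- All nonzero blocks of `X` lie in the columns of the window, so the submatrix computes complete
rows of `T - z`. In the first and last block row `idPlus` is zero, and so is `X`. -/
lemma toEuclideanLin_plus_apply (T : TriMatrix p) (n : ℕ) (k : ℤ) (z : ℂ)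
    (X : ℤ → EuclideanSpace ℂ (Fin p)) (hX : ∀ j, (j < k + 1 ∨ k + n < j) → X j = 0)
    (r : Fin (n + 2)) (s : Fin p) :
    Matrix.toEuclideanLin (T.plus n k - z • idPlus p n) (columnVec n k X) (r, s) =
      (T.row X (k + (r : ℕ)) - z • X (k + (r : ℕ))) s := by
  let f : Fin n ↪ ℤ := ⟨fun c => k + 1 + (c : ℕ), fun a b h => by simpa [Fin.ext_iff] using h⟩
  have hsupp : ∀ j, j ∉ Finset.univ.map f → X j = 0 := fun j hj => hX j (by
    by_contra! h
    exact hj (Finset.mem_map.mpr ⟨⟨(j - k - 1).toNat, by omega⟩, Finset.mem_univ _, by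
      change k + 1 + (((j - k - 1).toNat : ℕ) : ℤ) = j; omega⟩))
  rw [← T.sum_blockAt X _ _ hsupp, Finset.sum_map]
  have hI : (z • X (k + (r : ℕ))) s = ∑ c : Fin n, ∑ t : Fin p,
      z * (if (r : ℕ) = (c : ℕ) + 1 ∧ s = t then 1 else 0) * X (k + 1 + (c : ℕ)) t := by
    simp only [mul_ite, mul_one, mul_zero, ite_mul, zero_mul, ite_and]
    by_cases hr : 1 ≤ (r : ℕ) ∧ (r : ℕ) ≤ n
    · rw [Finset.sum_eq_single ⟨(r : ℕ) - 1, by omega⟩]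
      · have h1 : (r : ℕ) = (r : ℕ) - 1 + 1 := by omega
        have h2 : k + (r : ℕ) = k + 1 + ((r : ℕ) - 1 : ℕ) := by omega
        simp only [← h1, if_true, ← h2, Finset.sum_ite_eq, Finset.mem_univ, PiLp.smul_apply,
          smul_eq_mul]
      · intro c _ hc
        have : ¬ (r : ℕ) = (c : ℕ) + 1 := fun h => hc (Fin.ext (by simp [h]))
        simp [this]
      · simp
    · rw [hX _ (by omega)]
      symm
      simp only [smul_zero, PiLp.zero_apply]
      refine Finset.sum_eq_zero fun c _ => ?_
      have : ¬ (r : ℕ) = (c : ℕ) + 1 := by omega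
      simp [this]
  rw [PiLp.sub_apply, hI]
  simp only [Matrix.toLpLin_apply, Matrix.mulVec, dotProduct, columnVec, Matrix.sub_apply,
    Matrix.smul_apply, TriMatrix.plus, idPlus, Matrix.of_apply, Fintype.sum_prod_type, sub_mul,
    Finset.sum_sub_distrib, smul_eq_mul]
  congr 1
  rw [WithLp.ofLp_sum, Finset.sum_apply]
  rfl

lemma sq_norm_plus (T : TriMatrix p) (n : ℕ) (k : ℤ) (z : ℂ)
    (X : ℤ → EuclideanSpace ℂ (Fin p)) (hX : ∀ j, (j < k + 1 ∨ k + n < j) → X j = 0) :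
    ‖Matrix.toEuclideanLin (T.plus n k - z • idPlus p n) (columnVec n k X)‖ ^ 2 =
      ∑ r ∈ Finset.range (n + 2), ‖T.row X (k + (r : ℕ)) - z • X (k + (r : ℕ))‖ ^ 2 := by
  rw [EuclideanSpace.norm_sq_eq, Fintype.sum_prod_type, Finset.sum_range]
  refine Finset.sum_congr rfl fun r _ => ?_
  rw [EuclideanSpace.norm_sq_eq]
  exact Finset.sum_congr rfl fun s _ => by rw [toEuclideanLin_plus_apply T n k z X hX]

/-! ### Windows and approximate eigenvectors -/

/-- The operator `S` has the tridiagonal block matrix `T`. -/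
def HasBlocks (S : E →L[ℂ] E) (T : TriMatrix p) : Prop :=
  ∀ (x : E) (i : ℤ), block p (S x) i = T.row (block p x) i

lemma block_sub_smul (x y : E) (z : ℂ) (i : ℤ) :
    block p ((x - z • y : E) : ℤ → ℂ) i = block p x i - z • block p y i := rfl

/-- If all windows had lower norm above `m`, then the weighted cut-offs of `x`, summed over all
windows, would satisfy `m² W ‖x‖² ≤ (d + (a + c) θ)² W ‖x‖²`, where `W` is the sum of the squared
weights. The slack `δ` in `m` makes this absurd. -/
theorem HasBlocks.exists_lowerNorm_le {S : E →L[ℂ] E} {T : TriMatrix p} (hST : HasBlocks S T)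
    (hp : 0 < p) {n : ℕ} (hn : 0 < n) {a c : ℝ} (ha : ∀ j, ‖T.α j‖ ≤ a) (hc : ∀ j, ‖T.γ j‖ ≤ c)
    {z : ℂ} {d δ : ℝ} (hd : 0 ≤ d) (hδ : 0 < δ) {x : E} (hx : x ≠ 0)
    (h : ‖S x - z • x‖ ≤ d * ‖x‖) :
    ∃ k : ℤ, lowerNorm (T.plus n k - z • idPlus p n) ≤
      d + (a + c) * (22 / (7 * ((n : ℝ) + 1))) + δ := by
  by_contra! hcon
  set θ : ℝ := 22 / (7 * ((n : ℝ) + 1)) with hθ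
  have hθ0 : 0 ≤ θ := by positivity
  have ha0 : 0 ≤ a := (norm_nonneg _).trans (ha 0)
  have hc0 : 0 ≤ c := (norm_nonneg _).trans (hc 0)
  set m : ℝ := d + (a + c) * θ + δ with hm
  have hm0 : 0 ≤ m := by positivity
  set w : ℤ → ℝ := sineWeight n with hw
  set W : ℝ := ∑ r ∈ Finset.range (n + 2), w r ^ 2 with hW
  have hW0 : 0 < W := sum_sq_sineWeight_pos hn
  set y : E := S x - z • x with hy
  let X : ℤ → ℤ → EuclideanSpace ℂ (Fin p) := fun k j => ((w (j - k) : ℝ) : ℂ) • block p x j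
  have hX : ∀ k j : ℤ, (j < k + 1 ∨ k + n < j) → X k j = 0 := fun k j hj => by
    have : w (j - k) = 0 := if_neg (by omega)
    simp [X, this]
  let u : ℤ × ℕ → ℝ := fun q => ‖T.row (X q.1) (q.1 + (q.2 : ℕ)) - z • X q.1 (q.1 + (q.2 : ℕ))‖
  have hlow : ∀ k : ℤ, m ^ 2 * ∑ r ∈ Finset.range (n + 2), w r ^ 2 * ‖block p x (k + r)‖ ^ 2 ≤
      ∑ r ∈ Finset.range (n + 2), u (k, r) ^ 2 := by
    intro k
    have h1 : m * ‖columnVec n k (X k)‖ ≤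
        ‖Matrix.toEuclideanLin (T.plus n k - z • idPlus p n) (columnVec n k (X k))‖ :=
      (mul_le_mul_of_nonneg_right (hcon k).le (norm_nonneg _)).trans (lowerNorm_mul_norm_le _ _)
    have h2 := pow_le_pow_left₀ (by positivity) h1 2
    rw [mul_pow, sq_norm_plus T n k z (X k) (hX k), sq_norm_columnVec] at h2
    refine le_trans (le_of_eq ?_) h2
    congr 1
    -- The weights vanish at both ends of the `n + 2` positions, which leaves the `n` blocks of the
    -- window.
    rw [Finset.sum_range_succ, Finset.sum_range_succ']
    have e0 : w ((0 : ℕ) : ℤ) = 0 := by simp [hw, sineWeight]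
    have e1 : w ((n + 1 : ℕ) : ℤ) = 0 := by simp [hw, sineWeight]
    rw [e0, e1, zero_pow two_ne_zero, zero_mul, zero_mul, add_zero, add_zero]
    refine Finset.sum_congr rfl fun r _ => ?_
    have e2 : k + 1 + (r : ℤ) - k = ((r + 1 : ℕ) : ℤ) := by push_cast; ring
    have e3 : k + ((r + 1 : ℕ) : ℤ) = k + 1 + (r : ℤ) := by push_cast; ring
    simp only [X, norm_smul, Complex.norm_real, mul_pow, e2, e3, Real.norm_eq_abs, sq_abs]
  have hup : ∀ q : ℤ × ℕ, u q ≤ |w q.2| * ‖block p y (q.1 + (q.2 + 0))‖ +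
      |w (q.2 - 1) - w q.2| * a * ‖block p x (q.1 + (q.2 + -1))‖ +
      |w (q.2 + 1) - w q.2| * c * ‖block p x (q.1 + (q.2 + 1))‖ := by
    rintro ⟨k, r⟩
    set i : ℤ := k + r with hi
    have e0 : (r : ℤ) = i - k := by omega
    have e1 : (r : ℤ) - 1 = i - 1 - k := by omega
    have e2 : (r : ℤ) + 1 = i + 1 - k := by omega
    -- Commuting the weight with `T - z`: the diagonal part cancels, and each off-diagonal block is
    -- multiplied by the difference of two neighbouring weights.
    have key : T.row (X k) i - z • X k i = ((w (i - k) : ℝ) : ℂ) • block p y i +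
        ((w (i - 1 - k) - w (i - k) : ℝ) : ℂ) •
          Matrix.toEuclideanLin (T.α (i - 1)) (block p x (i - 1)) +
        ((w (i + 1 - k) - w (i - k) : ℝ) : ℂ) •
          Matrix.toEuclideanLin (T.γ (i + 1)) (block p x (i + 1)) := by
      rw [hy, block_sub_smul, hST x i]
      simp only [X, TriMatrix.row, map_smul, Complex.ofReal_sub]
      module
    have a1 : k + ((r : ℤ) + 0) = i := by omega
    have a2 : k + ((r : ℤ) + -1) = i - 1 := by omega
    have a3 : k + ((r : ℤ) + 1) = i + 1 := by omega
    simp only [u, a1, a2, a3]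
    rw [← hi, key, e1, e2, e0]
    refine (norm_add₃_le).trans (add_le_add (add_le_add ?_ ?_) ?_)
    · rw [norm_smul, Complex.norm_real, Real.norm_eq_abs]
    · rw [norm_smul, Complex.norm_real, Real.norm_eq_abs, mul_assoc]
      exact mul_le_mul_of_nonneg_left (norm_toEuclideanLin_le _ (ha _) _) (abs_nonneg _)
    · rw [norm_smul, Complex.norm_real, Real.norm_eq_abs, mul_assoc]
      exact mul_le_mul_of_nonneg_left (norm_toEuclideanLin_le _ (hc _) _) (abs_nonneg _)
  -- Minkowski's inequality in the variables `k` and `r` together; finite sets of windows suffice to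
  -- bound the infinite sum.
  have hfin : ∀ s : Finset ℤ, ∑ k ∈ s, ∑ r ∈ Finset.range (n + 2),
      m ^ 2 * w r ^ 2 * ‖block p x (k + r)‖ ^ 2 ≤
        (√W * (d * ‖x‖) + θ * √W * (a * ‖x‖) + θ * √W * (c * ‖x‖)) ^ 2 := by
    intro s
    refine le_trans (b := ∑ q ∈ s ×ˢ Finset.range (n + 2), u q ^ 2) ?_ ?_
    · rw [Finset.sum_product]
      refine Finset.sum_le_sum fun k _ => le_trans (le_of_eq ?_) (hlow k)
      rw [Finset.mul_sum]
      exact Finset.sum_congr rfl fun r _ => by ring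
    · have hsq : √W ^ 2 = W := Real.sq_sqrt hW0.le
      refine sum_sq_le_of_le_add _ (fun _ _ => norm_nonneg _) (fun q _ => hup q) (by positivity)
        (by positivity) (by positivity) ?_ ?_ ?_
      · refine (sum_sq_mul_norm_block_le hp y s (n + 2) (fun r => |w r|) 0).trans ?_
        simp only [sq_abs]
        rw [mul_pow, hsq]
        gcongr
      · refine (sum_sq_mul_norm_block_le hp x s (n + 2) (fun r => |w (r - 1) - w r| * a)
          (-1)).trans ?_
        simp only [mul_pow, sq_abs, hsq, ← Finset.sum_mul]
        have := sum_sineWeight_pred_sub_sq n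
        calc _ ≤ (θ ^ 2 * W) * a ^ 2 * ‖x‖ ^ 2 := by gcongr
          _ = _ := by ring
      · refine (sum_sq_mul_norm_block_le hp x s (n + 2) (fun r => |w (r + 1) - w r| * c)
          1).trans ?_
        simp only [mul_pow, sq_abs, hsq, ← Finset.sum_mul]
        have := sum_sineWeight_succ_sub_sq n
        calc _ ≤ (θ ^ 2 * W) * c ^ 2 * ‖x‖ ^ 2 := by gcongr
          _ = _ := by ring
  have hsum := hasSum_le_of_sum_le
    (hasSum_sum_mul_sq_norm_block hp x (n + 2) fun r => m ^ 2 * w r ^ 2) hfin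
  rw [← Finset.mul_sum, ← hW] at hsum
  have hx0 : 0 < ‖x‖ := norm_pos_iff.mpr hx
  have h1 : (m * (√W * ‖x‖)) ^ 2 ≤ ((d + (a + c) * θ) * (√W * ‖x‖)) ^ 2 := by
    refine le_trans (le_of_eq ?_) (hsum.trans (le_of_eq ?_))
    · rw [mul_pow, mul_pow, Real.sq_sqrt hW0.le]; ring
    · ring
  have h2 := le_of_mul_le_mul_right (le_of_abs_le (abs_le_of_sq_le_sq h1 (by positivity)))
    (mul_pos (Real.sqrt_pos.mpr hW0) hx0)
  linarith

/-- Minkowski's inequality for the three block diagonals, each of which is a shift with bounded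
block weights. -/
lemma HasBlocks.norm_le {S : E →L[ℂ] E} {T : TriMatrix p} (hST : HasBlocks S T) (hp : 0 < p)
    {a b c : ℝ} (ha : ∀ j, ‖T.α j‖ ≤ a) (hb : ∀ j, ‖T.β j‖ ≤ b) (hc : ∀ j, ‖T.γ j‖ ≤ c) :
    ‖S‖ ≤ a + b + c := by
  have ha0 : 0 ≤ a := (norm_nonneg _).trans (ha 0)
  have hb0 : 0 ≤ b := (norm_nonneg _).trans (hb 0)
  have hc0 : 0 ≤ c := (norm_nonneg _).trans (hc 0)
  refine S.opNorm_le_bound (by positivity) fun x => ?_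
  refine le_of_abs_le (abs_le_of_sq_le_sq ?_ (by positivity))
  refine hasSum_le_of_sum_le (hasSum_sq_norm_block hp (S x)) fun s => ?_
  have hs : ∀ (e : ℤ) (C : ℝ), ∑ i ∈ s, (C * ‖block p x (i + e)‖) ^ 2 ≤ (C * ‖x‖) ^ 2 := by
    intro e C
    simp only [mul_pow, ← Finset.mul_sum]
    exact mul_le_mul_of_nonneg_left (sum_le_hasSum s (fun _ _ => sq_nonneg _)
      (hasSum_sq_norm_block_add hp x _)) (sq_nonneg _)
  rw [add_mul, add_mul]
  refine sum_sq_le_of_le_add s (fun _ _ => norm_nonneg _) (fun i _ => ?_) (by positivity)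
    (by positivity) (by positivity) (hs (-1) a) (hs 0 b) (hs 1 c)
  rw [hST x i, TriMatrix.row, add_zero, ← sub_eq_add_neg]
  exact norm_add₃_le.trans (add_le_add (add_le_add (norm_toEuclideanLin_le _ (ha _) _)
    (norm_toEuclideanLin_le _ (hb _) _)) (norm_toEuclideanLin_le _ (hc _) _))

lemma exists_block_eq (hp : 0 < p) (X : ℤ → EuclideanSpace ℂ (Fin p)) (s : Finset ℤ)
    (hX : ∀ j, j ∉ s → X j = 0) : ∃ x : E, block p x = X := by
  have : NeZero p := ⟨hp.ne'⟩
  let f : ℤ → ℂ := fun i => X ((blockIndex p).symm i).1 ((blockIndex p).symm i).2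
  have hf : Memℓp f 2 := by
    refine memℓp_gen (summable_of_ne_finset_zero
      (s := (s ×ˢ Finset.univ).map (blockIndex p).toEmbedding) fun i hi => ?_)
    have : ((blockIndex p).symm i).1 ∉ s := fun h => hi (by
      rw [Finset.mem_map_equiv]
      exact Finset.mem_product.mpr ⟨h, Finset.mem_univ _⟩)
    simp [f, hX _ this]
  refine ⟨⟨f, hf⟩, ?_⟩
  funext i
  ext t
  change f (p * i + (t : ℕ) + 1) = _
  have h := blockIndex_apply (p := p) (i, t)
  simp only [f, ← h, Equiv.symm_apply_apply]

/-- Extension by zero loses nothing: `T` is tridiagonal, so the image under `S - z` lives in the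
blocks `k, …, k + n + 1`, exactly the rows of the rectangular submatrix. A square `n × n` section
would miss two of them. -/
theorem HasBlocks.exists_norm_le {S : E →L[ℂ] E} {T : TriMatrix p} (hST : HasBlocks S T)
    (hp : 0 < p) {n : ℕ} (hn : 0 < n) {k : ℤ} {z : ℂ} {ε : ℝ}
    (h : lowerNorm (T.plus n k - z • idPlus p n) ≤ ε) :
    ∃ x : E, ‖x‖ = 1 ∧ ‖S x - z • x‖ ≤ ε := by
  have : NeZero p := ⟨hp.ne'⟩
  have : NeZero n := ⟨hn.ne'⟩
  obtain ⟨v, hv, hle⟩ := (lowerNorm_le_iff _ _).mp h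
  let X : ℤ → EuclideanSpace ℂ (Fin p) := fun j =>
    if hj : k + 1 ≤ j ∧ j ≤ k + n then
      WithLp.toLp 2 fun s => v (⟨(j - k - 1).toNat, by omega⟩, s) else 0
  have hX : ∀ j, (j < k + 1 ∨ k + n < j) → X j = 0 := fun j hj => dif_neg (by omega)
  have hcol : columnVec n k X = v := by
    ext ⟨c, t⟩
    change X (k + 1 + (c : ℕ)) t = _
    have hc : k + 1 ≤ k + 1 + ((c : ℕ) : ℤ) ∧ k + 1 + ((c : ℕ) : ℤ) ≤ k + n := by omega
    simp only [X, dif_pos hc]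
    have : (⟨(k + 1 + ((c : ℕ) : ℤ) - k - 1).toNat, by omega⟩ : Fin n) = c := by
      apply Fin.ext
      simp only
      omega
    simp only [this]
  obtain ⟨x, hx⟩ := exists_block_eq hp X (Finset.Icc (k + 1) (k + n)) fun j hj => hX j (by
    rw [Finset.mem_Icc] at hj; omega)
  let f : ℕ → ℕ ↪ ℤ := fun e => ⟨fun r => k + e + (r : ℕ), fun a b h => by simpa using h⟩
  -- Used with `e = 1`, `N = n` for the vector and with `e = 0`, `N = n + 2` for its image.
  have hsq : ∀ (g : ℤ → ℝ) (e N : ℕ), (∀ j, (j < k + e ∨ k + e + N ≤ j) → g j = 0) →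
      HasSum g (∑ r ∈ Finset.range N, g (k + e + r)) := by
    intro g e N hg
    have : HasSum g (∑ j ∈ (Finset.range N).map (f e), g j) :=
      hasSum_sum_of_ne_finset_zero fun j hj => hg j (by
        by_contra! h
        refine hj (Finset.mem_map.mpr ⟨(j - k - e).toNat, Finset.mem_range.mpr (by omega), ?_⟩)
        change k + e + (((j - k - e).toNat : ℕ) : ℤ) = j
        omega)
    rwa [Finset.sum_map] at this
  refine ⟨x, ?_, ?_⟩
  · have h1 := (hasSum_sq_norm_block hp x).unique (hsq _ 1 n fun j hj => by
      rw [hx, hX j (by omega), norm_zero, zero_pow two_ne_zero])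
    have h2 := sq_norm_columnVec n k X
    rw [hcol, hv] at h2
    rw [hx] at h1
    have h3 : ‖x‖ ^ 2 = 1 := by
      rw [one_pow] at h2
      rw [h1, Nat.cast_one, ← h2]
    exact (pow_eq_one_iff_of_nonneg (norm_nonneg _) two_ne_zero).mp h3
  · have h0 : 0 ≤ ε := (norm_nonneg _).trans hle
    have h1 := (hasSum_sq_norm_block hp (S x - z • x)).unique (hsq _ 0 (n + 2) fun j hj => by
      rw [block_sub_smul, hST x j, hx, TriMatrix.row, hX (j - 1) (by omega), hX j (by omega),
        hX (j + 1) (by omega)]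
      simp)
    have h2 := sq_norm_plus T n k z X hX
    rw [hcol] at h2
    refine le_of_abs_le (abs_le_of_sq_le_sq ?_ h0)
    refine le_trans (le_of_eq ?_) (pow_le_pow_left₀ (norm_nonneg _) hle 2)
    rw [h1, h2]
    refine Finset.sum_congr rfl fun r _ => ?_
    rw [block_sub_smul, hST x, hx, Nat.cast_zero, add_zero]

/-! ### Matrix entries, transposed operators -/

lemma hasSum_basisVec (x : E) : HasSum (fun j => (x : ℤ → ℂ) j • basisVec j) x := by
  have h := lp.hasSum_single (p := 2) (by norm_num) x
  have h1 : (fun j => (x : ℤ → ℂ) j • basisVec j) = fun j => lp.single 2 j ((x : ℤ → ℂ) j) := by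
    funext j
    rw [basisVec, ← lp.single_smul, smul_eq_mul, mul_one]
  rwa [h1]

lemma ext_entry {A B : E →L[ℂ] E} (h : ∀ i j, entry A i j = entry B i j) : A = B := by
  ext1 x
  have hb : ∀ j, A (basisVec j) = B (basisVec j) := fun j => by
    ext i; exact h i j
  have hA := (hasSum_basisVec x).mapL A
  have hB := (hasSum_basisVec x).mapL B
  simp only [map_smul, hb] at hA hB
  exact hA.unique hB

/-- Complex conjugation of sequences. -/
noncomputable def conjE : E →L⋆[ℂ] E := (starₗᵢ ℂ : E ≃ₗᵢ⋆[ℂ] E).toContinuousLinearEquiv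

@[simp] lemma conjE_apply (x : E) : conjE x = star x := rfl

/-- The operator with the transposed matrix. -/
noncomputable def transp (A : E →L[ℂ] E) : E →L[ℂ] E :=
  (conjE.comp (ContinuousLinearMap.adjoint A)).comp conjE

lemma transp_apply (A : E →L[ℂ] E) (x : E) :
    transp A x = star (ContinuousLinearMap.adjoint A (star x)) := rfl

lemma star_basisVec (j : ℤ) : star (basisVec j) = basisVec j := by
  ext i
  rw [lp.coeFn_star, Pi.star_apply, basisVec, lp.coeFn_single]
  by_cases h : i = j
  · subst h; simp
  · simp [h]

lemma entry_transp (A : E →L[ℂ] E) (i j : ℤ) : entry (transp A) i j = entry A j i := by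
  have h : ∀ (x : E) (i : ℤ), (x : ℤ → ℂ) i = inner ℂ (basisVec i) x := fun x i => by
    rw [basisVec, lp.inner_single_left]; simp
  rw [entry, entry, transp_apply, star_basisVec, lp.coeFn_star, Pi.star_apply, h,
    ContinuousLinearMap.adjoint_inner_right, h]
  exact inner_conj_symm _ _

lemma transp_sub (A B : E →L[ℂ] E) : transp (A - B) = transp A - transp B := by
  ext1 x
  simp [transp_apply]

/-- The two conjugations cancel. Unlike the Hilbert space adjoint, transposition is complex linear,
so `A - z` corresponds to `transp A - z` with the same `z`. -/
lemma transp_smul (c : ℂ) (A : E →L[ℂ] E) : transp (c • A) = c • transp A := by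
  ext1 x
  rw [transp_apply, map_smulₛₗ]
  change star ((starRingEnd ℂ) c • ContinuousLinearMap.adjoint A (star x)) = c • star _
  rw [star_smul]
  simp

lemma transp_one : transp 1 = 1 := by
  ext1 x
  rw [transp_apply, ContinuousLinearMap.one_def, ContinuousLinearMap.adjoint_id]
  simp

lemma transp_mul (A B : E →L[ℂ] E) : transp (A * B) = transp B * transp A := by
  ext1 x
  simp [transp_apply, ContinuousLinearMap.mul_def, ContinuousLinearMap.adjoint_comp]

/-- Transposition does not increase the norm and is an involution. -/
lemma norm_transp (A : E →L[ℂ] E) : ‖transp A‖ = ‖A‖ := by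
  have hle : ∀ A : E →L[ℂ] E, ‖transp A‖ ≤ ‖A‖ := fun A => by
    refine (transp A).opNorm_le_bound (norm_nonneg _) fun x => ?_
    rw [transp_apply, norm_star]
    refine (ContinuousLinearMap.le_opNorm _ _).trans (le_of_eq ?_)
    rw [norm_star, LinearIsometryEquiv.norm_map]
  refine le_antisymm (hle A) ?_
  have h : transp (transp A) = A := ext_entry fun i j => by rw [entry_transp, entry_transp]
  simpa only [h] using hle (transp A)

lemma bandEntry_transp (A : E →L[ℂ] E) (n : ℕ) (i j : ℤ) :
    bandEntry (transp A) n i j = bandEntry A n j i := by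
  rw [bandEntry, bandEntry, entry_transp, abs_sub_comm]

lemma bandApprox_transp (A : E →L[ℂ] E) (n : ℕ) :
    bandApprox (transp A) n = transp (bandApprox A n) := ext_entry fun i j => by
  rw [entry_transp, entry_bandApprox, entry_bandApprox, bandEntry_transp]

/-! ### The blocks of banded approximations -/

lemma bandApprox_apply (A : E →L[ℂ] E) (n : ℕ) (x : E) (i : ℤ) :
    (bandApprox A n x : ℤ → ℂ) i =
      ∑ d ∈ Finset.Icc (-(n : ℤ)) n, bandEntry A n i (i + d) * (x : ℤ → ℂ) (i + d) := by
  simp only [bandApprox, sum_apply, lp.coeFn_sum, Finset.sum_apply]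
  rfl

lemma bandEntry_eq_zero (A : E →L[ℂ] E) {n : ℕ} {i j : ℤ} (h : (n : ℤ) < |i - j|) :
    bandEntry A n i j = 0 := if_neg (not_le.mpr h)

/-- Band-width `n` and block size `n` leave only adjacent blocks. The matrix `T` is described by its
blocks so that the statement also covers adjoints. -/
lemma hasBlocks_bandApprox (A : E →L[ℂ] E) {n : ℕ} (hn : 0 < n) (T : TriMatrix n)
    (hα : ∀ j, T.α j = blockOf (bandEntry A n) n (j + 1) j)
    (hβ : ∀ j, T.β j = blockOf (bandEntry A n) n j j)
    (hγ : ∀ j, T.γ j = blockOf (bandEntry A n) n (j - 1) j) : HasBlocks (bandApprox A n) T := by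
  have : NeZero n := ⟨hn.ne'⟩
  intro x i
  ext s
  rw [block_apply, bandApprox_apply]
  set I : ℤ := n * i + (s : ℕ) + 1 with hI
  let g : ℤ → ℂ := fun J => bandEntry A n I J * (x : ℤ → ℂ) J
  have hg : ∀ J, (n : ℤ) < |I - J| → g J = 0 := fun J h => by
    simp only [g, bandEntry_eq_zero A h, zero_mul]
  have h1 : ∑ d ∈ Finset.Icc (-(n : ℤ)) n, bandEntry A n I (I + d) * (x : ℤ → ℂ) (I + d) =
      ∑ᶠ J, g J := by
    rw [finsum_eq_sum_of_support_subset (s := (Finset.Icc (-(n : ℤ)) n).map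
      (Equiv.addLeft I).toEmbedding), Finset.sum_map]
    · rfl
    · intro J hJ
      have : ¬ (n : ℤ) < |I - J| := fun h => hJ (hg J h)
      rw [not_lt, abs_le] at this
      rw [Finset.mem_coe, Finset.mem_map_equiv, Finset.mem_Icc]
      simp only [Equiv.addLeft_symm, Equiv.coe_addLeft]
      omega
  have h2 : ∑ᶠ J, g J = ∑ j ∈ ({i - 1, i, i + 1} : Finset ℤ), ∑ t : Fin n,
      g (n * j + (t : ℕ) + 1) := by
    rw [finsum_eq_sum_of_support_subset (s := (({i - 1, i, i + 1} : Finset ℤ) ×ˢ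
      (Finset.univ : Finset (Fin n))).map (blockIndex n).toEmbedding), Finset.sum_map,
      Finset.sum_product]
    · simp only [Equiv.coe_toEmbedding, blockIndex_apply]
    · intro J hJ
      have : ¬ (n : ℤ) < |I - J| := fun h => hJ (hg J h)
      rw [not_lt, abs_le] at this
      obtain ⟨⟨j, t⟩, rfl⟩ := (blockIndex n).surjective J
      rw [blockIndex_apply] at this
      rw [Finset.mem_coe, Finset.mem_map_equiv, Equiv.symm_apply_apply, Finset.mem_product]
      refine ⟨?_, Finset.mem_univ _⟩
      simp only [hI] at this
      have hs := s.2
      have ht := t.2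
      have hn' : (0 : ℤ) < n := by exact_mod_cast hn
      -- The entries are at distance at most `n` and their positions within the blocks differ by
      -- less than `n`, so `n |j - i| < 2 n` and the blocks are neighbours.
      have l1 : (n : ℤ) * (j - i) < n * 2 := by linarith [this.1, this.2, (by exact_mod_cast hs :
        ((s : ℕ) : ℤ) < n), (by positivity : (0 : ℤ) ≤ ((t : ℕ) : ℤ))]
      have l2 : (n : ℤ) * (i - j) < n * 2 := by linarith [this.1, this.2, (by exact_mod_cast ht :
        ((t : ℕ) : ℤ) < n), (by positivity : (0 : ℤ) ≤ ((s : ℕ) : ℤ))]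
      have l1' := lt_of_mul_lt_mul_left l1 hn'.le
      have l2' := lt_of_mul_lt_mul_left l2 hn'.le
      simp only [Finset.mem_insert, Finset.mem_singleton]
      omega
  rw [h1, h2, Finset.sum_insert (by simp; omega), Finset.sum_insert (by simp),
    Finset.sum_singleton, ← add_assoc, TriMatrix.row, hα, hβ, hγ]
  simp only [PiLp.add_apply, Matrix.toLpLin_apply, Matrix.mulVec, dotProduct, blockOf,
    Matrix.of_apply, block_apply, sub_add_cancel, add_sub_cancel_right]
  rfl

lemma hasBlocks_toTri (A : BDO) {n : ℕ} (hn : 0 < n) :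
    HasBlocks (bandApprox A.1 n) (toTri A n) :=
  hasBlocks_bandApprox A.1 hn _ (fun _ => rfl) (fun _ => rfl) (fun _ => rfl)

/-- Blockwise transposition combined with the exchange of block indices is transposition of the
scalar matrix, so the results for `A` apply to `transp A` with the adjoint block matrix. -/
lemma hasBlocks_adjoint_toTri (A : BDO) {n : ℕ} (hn : 0 < n) :
    HasBlocks (bandApprox (transp A.1) n) (toTri A n).adjoint := by
  have h : ∀ i j, (blockOf (bandEntry A.1 n) n i j).transpose =
      blockOf (bandEntry (transp A.1) n) n j i := fun i j => by
    ext s t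
    simp [blockOf, bandEntry_transp]
  refine hasBlocks_bandApprox (transp A.1) hn _ (fun j => ?_) (fun j => ?_) (fun j => ?_)
  · change (blockOf _ n (j + 1 - 1) (j + 1)).transpose = _
    rw [h, add_sub_cancel_right]
  · exact h _ _
  · change (blockOf _ n (j - 1 + 1) (j - 1)).transpose = _
    rw [h, sub_add_cancel]

/-- The transpose is the conjugate transpose of the entrywise conjugate, and both operations
preserve the norm. The exact value is needed to bound the off-diagonals of the adjoint by `γ_max`
and `α_max`. -/
lemma norm_transpose {m : ℕ} (M : Matrix (Fin m) (Fin m) ℂ) : ‖M.transpose‖ = ‖M‖ := by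
  have hle : ∀ M : Matrix (Fin m) (Fin m) ℂ, ‖M.map star‖ ≤ ‖M‖ := fun M => by
    rw [Matrix.l2_opNorm_def]
    refine ContinuousLinearMap.opNorm_le_bound _ (norm_nonneg _) fun v => ?_
    let w : EuclideanSpace ℂ (Fin m) := WithLp.toLp 2 fun i => star (v i)
    have hw : ‖w‖ = ‖v‖ := by simp [w, EuclideanSpace.norm_eq]
    have key : ‖Matrix.toEuclideanLin (M.map star) v‖ = ‖Matrix.toEuclideanLin M w‖ := by
      rw [EuclideanSpace.norm_eq, EuclideanSpace.norm_eq]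
      congr 1
      refine Finset.sum_congr rfl fun i _ => ?_
      rw [← norm_star]
      congr 2
      simp [Matrix.toLpLin_apply, Matrix.mulVec, dotProduct, w]
    refine key.le.trans ((norm_toEuclideanLin_le M le_rfl _).trans ?_)
    rw [hw]
  have h1 : M.transpose = (M.map star).conjTranspose := by
    ext i j; simp [Matrix.conjTranspose_apply]
  rw [h1, Matrix.l2_opNorm_conjTranspose]
  refine le_antisymm (hle M) ?_
  have h2 : (M.map star).map star = M := by ext i j; simp
  simpa only [h2] using hle (M.map star)

/-! ### Spectra and approximate eigenvectors -/

/-- A unit vector that `A - z` maps to a vector of norm at most `δ`. -/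
def ApproxEigen (A : E →L[ℂ] E) (z : ℂ) (δ : ℝ) : Prop := ∃ x : E, ‖x‖ = 1 ∧ ‖A x - z • x‖ ≤ δ

lemma ApproxEigen.perturb {A B : E →L[ℂ] E} {z : ℂ} {δ η : ℝ} (h : ApproxEigen A z δ)
    (hη : ‖A - B‖ ≤ η) : ApproxEigen B z (δ + η) := by
  obtain ⟨x, hx, hle⟩ := h
  refine ⟨x, hx, ?_⟩
  have h1 : B x - z • x = (A x - z • x) - (A - B) x := by
    rw [sub_apply]; abel
  have h2 := (A - B).le_of_opNorm_le hη x
  rw [hx, mul_one] at h2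
  rw [h1]
  exact (norm_sub_le _ _).trans (add_le_add hle h2)

/-- If `A - z` is bounded below, it is injective with closed range; if its transpose is bounded
below too, the range has trivial orthogonal complement. Then `A - z` is invertible. -/
lemma approxEigen_of_mem_spectrum {A : E →L[ℂ] E} {z : ℂ} (hz : z ∈ spectrum ℂ A) {δ : ℝ}
    (hδ : 0 < δ) : ApproxEigen A z δ ∨ ApproxEigen (transp A) z δ := by
  by_contra! hcon
  have low : ∀ B : E →L[ℂ] E, ¬ ApproxEigen B z δ → ∀ x, δ * ‖x‖ ≤ ‖B x - z • x‖ := by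
    intro B hB x
    by_cases hx : x = 0
    · simp [hx]
    have hx' : 0 < ‖x‖ := norm_pos_iff.mpr hx
    by_contra! hlt
    refine hB ⟨((‖x‖⁻¹ : ℝ) : ℂ) • x, by simp [norm_smul, hx'.ne'], ?_⟩
    rw [map_smul, smul_comm z, ← smul_sub, norm_smul, Complex.norm_real, norm_inv, norm_norm,
      ← div_eq_inv_mul, div_le_iff₀ hx']
    exact hlt.le
  refine hz ?_
  set B : E →L[ℂ] E := algebraMap ℂ (E →L[ℂ] E) z - A with hB
  have hBx : ∀ x, B x = z • x - A x := fun x => rfl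
  have hlow : ∀ x, δ * ‖x‖ ≤ ‖B x‖ := fun x => by
    rw [hBx, norm_sub_rev]; exact low A hcon.1 x
  have hanti : AntilipschitzWith (Real.toNNReal δ⁻¹) B := by
    refine B.antilipschitz_of_bound fun x => ?_
    rw [Real.coe_toNNReal _ (by positivity), ← div_eq_inv_mul, le_div_iff₀ hδ, mul_comm]
    exact hlow x
  -- The kernel of the Hilbert space adjoint is the complex conjugate of the kernel of the
  -- transpose.
  have hker : ∀ y, ContinuousLinearMap.adjoint B y = 0 → y = 0 := by
    intro y hy
    have h1 : transp B (star y) = 0 := by rw [transp_apply, star_star, hy, star_zero]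
    have h2 : transp B = algebraMap ℂ (E →L[ℂ] E) z - transp A := by
      rw [hB, transp_sub, Algebra.algebraMap_eq_smul_one, transp_smul, transp_one]
    rw [h2] at h1
    have h3 := low _ hcon.2 (star y)
    have h4 : transp A (star y) - z • star y = 0 := by
      rw [← neg_sub, neg_eq_zero]; exact h1
    rw [h4, norm_zero, norm_star] at h3
    have : ‖y‖ = 0 := by nlinarith [norm_nonneg y]
    exact norm_eq_zero.mp this
  refine ContinuousLinearMap.isUnit_iff_bijective.mpr ⟨hanti.injective, ?_⟩
  have hclosed : IsClosed (B.range : Set E) := by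
    have := hanti.isClosed_range B.uniformContinuous
    exact this
  have horth : (B.range)ᗮ = ⊥ := by
    rw [ContinuousLinearMap.orthogonal_range]
    exact (Submodule.eq_bot_iff _).mpr fun y hy => hker y hy
  have htop := (Submodule.topologicalClosure_eq_top_iff).mpr horth
  rw [hclosed.submodule_topologicalClosure_eq] at htop
  exact LinearMap.range_eq_top.mp htop

/-- The resolvent is bounded on the compact set of points in the disc at distance at least `e` from
the spectrum. A bounded inverse excludes approximate eigenvectors with small error, for `A` and, by
transposing the resolvent, for `transp A`. -/
lemma exists_dist_spectrum_le (A : E →L[ℂ] E) (ρ : ℝ) {e : ℝ} (he : 0 < e) :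
    ∃ δ > 0, ∀ z : ℂ, ‖z‖ ≤ ρ → (ApproxEigen A z δ ∨ ApproxEigen (transp A) z δ) →
      ∃ μ ∈ spectrum ℂ A, dist z μ ≤ e := by
  have hne : (spectrum ℂ A).Nonempty := spectrum.nonempty A
  let K : Set ℂ := Metric.closedBall 0 ρ ∩ {z | e ≤ Metric.infDist z (spectrum ℂ A)}
  have hK : IsCompact K := (isCompact_closedBall _ _).inter_right
    (isClosed_le continuous_const (Metric.continuous_infDist_pt _))
  have hres : ∀ z ∈ K, z ∈ resolventSet ℂ A := fun z hz => by
    by_contra h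
    have : Metric.infDist z (spectrum ℂ A) = 0 := Metric.infDist_zero_of_mem h
    have h2 : e ≤ Metric.infDist z (spectrum ℂ A) := hz.2
    linarith
  have hcont : ContinuousOn (resolvent A) K := fun z hz =>
    (spectrum.hasDerivAt_resolvent_const_left (hres z hz)).continuousAt.continuousWithinAt
  obtain ⟨M, hM⟩ := (hK.image_of_continuousOn hcont).isBounded.exists_norm_le
  -- The maximum with `1` guarantees a positive bound, also when the compact set is empty.
  set M' : ℝ := max M 1
  have hM'0 : 0 < M' := lt_max_of_lt_right one_pos
  -- With this `δ` a unit vector would be the image under the resolvent of a vector too short by a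
  -- factor of two: `1 ≤ 1 / 2`.
  refine ⟨1 / (2 * M'), by positivity, fun z hz hδ => ?_⟩
  by_contra! hcon
  have hzK : z ∈ K := ⟨by simpa using hz,
    (Metric.le_infDist hne).mpr fun {μ} hμ => (hcon μ hμ).le⟩
  have hr : ‖resolvent A z‖ ≤ M' := (hM _ ⟨z, hzK, rfl⟩).trans (le_max_left _ _)
  have hunit : IsUnit (algebraMap ℂ (E →L[ℂ] E) z - A) := hres z hzK
  have hb : ∀ r B : E →L[ℂ] E, ‖r‖ ≤ M' → r * (algebraMap ℂ (E →L[ℂ] E) z - B) = 1 →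
      ¬ ApproxEigen B z (1 / (2 * M')) := by
    rintro r B hr h ⟨x, hx, hle⟩
    have h1 : r (z • x - B x) = x := by
      have := congrArg (fun T : E →L[ℂ] E => T x) h
      exact this
    have h2 := r.le_of_opNorm_le hr (z • x - B x)
    rw [h1, hx, norm_sub_rev] at h2
    have h3 : M' * ‖B x - z • x‖ ≤ M' * (1 / (2 * M')) := by gcongr
    have h4 : M' * (1 / (2 * M')) = 1 / 2 := by field_simp
    linarith
  rcases hδ with h | h
  · exact hb _ A hr (Ring.inverse_mul_cancel _ hunit) h
  · refine hb (transp (resolvent A z)) (transp A) (by rwa [norm_transp]) ?_ h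
    have h1 : algebraMap ℂ (E →L[ℂ] E) z - transp A =
        transp (algebraMap ℂ (E →L[ℂ] E) z - A) := by
      rw [transp_sub, Algebra.algebraMap_eq_smul_one, transp_smul, transp_one]
    rw [h1, ← transp_mul, resolvent, Ring.mul_inverse_cancel _ hunit, transp_one]

/-! ### Perturbation of lower norms -/

/-- Its columns are orthonormal, so the C*-identity applies. Only an inequality is claimed, since
the norm is `0` if there are no columns. -/
lemma norm_idPlus_le (p n : ℕ) : ‖idPlus p n‖ ≤ 1 := by
  have h : (idPlus p n).conjTranspose * idPlus p n = 1 := by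
    ext ⟨c, t⟩ ⟨c', t'⟩
    rw [Matrix.mul_apply, Finset.sum_eq_single (⟨(c : ℕ) + 1, by omega⟩, t)]
    · simp only [Matrix.conjTranspose_apply, idPlus, Matrix.of_apply, Matrix.one_apply, and_self,
        if_true, star_one, one_mul, Prod.mk.injEq, Fin.ext_iff, Nat.add_right_cancel_iff]
    · rintro ⟨r, s⟩ - hne
      have : ¬ ((r : ℕ) = (c : ℕ) + 1 ∧ s = t) := fun ⟨h1, h2⟩ => hne (by
        rw [Prod.mk.injEq]; exact ⟨Fin.ext h1, h2⟩)
      simp [idPlus, this]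
    · simp
  have h1 := Matrix.l2_opNorm_conjTranspose_mul_self (idPlus p n)
  rw [h, ← Matrix.diagonal_one, Matrix.l2_opNorm_diagonal] at h1
  have h2 : ‖(fun _ : Fin n × Fin p => (1 : ℂ))‖ ≤ 1 :=
    (pi_norm_le_iff_of_nonneg zero_le_one).mpr fun _ => by simp
  have h3 : ‖(1 : Fin n × Fin p → ℂ)‖ ≤ 1 := h2
  nlinarith [norm_nonneg (idPlus p n)]

lemma lowerNorm_le_of_norm_sub_le {m n : Type} [Fintype m] [Fintype n] [DecidableEq n] [Nonempty n]
    {B C : Matrix m n ℂ} {ε e : ℝ} (hBC : ‖B - C‖ ≤ e) (hC : lowerNorm C ≤ ε) :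
    lowerNorm B ≤ ε + e := by
  obtain ⟨x, hx, hle⟩ := (lowerNorm_le_iff _ _).mp hC
  refine (lowerNorm_le_iff _ _).mpr ⟨x, hx, ?_⟩
  have h1 : Matrix.toEuclideanLin B x =
      Matrix.toEuclideanLin C x + Matrix.toEuclideanLin (B - C) x := by
    rw [map_sub, LinearMap.sub_apply]; abel
  have h2 := norm_toEuclideanLin_le _ hBC x
  rw [hx, mul_one] at h2
  rw [h1]
  exact (norm_add_le _ _).trans (add_le_add hle h2)

/-- Lower norms are 1-Lipschitz in the operator norm. This accounts at once for changing the window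
and for changing the point. -/
lemma lowerNorm_sub_smul_idPlus_le {p n : ℕ} [NeZero p] [NeZero n]
    {B C : Matrix (Fin (n + 2) × Fin p) (Fin n × Fin p) ℂ} {z w : ℂ} {ε e e' : ℝ}
    (hBC : ‖C - B‖ ≤ e) (hzw : ‖z - w‖ ≤ e') (hC : lowerNorm (C - w • idPlus p n) ≤ ε) :
    lowerNorm (B - z • idPlus p n) ≤ ε + (e + e') := by
  refine lowerNorm_le_of_norm_sub_le ?_ hC
  have h1 : B - z • idPlus p n - (C - w • idPlus p n) = -(C - B) - (z - w) • idPlus p n := by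
    rw [sub_smul]; abel
  rw [h1]
  refine (norm_sub_le _ _).trans (add_le_add (by rwa [norm_neg]) ?_)
  rw [norm_smul]
  calc _ ≤ ‖z - w‖ * 1 := by gcongr; exact norm_idPlus_le p n
    _ ≤ e' := by rwa [mul_one]

/-! ### The inclusion of the spectrum -/

/-- Rounding strictly towards zero, even at integers: the grid is cut off by an open disc, while a
spectral point may lie on its boundary. -/
lemma exists_int_abs_lt (t : ℝ) : ∃ a : ℤ, |(a : ℝ) - t| ≤ 1 ∧ (t = 0 → a = 0) ∧
    |(a : ℝ)| ≤ |t| ∧ (t ≠ 0 → |(a : ℝ)| < |t|) := by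
  rcases lt_trichotomy t 0 with h | rfl | h
  · have h1 : (0 : ℝ) ≤ -(⌊t⌋ + 1 : ℤ) := by
      have : ⌊t⌋ < 0 := Int.floor_lt.mpr (by simpa using h)
      have : ⌊t⌋ + 1 ≤ 0 := this
      exact_mod_cast neg_nonneg.mpr this
    have h2 := Int.floor_le t
    have h3 := Int.lt_floor_add_one t
    have h4 : |((⌊t⌋ + 1 : ℤ) : ℝ)| < |t| := by
      rw [abs_of_neg h, abs_of_nonpos (by linarith)]
      push_cast; linarith
    refine ⟨⌊t⌋ + 1, ?_, fun h0 => absurd h0 h.ne, h4.le, fun _ => h4⟩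
    rw [abs_le]; push_cast; constructor <;> linarith
  · exact ⟨0, by simp⟩
  · have h1 : (0 : ℝ) ≤ (⌈t⌉ - 1 : ℤ) := by
      have : 0 < ⌈t⌉ := Int.ceil_pos.mpr h
      have : 0 ≤ ⌈t⌉ - 1 := by omega
      exact_mod_cast this
    have h2 := Int.le_ceil t
    have h3 := Int.ceil_lt_add_one t
    have h4 : |((⌈t⌉ - 1 : ℤ) : ℝ)| < |t| := by
      rw [abs_of_pos h, abs_of_nonneg h1]
      push_cast; linarith
    refine ⟨⌈t⌉ - 1, ?_, fun h0 => absurd h0 h.ne', h4.le, fun _ => h4⟩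
    rw [abs_le]; push_cast; constructor <;> linarith

lemma exists_mem_Grid {n : ℕ} (hn : 0 < n) {r : ℝ} {μ : ℂ} (hμ : ‖μ‖ ≤ r) :
    ∃ z ∈ Grid n r, ‖z - μ‖ ≤ 2 / n := by
  have hn' : (0 : ℝ) < n := by exact_mod_cast hn
  have hr : 0 ≤ r := (norm_nonneg _).trans hμ
  obtain ⟨a, ha1, ha0, hale, halt⟩ := exists_int_abs_lt (n * μ.re)
  obtain ⟨b, hb1, hb0, hble, hblt⟩ := exists_int_abs_lt (n * μ.im)
  set z : ℂ := ((a : ℂ) + (b : ℂ) * Complex.I) / (n : ℂ) with hz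
  have hre : z.re = a / n := by
    rw [hz, ← Complex.ofReal_natCast, Complex.div_ofReal_re]; simp
  have him : z.im = b / n := by
    rw [hz, ← Complex.ofReal_natCast, Complex.div_ofReal_im]; simp
  refine ⟨z, ⟨⟨a, b, hz⟩, ?_⟩, ?_⟩
  · rw [mem_smul_ball_iff hr]
    -- For `μ = 0` the modulus cannot decrease; the origin is then itself the grid point, and it
    -- belongs to the grid also if `r = 0`.
    by_cases h0 : μ = 0
    · have hz0 : z = 0 := by
        rw [hz, ha0 (by simp [h0]), hb0 (by simp [h0])]; simp
      rcases hr.eq_or_lt with h | h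
      · exact Or.inr ⟨h.symm, hz0⟩
      · left; rwa [hz0, norm_zero]
    · left
      refine lt_of_lt_of_le ?_ hμ
      refine lt_of_pow_lt_pow_left₀ 2 (norm_nonneg _) ?_
      rw [← Complex.normSq_eq_norm_sq, ← Complex.normSq_eq_norm_sq, Complex.normSq_apply,
        Complex.normSq_apply, hre, him]
      have e1 : (a : ℝ) ^ 2 ≤ (n * μ.re) ^ 2 := sq_le_sq.mpr hale
      have e2 : (b : ℝ) ^ 2 ≤ (n * μ.im) ^ 2 := sq_le_sq.mpr hble
      have e3 : (a : ℝ) ^ 2 + (b : ℝ) ^ 2 < (n * μ.re) ^ 2 + (n * μ.im) ^ 2 := by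
        by_cases h1 : μ.re = 0
        · have h2 : μ.im ≠ 0 := fun h2 => h0 (Complex.ext h1 h2)
          exact add_lt_add_of_le_of_lt e1 (sq_lt_sq.mpr (hblt (mul_ne_zero hn'.ne' h2)))
        · exact add_lt_add_of_lt_of_le (sq_lt_sq.mpr (halt (mul_ne_zero hn'.ne' h1))) e2
      have e4 : (a : ℝ) / n * (a / n) + b / n * (b / n) = ((a : ℝ) ^ 2 + (b : ℝ) ^ 2) / n ^ 2 := by
        field_simp
      rw [e4, div_lt_iff₀ (by positivity)]
      linarith
  · refine (Complex.norm_le_abs_re_add_abs_im _).trans ?_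
    rw [Complex.sub_re, Complex.sub_im, hre, him]
    have e : ∀ c t : ℝ, |c - n * t| ≤ 1 → |c / n - t| ≤ 1 / n := by
      intro c t h
      rw [le_div_iff₀ hn', ← abs_of_pos hn', ← abs_mul, abs_of_pos hn', sub_mul,
        div_mul_cancel₀ _ hn'.ne', mul_comm t]
      exact h
    calc _ ≤ 1 / (n : ℝ) + 1 / n := add_le_add (e _ _ ha1) (e _ _ hb1)
      _ = 2 / n := by ring

namespace InputMaps

variable (𝓘 : InputMaps) (A : BDO) {n : ℕ}

lemma norm_bandApprox_le (hn : 0 < n) : ‖bandApprox A.1 n‖ ≤ 𝓘.αmax n (toTri A n) +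
    𝓘.βmax n (toTri A n) + 𝓘.γmax n (toTri A n) :=
  (hasBlocks_toTri A hn).norm_le hn (𝓘.le_αmax _ _) (𝓘.le_βmax _ _) (𝓘.le_γmax _ _)

lemma norm_le_R (hn : 0 < n) : ‖A.1‖ ≤ 𝓘.R A n := by
  have h1 : A.1 = bandApprox A.1 n + (A.1 - bandApprox A.1 n) := by abel
  rw [h1]
  exact (norm_add_le _ _).trans (add_le_add (𝓘.norm_bandApprox_le A hn) (𝓘.le_η A n hn))

lemma norm_transp_sub_le (hn : 0 < n) :
    ‖transp A.1 - bandApprox (transp A.1) n‖ ≤ 𝓘.η A n := by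
  rw [bandApprox_transp, ← transp_sub, norm_transp]
  exact 𝓘.le_η A n hn

lemma norm_adjoint_α_le (j : ℤ) : ‖(toTri A n).adjoint.α j‖ ≤ 𝓘.γmax n (toTri A n) :=
  (norm_transpose _).trans_le (𝓘.le_γmax _ _ _)

lemma norm_adjoint_γ_le (j : ℤ) : ‖(toTri A n).adjoint.γ j‖ ≤ 𝓘.αmax n (toTri A n) :=
  (norm_transpose _).trans_le (𝓘.le_αmax _ _ _)

/-- The error budget: `η_n` for the banded approximation, `ε_n^*` for the window, `1 / n` for its
replacement in `K_n`, and `2 / n` for the replacement of `μ` by `z`. -/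
lemma muFin_le_of_mem_spectrum (hn : 0 < n) {μ z : ℂ} (hμ : μ ∈ spectrum ℂ A.1)
    (hz : ‖z - μ‖ ≤ 2 / n) : muFin (toTri A n) (𝓘.Kset A n) n z ≤
      𝓘.εstar A n + 3 / (n : ℝ) + 𝓘.η A n := by
  have : NeZero n := ⟨hn.ne'⟩
  -- Half of `δ` is spent on the approximate eigenvector, half on the choice of the window; both
  -- disappear in the limit.
  refine le_of_forall_pos_le_add fun δ hδ => ?_
  have hη := 𝓘.η_nonneg A n hn
  rw [muFin_le_iff _ _ (𝓘.Kset_nonempty A hn)]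
  have fin : ∀ L : ℝ, L ≤ 𝓘.η A n + δ / 2 + 𝓘.εstar A n + δ / 2 + (1 / (n : ℝ) + 2 / n) →
      L ≤ 𝓘.εstar A n + 3 / (n : ℝ) + 𝓘.η A n + δ := fun L hL => by
    have : 1 / (n : ℝ) + 2 / n = 3 / n := by ring
    linarith
  rcases approxEigen_of_mem_spectrum hμ (half_pos hδ) with h | h
  · obtain ⟨x, hx, hle⟩ := h.perturb (𝓘.le_η A n hn)
    obtain ⟨k, hk⟩ := (hasBlocks_toTri A hn).exists_lowerNorm_le hn hn (𝓘.le_αmax _ _)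
      (𝓘.le_γmax _ _) (z := μ) (d := 𝓘.η A n + δ / 2) (by positivity) (half_pos hδ) (x := x)
      (norm_ne_zero_iff.mp (by rw [hx]; exact one_ne_zero)) (by rw [hx]; linarith)
    obtain ⟨j, hj, h1, -⟩ := 𝓘.K_spec n (toTri A n) n hn k
    exact ⟨j, hj, Or.inl (fin _ (lowerNorm_sub_smul_idPlus_le h1 hz hk))⟩
  · obtain ⟨x, hx, hle⟩ := h.perturb (𝓘.norm_transp_sub_le A hn)
    obtain ⟨k, hk⟩ := (hasBlocks_adjoint_toTri A hn).exists_lowerNorm_le hn hn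
      (𝓘.norm_adjoint_α_le A) (𝓘.norm_adjoint_γ_le A) (z := μ) (d := 𝓘.η A n + δ / 2)
      (by positivity) (half_pos hδ) (x := x)
      (norm_ne_zero_iff.mp (by rw [hx]; exact one_ne_zero)) (by rw [hx]; linarith)
    -- The adjoint exchanges the roles of the two off-diagonals, and `ε_n^*` is symmetric in them.
    rw [add_comm (𝓘.γmax n (toTri A n))] at hk
    obtain ⟨j, hj, -, h1⟩ := 𝓘.K_spec n (toTri A n) n hn k
    exact ⟨j, hj, Or.inr (fin _ (lowerNorm_sub_smul_idPlus_le h1 hz hk))⟩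

lemma exists_mem_GammaFin (hn : 0 < n) {μ : ℂ} (hμ : μ ∈ spectrum ℂ A.1) :
    ∃ z ∈ 𝓘.GammaFin A n, ‖z - μ‖ ≤ 2 / n := by
  obtain ⟨z, hz, hle⟩ := exists_mem_Grid hn
    ((spectrum.norm_le_norm_of_mem hμ).trans (𝓘.norm_le_R A hn))
  exact ⟨z, ⟨𝓘.muFin_le_of_mem_spectrum A hn hμ hle, hz⟩, hle⟩

lemma smul_closedBall_eq (hn : 0 < n) :
    (2 / (n : ℝ)) • Metric.closedBall (0 : ℂ) 1 = Metric.closedBall 0 (2 / n) := by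
  have : (0 : ℝ) < n := by exact_mod_cast hn
  rw [smul_closedBall _ _ zero_le_one, smul_zero, mul_one, Real.norm_eq_abs,
    abs_of_nonneg (by positivity)]

theorem spectrum_subset_GammaHat (hn : 0 < n) : spectrum ℂ A.1 ⊆ 𝓘.GammaHat A n := by
  intro μ hμ
  obtain ⟨z, hz, hle⟩ := 𝓘.exists_mem_GammaFin A hn hμ
  rw [GammaHat, smul_closedBall_eq hn]
  refine ⟨z, hz, μ - z, ?_, by simp⟩
  rwa [mem_closedBall_zero_iff, norm_sub_rev]

/-! ### Convergence -/

lemma norm_le_R_of_mem_GammaFin (hn : 0 < n) {z : ℂ} (hz : z ∈ 𝓘.GammaFin A n) :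
    ‖z‖ ≤ 𝓘.R A n := by
  have hR := 𝓘.R_nonneg A hn
  rcases (mem_smul_ball_iff hR z).mp hz.2.2 with h | ⟨h, rfl⟩
  · exact h.le
  · simpa using hR

/-- The second `η_n` is the cost of returning from the banded approximation to `A`. -/
lemma approxEigen_of_mem_GammaFin (hn : 0 < n) {z : ℂ} (hz : z ∈ 𝓘.GammaFin A n) {δ : ℝ}
    (hδ : 𝓘.εstar A n + 3 / (n : ℝ) + 𝓘.η A n + 𝓘.η A n ≤ δ) :
    ApproxEigen A.1 z δ ∨ ApproxEigen (transp A.1) z δ := by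
  have mono : ∀ {B : E →L[ℂ] E} {e : ℝ}, ApproxEigen B z e → e ≤ δ → ApproxEigen B z δ :=
    fun ⟨x, hx, h⟩ he => ⟨x, hx, h.trans he⟩
  obtain ⟨k, -, h⟩ := (muFin_le_iff _ _ (𝓘.Kset_nonempty A hn) _ _ _).mp hz.1
  refine h.imp (fun h => ?_) (fun h => ?_)
  · have h1 : ApproxEigen _ _ _ := (hasBlocks_toTri A hn).exists_norm_le hn hn h
    exact mono (h1.perturb (norm_sub_rev A.1 _ ▸ 𝓘.le_η A n hn)) hδ
  · have h1 : ApproxEigen _ _ _ := (hasBlocks_adjoint_toTri A hn).exists_norm_le hn hn h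
    exact mono (h1.perturb (norm_sub_rev (transp A.1) _ ▸ 𝓘.norm_transp_sub_le A hn)) hδ

/-- Boundedness of `R_n` serves twice: all points lie in one fixed disc, where a single `δ` works,
and `α_max + γ_max` is bounded, so that `ε_n^*` tends to `0`. -/
lemma eventually_dist_spectrum_le (hR : BddAbove (Set.range (𝓘.R A))) {e : ℝ} (he : 0 < e) :
    ∀ᶠ n in atTop, ∀ z ∈ 𝓘.GammaFin A n, ∃ μ ∈ spectrum ℂ A.1, dist z μ ≤ e := by
  obtain ⟨ρ, hρ⟩ := hR
  have hρ' : ∀ n, 𝓘.R A n ≤ ρ := fun n => hρ ⟨n, rfl⟩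
  obtain ⟨δ, hδ, H⟩ := exists_dist_spectrum_le A.1 ρ he
  have hlim : Tendsto (fun n : ℕ => ρ * (22 / 7 * (1 / ((n : ℝ) + 1))) + 3 * (1 / (n : ℝ)) +
      𝓘.η A n + 𝓘.η A n) atTop (𝓝 (ρ * (22 / 7 * 0) + 3 * 0 + 0 + 0)) :=
    (((tendsto_one_div_add_atTop_nhds_zero_nat.const_mul _).const_mul _).add
      (tendsto_one_div_atTop_nhds_zero_nat.const_mul _)).add (𝓘.η_tendsto A) |>.add (𝓘.η_tendsto A)
  have hev := hlim.eventually_lt_const (u := δ) (by simpa using hδ)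
  filter_upwards [hev, eventually_gt_atTop 0] with n hn hn0 z hz
  refine H z ((𝓘.norm_le_R_of_mem_GammaFin A hn0 hz).trans (hρ' n))
    (𝓘.approxEigen_of_mem_GammaFin A hn0 hz (le_trans ?_ hn.le))
  have h1 : 𝓘.εstar A n ≤ ρ * (22 / 7 * (1 / ((n : ℝ) + 1))) := by
    have h2 : 𝓘.αmax n (toTri A n) + 𝓘.γmax n (toTri A n) ≤ ρ := by
      have := hρ' n
      have h3 := 𝓘.βmax_nonneg (toTri A n)
      have h4 := 𝓘.η_nonneg A n hn0
      unfold R at this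
      linarith
    have h3 : 22 / (7 * ((n : ℝ) + 1)) = 22 / 7 * (1 / ((n : ℝ) + 1)) := by field_simp
    rw [εstar, h3]
    gcongr
  have h2 : 3 / (n : ℝ) = 3 * (1 / (n : ℝ)) := by ring
  rw [h2]
  gcongr

lemma eventually_two_div_le {e : ℝ} (he : 0 < e) : ∀ᶠ n : ℕ in atTop, 2 / (n : ℝ) ≤ e := by
  have h := (tendsto_one_div_atTop_nhds_zero_nat (𝕜 := ℝ)).const_mul 2
  rw [mul_zero] at h
  filter_upwards [h.eventually_lt_const he] with n hn
  rw [← mul_one_div]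
  exact hn.le

lemma tendsto_zero_of_eventually_le_ofReal {f : ℕ → ENNReal}
    (h : ∀ e : ℝ, 0 < e → ∀ᶠ n in atTop, f n ≤ ENNReal.ofReal e) : Tendsto f atTop (𝓝 0) := by
  refine ENNReal.tendsto_nhds_zero.mpr fun ε hε => ?_
  obtain ⟨e, he0, he⟩ := ENNReal.lt_iff_exists_real_btwn.mp hε
  exact (h e (ENNReal.ofReal_pos.mp he.1)).mono fun n hn => hn.trans he.2.le

theorem tendsto_GammaFin (hR : BddAbove (Set.range (𝓘.R A))) :
    Tendsto (fun n => Metric.hausdorffEDist (𝓘.GammaFin A n) (spectrum ℂ A.1)) atTop (𝓝 0) := by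
  refine tendsto_zero_of_eventually_le_ofReal fun e he => ?_
  filter_upwards [𝓘.eventually_dist_spectrum_le A hR he, eventually_two_div_le he,
    eventually_gt_atTop 0] with n h1 h2 hn
  refine Metric.hausdorffEDist_le_of_mem_edist (fun z hz => ?_) (fun μ hμ => ?_)
  · obtain ⟨μ, hμ, h⟩ := h1 z hz
    exact ⟨μ, hμ, by rw [edist_dist]; exact ENNReal.ofReal_le_ofReal h⟩
  · obtain ⟨z, hz, h⟩ := 𝓘.exists_mem_GammaFin A hn hμ
    refine ⟨z, hz, ?_⟩
    rw [edist_dist, dist_comm, dist_eq_norm]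
    exact ENNReal.ofReal_le_ofReal (h.trans h2)

lemma hausdorffEDist_GammaHat_le (hn : 0 < n) :
    Metric.hausdorffEDist (𝓘.GammaHat A n) (𝓘.GammaFin A n) ≤ ENNReal.ofReal (2 / n) := by
  rw [GammaHat, smul_closedBall_eq hn]
  refine Metric.hausdorffEDist_le_of_mem_edist ?_ (fun z hz => ⟨z, ⟨z, hz, 0, ?_, add_zero z⟩, ?_⟩)
  · rintro _ ⟨z, hz, w, hw, rfl⟩
    refine ⟨z, hz, ?_⟩
    rw [edist_dist, dist_eq_norm]
    refine ENNReal.ofReal_le_ofReal ?_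
    simpa using hw
  · exact Metric.mem_closedBall_self (by positivity)
  · simp

theorem tendsto_GammaHat (hR : BddAbove (Set.range (𝓘.R A))) :
    Tendsto (fun n => Metric.hausdorffEDist (𝓘.GammaHat A n) (spectrum ℂ A.1)) atTop (𝓝 0) := by
  have h1 : Tendsto (fun n => Metric.hausdorffEDist (𝓘.GammaHat A n) (𝓘.GammaFin A n)) atTop
      (𝓝 0) := by
    refine tendsto_zero_of_eventually_le_ofReal fun e he => ?_
    filter_upwards [eventually_two_div_le he, eventually_gt_atTop 0] with n h hn
    exact (𝓘.hausdorffEDist_GammaHat_le A hn).trans (ENNReal.ofReal_le_ofReal h)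
  have h2 := h1.add (𝓘.tendsto_GammaFin A hR)
  rw [add_zero] at h2
  exact tendsto_of_tendsto_of_tendsto_of_le_of_le tendsto_const_nhds h2 (fun _ => zero_le)
    (fun _ => Metric.hausdorffEDist_triangle)

end InputMaps

/-! ### General algorithms -/

/-- Injectivity of the codes turns equal oracle answers into equal sets, bounds and matrices. -/
lemma Data.ofList_injective : Function.Injective Data.ofList := by
  intro l
  induction l with
  | nil => intro l' h; cases l' <;> simp_all [Data.ofList]
  | cons a l ih =>
    intro l' h
    cases l' with
    | nil => simp [Data.ofList] at h
    | cons b l' =>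
      simp only [Data.ofList, Data.pair.injEq] at h
      rw [h.1, ih h.2]

lemma Enc.list_injective {X : Type} [Enc X] (h : Function.Injective (Enc.enc (X := X))) :
    Function.Injective (Enc.enc (X := List X)) := fun _ _ hl =>
  List.map_injective_iff.mpr h (Data.ofList_injective hl)

lemma Enc.complex_injective : Function.Injective (Enc.enc (X := ℂ)) := fun z w h => by
  injection h with h1 h2
  injection h1 with h1
  injection h2 with h2
  exact Complex.ext h1 h2

lemma Enc.int_injective : Function.Injective (Enc.enc (X := ℤ)) := fun z w h => by
  injection h with h
  exact_mod_cast h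

lemma Data.ofIntFinset_injective : Function.Injective Data.ofIntFinset := fun K L h => by
  rw [← enc_sort, ← enc_sort] at h
  have := congrArg List.toFinset (Enc.list_injective Enc.int_injective h)
  rwa [Finset.sort_toFinset, Finset.sort_toFinset] at this

lemma Data.ofMatrix_injective {a b c d : ℕ} :
    Function.Injective (Data.ofMatrix (a := a) (b := b) (c := c) (d := d)) := fun M N h => by
  rw [← enc_matrixRows, ← enc_matrixRows] at h
  have h1 := Enc.list_injective (Enc.list_injective Enc.complex_injective) h
  ext r s
  have h2 := listEntry_matrixRows M (finProdFinEquiv r) (finProdFinEquiv s)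
  rw [h1, listEntry_matrixRows] at h2
  simpa using h2.symm

lemma eval_sub_eq {𝓘 : InputMaps} {A B : BDO} {k : ℤ} {n : ℕ+}
    (h : (spectralProblem 𝓘).eval (SpecQuery.sub k n) B =
      (spectralProblem 𝓘).eval (SpecQuery.sub k n) A) :
    (toTri B n).plus n k = (toTri A n).plus n k ∧
      (toTri B n).adjoint.plus n k = (toTri A n).adjoint.plus n k := by
  injection h with h1 h2
  exact ⟨Data.ofMatrix_injective h1, Data.ofMatrix_injective h2⟩

/-- Agreement on the query for `K_n` already makes the two query sets coincide; the other answers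
then determine the whole input of the computation. -/
lemma eq_of_eval_eq {𝓘 : InputMaps} {A B : BDO} {n : ℕ+}
    (h : ∀ q ∈ neededQueries 𝓘 A n, (spectralProblem 𝓘).eval q B = (spectralProblem 𝓘).eval q A) :
    gammaInput 𝓘 B n = gammaInput 𝓘 A n ∧ neededQueries 𝓘 B n = neededQueries 𝓘 A n := by
  have hK : 𝓘.Kset B n = 𝓘.Kset A n :=
    Data.ofIntFinset_injective (h (SpecQuery.cover n) (Or.inl (Or.inl rfl)))
  have hb := h (SpecQuery.bounds n) (Or.inl (Or.inr (Or.inl rfl)))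
  have hη := h (SpecQuery.error n) (Or.inl (Or.inr (Or.inr rfl)))
  injection hb with hb1 hb
  injection hb with hb2 hb3
  injection hb1 with hb1
  injection hb2 with hb2
  injection hb3 with hb3
  injection hη with hη
  constructor
  · rw [gammaInput, gammaInput, hK, hb1, hb2, hb3, hη]
    congr 2
    refine List.foldl_ext _ _ _ fun l k hk => ?_
    obtain ⟨h1, h2⟩ := eval_sub_eq (h (SpecQuery.sub k n) (Or.inr ⟨k, by simpa using hk, rfl⟩))
    rw [h1, h2]
  · rw [neededQueries, neededQueries, hK]

lemma isGeneralAlgorithm_of_gammaInput {β : Type} (𝓘 : InputMaps) (n : ℕ+) (Γ : BDO → β)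
    (hΓ : ∀ A B, gammaInput 𝓘 B n = gammaInput 𝓘 A n → Γ B = Γ A) :
    (spectralProblem 𝓘).IsGeneralAlgorithm Γ :=
  ⟨fun A => neededQueries 𝓘 A n, fun A => ⟨finite_neededQueries 𝓘 A n,
    ⟨SpecQuery.cover n, Or.inl (Or.inl rfl)⟩, fun B hB =>
      ⟨hΓ A B (eq_of_eval_eq hB).1, (eq_of_eval_eq hB).2⟩⟩⟩

lemma GammaFin_eq_of_gammaInput_eq {𝓘 : InputMaps} {n : ℕ+} {A B : BDO}
    (h : gammaInput 𝓘 B n = gammaInput 𝓘 A n) : 𝓘.GammaFin B n = 𝓘.GammaFin A n := by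
  rw [GammaFin_eq_pointsOfInput, GammaFin_eq_pointsOfInput, h]

theorem isGeneralAlgorithm_GammaFin (𝓘 : InputMaps) (n : ℕ+) :
    (spectralProblem 𝓘).IsGeneralAlgorithm (fun A => 𝓘.GammaFin A n) :=
  isGeneralAlgorithm_of_gammaInput 𝓘 n _ fun _ _ h => GammaFin_eq_of_gammaInput_eq h

theorem isGeneralAlgorithm_GammaHat (𝓘 : InputMaps) (n : ℕ+) :
    (spectralProblem 𝓘).IsGeneralAlgorithm (fun A => 𝓘.GammaHat A n) :=
  isGeneralAlgorithm_of_gammaInput 𝓘 n _ fun _ _ h => by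
    rw [InputMaps.GammaHat, InputMaps.GammaHat, GammaFin_eq_of_gammaInput_eq h]

lemma toTri_blockAt (A : BDO) (n : ℕ) {i j : ℤ} (h : i = j + 1 ∨ i = j ∨ i = j - 1) :
    (toTri A n).blockAt i j = blockOf (bandEntry A.1 n) n i j := by
  rcases h with rfl | rfl | rfl
  · rw [TriMatrix.blockAt, if_pos rfl]; rfl
  · rw [TriMatrix.blockAt, if_neg (by omega), if_pos rfl]; rfl
  · rw [TriMatrix.blockAt, if_neg (by omega), if_neg (by omega), if_pos rfl]; rfl

/-- Every entry of `A` can be recovered from a suitable submatrix, because its weight in the banded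
approximation is nonzero as soon as `n` exceeds the distance to the diagonal. -/
theorem separates_spectralProblem (𝓘 : InputMaps) : (spectralProblem 𝓘).Separates := by
  intro A B h
  refine Subtype.ext (ext_entry fun i j => ?_)
  let n : ℕ+ := ⟨(i - j).natAbs + 1, by omega⟩
  have hn : (n : ℕ) = (i - j).natAbs + 1 := rfl
  have : NeZero (n : ℕ) := ⟨n.pos.ne'⟩
  have hij : |i - j| < (n : ℕ) := by rw [hn, Int.abs_eq_natAbs]; omega
  obtain ⟨⟨bi, s⟩, hi⟩ := (blockIndex n).surjective i
  obtain ⟨⟨bj, t⟩, hj⟩ := (blockIndex n).surjective j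
  rw [blockIndex_apply] at hi hj
  have hb : bi = bj + 1 ∨ bi = bj ∨ bi = bj - 1 := by
    have hn' : (0 : ℤ) < (n : ℕ) := by exact_mod_cast n.pos
    have hs : ((s : ℕ) : ℤ) < (n : ℕ) := by exact_mod_cast s.2
    have ht : ((t : ℕ) : ℤ) < (n : ℕ) := by exact_mod_cast t.2
    have hs0 : (0 : ℤ) ≤ ((s : ℕ) : ℤ) := by positivity
    have ht0 : (0 : ℤ) ≤ ((t : ℕ) : ℤ) := by positivity
    have habs := abs_lt.mp hij
    simp only at hi hj
    have l1 : ((n : ℕ) : ℤ) * (bi - bj) < (n : ℕ) * 2 := by linarith [habs.2]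
    have l2 : ((n : ℕ) : ℤ) * (bj - bi) < (n : ℕ) * 2 := by linarith [habs.1]
    have l1' := lt_of_mul_lt_mul_left l1 hn'.le
    have l2' := lt_of_mul_lt_mul_left l2 hn'.le
    omega
  -- The window at `k = bj - 1` begins with block column `bj`; block row `bi` then has position `bi
  -- - bj + 1`, which is `0`, `1` or `2`.
  have key : ∀ C : BDO, (toTri C n).plus n (bj - 1)
      (⟨(bi - bj + 1).toNat, by have := n.pos; omega⟩, s) (⟨0, n.pos⟩, t) =
        bandEntry C.1 n i j := by
    intro C
    have e1 : bj - 1 + (((bi - bj + 1).toNat : ℕ) : ℤ) = bi := by omega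
    have e2 : bj - 1 + 1 + ((0 : ℕ) : ℤ) = bj := by omega
    simp only [TriMatrix.plus, Matrix.of_apply, e1, e2]
    rw [toTri_blockAt C n hb, blockOf, Matrix.of_apply, ← hi, ← hj]
  have h1 : bandEntry A.1 n i j = bandEntry B.1 n i j := by
    rw [← key, ← key, (eval_sub_eq (h (SpecQuery.sub (bj - 1) n))).1]
  rw [bandEntry, bandEntry, if_pos hij.le, if_pos hij.le] at h1
  refine mul_left_cancel₀ ?_ h1
  rw [Complex.ofReal_ne_zero]
  have h2 : ((|i - j| : ℤ) : ℝ) < (n : ℕ) := by exact_mod_cast hij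
  have h3 : ((|i - j| : ℤ) : ℝ) / (((n : ℕ) : ℝ) + 1) < 1 := by
    rw [div_lt_one (by positivity)]; linarith
  linarith

/-! ### Towers of algorithms -/

/-- `Γⁿ_fin(A)` as a non-empty compact set. -/
noncomputable def gammaFinCompact (𝓘 : InputMaps) (A : BDO) (n : ℕ+) :
    TopologicalSpace.NonemptyCompacts ℂ where
  carrier := 𝓘.GammaFin A n
  isCompact' := by
    rw [GammaFin_eq_pointsOfInput]
    exact (List.finite_toSet _).isCompact
  nonempty' := by
    obtain ⟨μ, hμ⟩ := spectrum.nonempty A.1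
    obtain ⟨z, hz, -⟩ := 𝓘.exists_mem_GammaFin A n.pos hμ
    exact ⟨z, hz⟩

/-- `Γ̂ⁿ_fin(A)` as a non-empty compact set. -/
noncomputable def gammaHatCompact (𝓘 : InputMaps) (A : BDO) (n : ℕ+) :
    TopologicalSpace.NonemptyCompacts ℂ where
  carrier := 𝓘.GammaHat A n
  isCompact' := by
    rw [InputMaps.GammaHat, InputMaps.smul_closedBall_eq n.pos]
    exact (gammaFinCompact 𝓘 A n).isCompact.add (isCompact_closedBall _ _)
  nonempty' := (spectrum.nonempty A.1).mono (𝓘.spectrum_subset_GammaHat A n.pos)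

/-- The index `2^(m+1)`, for which the points are within `2^(-m)` of the spectrum. -/
def towerIndex (m : ℕ) : ℕ+ := ⟨2 ^ (m + 1), by positivity⟩

lemma BSSComp.two_pow_succ : BSSComp (fun m : ℕ => 2 ^ (m + 1)) := by
  have h : ∀ m : ℕ, 2 ^ (m + 1) = (fun k => k + k)^[m] 2 := by
    intro m
    induction m with
    | zero => rfl
    | succ m ih => rw [Function.iterate_succ_apply', ← ih]; ring
  simp only [h]
  exact BSSComp.iterate (step := fun _ k => k + k) BSSComp.id (BSSComp.natConst 2)
    (BSSComp.id.snd.natAdd BSSComp.id.snd)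

lemma BSSComp.pointsToDiscs :
    BSSComp (fun l : List ℂ => l.foldl (fun s z => (z, (0 : ℝ)) :: s) []) :=
  BSSComp.foldl (step := fun _ s z => (z, (0 : ℝ)) :: s) BSSComp.id BSSComp.nil
    ((BSSComp.id.snd.fst.pair (BSSComp.const 0)).cons BSSComp.id.snd.snd)

lemma mem_pointsToDiscs (l : List ℂ) (q : ℂ × ℝ) (s : List (ℂ × ℝ)) :
    q ∈ l.foldl (fun s z => (z, (0 : ℝ)) :: s) s ↔ (∃ z ∈ l, q = (z, 0)) ∨ q ∈ s := by
  induction l generalizing s with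
  | nil => simp
  | cons a l ih => rw [List.foldl_cons, ih]; simp [or_assoc, or_left_comm]

lemma discUnion_pointsToDiscs (l : List ℂ) :
    discUnion (l.foldl (fun s z => (z, (0 : ℝ)) :: s) []) = {z | z ∈ l} := by
  ext z
  change (∃ q : ℂ × ℝ, q ∈ _ ∧ z ∈ Metric.closedBall q.1 q.2) ↔ z ∈ l
  constructor
  · rintro ⟨q, hq, hz⟩
    obtain ⟨w, hw, rfl⟩ := ((mem_pointsToDiscs l q []).mp hq).resolve_right (by simp)
    simp only [Metric.closedBall_zero, Set.mem_singleton_iff] at hz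
    rwa [hz]
  · intro hz
    exact ⟨(z, 0), (mem_pointsToDiscs l _ []).mpr (Or.inl ⟨z, hz, rfl⟩), by simp⟩

lemma exists_program_tower : ∃ c : Program, ∀ (𝓘 : InputMaps) (v : Fin 1 → ℕ) (A : BDO),
    ∃ l : List (ℂ × ℝ), Runs ((spectralProblem 𝓘).oracle Set.univ A) c (Data.ofNats v)
      (Data.ofDiscs l) ∧ 𝓘.GammaFin A (towerIndex (v 0)) = discUnion l := by
  obtain ⟨c, hc⟩ := exists_program_GammaFin
  obtain ⟨d, hd⟩ := BSSComp.pointsToDiscs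
  obtain ⟨e, he⟩ := BSSComp.two_pow_succ
  refine ⟨.comp d (.comp c (.comp e .fst)), fun 𝓘 v A => ?_⟩
  obtain ⟨l, hl, hΓ⟩ := hc 𝓘 A (towerIndex (v 0))
  refine ⟨_, .comp (.comp (.comp (.fst _ _) (he _ (v 0))) (hl.mono ?_)) (hd _ l), ?_⟩
  · rintro _ _ ⟨q, -, h⟩
    exact ⟨q, trivial, h⟩
  · rw [hΓ, discUnion_pointsToDiscs]

lemma tendsto_towerIndex : Tendsto (fun m => (towerIndex m : ℕ)) atTop atTop :=
  (tendsto_pow_atTop_atTop_of_one_lt (r := 2) one_lt_two).comp (tendsto_add_atTop_nat 1)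

theorem isArithmeticTower_gammaFin (𝓘 : InputMaps) (hR : ∀ A, BddAbove (Set.range (𝓘.R A))) :
    (spectralProblem 𝓘).IsArithmeticTower 1 fun v A => gammaFinCompact 𝓘 A (towerIndex (v 0)) where
  general v := isGeneralAlgorithm_of_gammaInput 𝓘 (towerIndex (v 0)) _ fun A B h =>
    TopologicalSpace.NonemptyCompacts.ext (GammaFin_eq_of_gammaInput_eq h)
  computable := by
    obtain ⟨c, hc⟩ := exists_program_tower
    exact ⟨c, hc 𝓘⟩
  limit A := by
    -- The inner iterated limit has height `0`, which means equality.
    refine ⟨fun m => gammaFinCompact 𝓘 A (towerIndex m), fun m => rfl, ?_⟩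
    rw [tendsto_iff_edist_tendsto_0]
    exact (𝓘.tendsto_GammaFin A (hR A)).comp tendsto_towerIndex

lemma dist_gammaHatCompact_le (𝓘 : InputMaps) (A : BDO) (m : ℕ) :
    dist (gammaHatCompact 𝓘 A (towerIndex m)) (gammaFinCompact 𝓘 A (towerIndex m)) ≤
      (2 : ℝ)⁻¹ ^ m := by
  have h := 𝓘.hausdorffEDist_GammaHat_le A (towerIndex m).pos
  have h1 : 2 / ((towerIndex m : ℕ) : ℝ) = (2 : ℝ)⁻¹ ^ m := by
    change 2 / ((2 ^ (m + 1) : ℕ) : ℝ) = _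
    rw [inv_pow]
    push_cast
    rw [pow_succ]
    field_simp
  rw [h1] at h
  rw [dist_edist]
  exact ENNReal.toReal_le_of_le_ofReal (by positivity) h

/-! ### Spectra that are not finite unions of discs -/

/-- The diagonal operator with entries `1 / (1 + |i|)`. -/
noncomputable def harmonicDiagonal : E →L[ℂ] E :=
  weightedShift (fun i => ((1 / (1 + |(i : ℝ)|) : ℝ) : ℂ)) 0 1 fun i => by
    rw [Complex.norm_real, Real.norm_eq_abs, abs_of_nonneg (by positivity)]
    exact div_le_one_of_le₀ (by linarith [abs_nonneg (i : ℝ)]) (by positivity)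

lemma harmonicDiagonal_apply (x : E) (i : ℤ) :
    (harmonicDiagonal x : ℤ → ℂ) i = ((1 / (1 + |(i : ℝ)|) : ℝ) : ℂ) * (x : ℤ → ℂ) i := by
  change _ * (x : ℤ → ℂ) (i + 0) = _
  rw [add_zero]

lemma entry_harmonicDiagonal (i j : ℤ) :
    entry harmonicDiagonal i j = if i = j then ((1 / (1 + |(i : ℝ)|) : ℝ) : ℂ) else 0 := by
  rw [entry, harmonicDiagonal_apply]
  split_ifs with h
  · subst h; simp [basisVec]
  · rw [basisVec, lp.single_apply_ne _ _ _ h, mul_zero]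

/-- Makes the spectrum real, so that it contains no disc of positive radius. -/
lemma isSelfAdjoint_harmonicDiagonal : IsSelfAdjoint harmonicDiagonal := by
  refine ext_entry fun i j => ?_
  have h1 : entry (star harmonicDiagonal) i j = star (entry (transp harmonicDiagonal) i j) := by
    rw [entry, entry, transp_apply, star_basisVec, lp.coeFn_star, Pi.star_apply, star_star]
    rfl
  rw [h1, entry_transp, entry_harmonicDiagonal, entry_harmonicDiagonal]
  by_cases h : i = j
  · subst h; simp
  · rw [if_neg h, if_neg (Ne.symm h), star_zero]

lemma mem_spectrum_harmonicDiagonal (j : ℤ) :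
    ((1 / (1 + |(j : ℝ)|) : ℝ) : ℂ) ∈ spectrum ℂ harmonicDiagonal := by
  intro hu
  have h := (ContinuousLinearMap.isUnit_iff_bijective.mp hu).1
  have h0 : basisVec j ≠ 0 := fun h => by simpa [h] using norm_basisVec j
  refine h0 (h ?_)
  rw [map_zero]
  change ((1 / (1 + |(j : ℝ)|) : ℝ) : ℂ) • basisVec j - harmonicDiagonal (basisVec j) = 0
  rw [sub_eq_zero]
  ext i
  rw [harmonicDiagonal_apply, lp.coeFn_smul, Pi.smul_apply, smul_eq_mul]
  by_cases hij : i = j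
  · rw [hij]
  · rw [basisVec, lp.single_apply_ne _ _ _ hij, mul_zero, mul_zero]

lemma spectrum_harmonicDiagonal_infinite : (spectrum ℂ harmonicDiagonal).Infinite := by
  refine Set.infinite_of_injective_forall_mem
    (f := fun k : ℕ => ((1 / (1 + |((k : ℤ) : ℝ)|) : ℝ) : ℂ)) (fun a b h => ?_)
    fun k => mem_spectrum_harmonicDiagonal k
  have h1 := Complex.ofReal_injective h
  simp only [Int.cast_natCast, Nat.abs_cast, one_div, inv_inj, add_right_inj, Nat.cast_inj] at h1
  exact h1

/-- A disc of positive radius would put a non-real point into the spectrum; without such discs the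
union is finite, whereas the spectrum is infinite. -/
lemma spectrum_harmonicDiagonal_ne_discUnion (l : List (ℂ × ℝ)) :
    spectrum ℂ harmonicDiagonal ≠ discUnion l := by
  intro h
  by_cases hl : ∃ q ∈ l, 0 < q.2
  · obtain ⟨q, hq, hr⟩ := hl
    have h1 : q.1 ∈ spectrum ℂ harmonicDiagonal := by
      rw [h]; exact ⟨q, hq, Metric.mem_closedBall_self hr.le⟩
    have h2 : q.1 + q.2 * Complex.I ∈ spectrum ℂ harmonicDiagonal := by
      rw [h]; exact ⟨q, hq, by simp [abs_of_pos hr]⟩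
    have e1 := isSelfAdjoint_harmonicDiagonal.im_eq_zero_of_mem_spectrum h1
    have e2 := isSelfAdjoint_harmonicDiagonal.im_eq_zero_of_mem_spectrum h2
    simp [e1] at e2
    exact hr.ne' e2
  -- A disc of radius at most `0` contains at most its centre.
  · push Not at hl
    refine spectrum_harmonicDiagonal_infinite (((l.map Prod.fst).finite_toSet).subset ?_)
    rw [h]
    rintro z ⟨q, hq, hz⟩
    have h1 : dist z q.1 ≤ 0 := (Metric.mem_closedBall.mp hz).trans (hl q hq)
    rw [dist_le_zero.mp h1]
    exact List.mem_map_of_mem hq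

lemma isBanded_harmonicDiagonal : IsBanded harmonicDiagonal :=
  ⟨0, fun i j h => by
    rw [entry_harmonicDiagonal, if_neg]
    rintro rfl
    simp at h⟩

/-- The obstruction is the form of the output: no finite list of discs represents this spectrum,
whatever the machine asks or computes. -/
lemma not_isArithmeticTower_zero (𝓘 : InputMaps)
    (Γ : (Fin 0 → ℕ) → BDO → TopologicalSpace.NonemptyCompacts ℂ) :
    ¬ (spectralProblem 𝓘).IsArithmeticTower 0 Γ := fun h => by
  obtain ⟨c, hc⟩ := h.computable
  let A : BDO := ⟨harmonicDiagonal, subset_closure isBanded_harmonicDiagonal⟩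
  obtain ⟨l, -, hl⟩ := hc Fin.elim0 A
  have h1 : Γ Fin.elim0 A = specCompact A.1 := h.limit A
  rw [h1] at hl
  exact spectrum_harmonicDiagonal_ne_discUnion l hl

theorem SCI_spectralProblem (𝓘 : InputMaps) (hR : ∀ A, BddAbove (Set.range (𝓘.R A))) :
    (spectralProblem 𝓘).SCI = 1 := by
  refine le_antisymm (sInf_le ⟨1, rfl, _, isArithmeticTower_gammaFin 𝓘 hR⟩) (le_sInf ?_)
  rintro m ⟨k, rfl, Γ, hΓ⟩
  rcases k with _ | k
  · exact absurd hΓ (not_isArithmeticTower_zero 𝓘 Γ)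
  · exact_mod_cast Nat.le_add_left 1 k

theorem inPiOne_spectralProblem (𝓘 : InputMaps) (hR : ∀ A, BddAbove (Set.range (𝓘.R A))) :
    (spectralProblem 𝓘).InPiOne :=
  ⟨(SCI_spectralProblem 𝓘 hR).le, _, isArithmeticTower_gammaFin 𝓘 hR,
    fun m A => gammaHatCompact 𝓘 A (towerIndex m), fun m A =>
      ⟨𝓘.spectrum_subset_GammaHat A (towerIndex m).pos, dist_gammaHatCompact_le 𝓘 A m⟩⟩

end BandSpec
open BandSpec in
theorem theorem7p1 :
    -- computation of `Γⁿ_fin(A)` in finitely many arithmetic operations from finitely many inputs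
    (∃ c : Program, ∀ (𝓘 : InputMaps) (A : BDO) (n : ℕ+),
      (neededQueries 𝓘 A n).Finite ∧
      ∃ l : List ℂ,
        Runs ((spectralProblem 𝓘).oracle (neededQueries 𝓘 A n) A) c
          (Data.num (n : ℕ)) (Data.ofPoints l) ∧
        𝓘.GammaFin A n = {z | z ∈ l}) ∧
    -- inclusion
    (∀ (𝓘 : InputMaps) (A : BDO) (n : ℕ+), spectrum ℂ A.1 ⊆ 𝓘.GammaHat A n) ∧
    -- Hausdorff convergence
    (∀ (𝓘 : InputMaps) (A : BDO), BddAbove (Set.range (𝓘.R A)) →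
      Tendsto (fun n => Metric.hausdorffEDist (𝓘.GammaFin A n) (spectrum ℂ A.1)) atTop (𝓝 0) ∧
      Tendsto (fun n => Metric.hausdorffEDist (𝓘.GammaHat A n) (spectrum ℂ A.1)) atTop (𝓝 0)) ∧
    -- classification of the spectral problem
    (∀ 𝓘 : InputMaps,
      (spectralProblem 𝓘).Separates ∧
      (∀ n : ℕ+, (spectralProblem 𝓘).IsGeneralAlgorithm (fun A => 𝓘.GammaFin A n) ∧
        (spectralProblem 𝓘).IsGeneralAlgorithm (fun A => 𝓘.GammaHat A n)) ∧
      ((∀ A : BDO, BddAbove (Set.range (𝓘.R A))) →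
        (spectralProblem 𝓘).SCI = 1 ∧ (spectralProblem 𝓘).InPiOne)) := by
  obtain ⟨c, hc⟩ := exists_program_GammaFin
  exact ⟨⟨c, fun 𝓘 A n => ⟨finite_neededQueries 𝓘 A n, hc 𝓘 A n⟩⟩,
    fun 𝓘 A n => 𝓘.spectrum_subset_GammaHat A n.pos,
    fun 𝓘 A hR => ⟨𝓘.tendsto_GammaFin A hR, 𝓘.tendsto_GammaHat A hR⟩,
    fun 𝓘 => ⟨separates_spectralProblem 𝓘,
      fun n => ⟨isGeneralAlgorithm_GammaFin 𝓘 n, isGeneralAlgorithm_GammaHat 𝓘 n⟩,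
      fun hR => ⟨SCI_spectralProblem 𝓘 hR, inPiOne_spectralProblem 𝓘 hR⟩⟩⟩
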